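/- **Setting.** All logarithms are to base 2. An adversarial channel consists of finite alphabets $\mathcal X,\mathcal S,\mathcal Y$, nonempty convex sets $\lambda_x\subseteq\Delta(\mathcal X)$ and $\lambda_s\subseteq\Delta(\mathcal S)$ of admissible input and noise distributions, and a deterministic law $W:\mathcal X\times\mathcal S\to\mathcal Y$, applied letter by letter to words. The type $\tau_v$ of a word $v$ of length $n$ is its empirical distribution; $\mathcal T_n(\tau)$ is the set of words of length $n$ and type $\tau$; a noise word $s\in\mathcal S^n$ is admissible if $\tau_s\in\lambda_s$. Let $$C=\max_{P\in\lambda_x}\ \min_{V}\ I(x;y),$$ where $V=P_{s|x}$ ranges over the conditional distributions for which the $s$-marginal of $P\,V$ lies in $\lambda_s$, and $(x,y)$ is distributed as $x\sim P$, $s\sim V(\cdot|x)$, $y=W(x,s)$ (in general the minimum is an infimum). Let $P^*\in\lambda_x$ attain the maximum. A set of words of $\mathcal X^n$ is confusable if there is one $y\in\mathcal Y^n$ such that each $x$ in the set satisfies $W(x,s)=y$ for some admissible $s$. For an integer $L$, a code $\mathcal K\subseteq\mathcal X^n$ is $(L-1)$-list decodable if no $L$ distinct codewords are confusable; an indexed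 code $(x_1,\dots,x_M)$ is $(L-1)$-list decodable with respect to messages if there are no $L$ distinct indices whose codewords are confusable (indices may share a codeword). The list size $L(\cdot)$ of a code, or of an indexed code with respect to messages, is the least such $L$. Let $N$ be a set of blocklengths along which the admissible noise types become dense in $\lambda_s$ (for all $Q\in\lambda_s$ and $\varepsilon>0$, for all large $n\in N$ some type of a word in $\mathcal S^n$ lies in $\lambda_s$ and is within $\varepsilon$ of $Q$). For $n\in N$ let $\tau_n$ be a type of words of $\mathcal X^n$, with $\tau_n\to P^*$ as $n\to\infty$ in $N$ (for example $\tau_n=P^*$, if $P^*$ is itself a type for every $n\in N$). Let $\delta>0$, $R=C-\delta$, $M_n=\lfloor 2^{nR}\rfloor$, and $$b_n=2^{-n\delta+\frac2\delta\log\frac1\delta}.$$ Say that an integer $L$ is *in range* if $\frac C\delta\le L<\frac{1+\log|\mathcal Y|}\delta+1$ and moreover, in case $\delta\le\min\{1,C/2\}$, $L\le\frac{1+\log|\mathcal Y|}\delta$; in particular, for $0<\delta<C$, the integers in range are $\Theta(1/\delta)$ with constants depending only on the channel. A random code consists of $M_n$ codewords drawn independently and uniformly from $\mathcal T_n(\tau_n)$.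 **Theorem.** 1. For all sufficiently large $n\in N$: for every integer $L<C/\delta$ the random code is $(L-1)$-list decodable with respect to messages with probability at most $b_n$; and its list size with respect to messages is in range with probability at least $1-2^{-n(1-R)}-b_n$. The latter probability also tends to $1$ as $n\to\infty$ in $N$. 2. For all sufficiently large $n\in N$, at least a fraction $1-2^{-n(1-R)}-b_n$ of all codes consisting of $M_n$ distinct words of $\mathcal T_n(\tau_n)$ are $(L-1)$-list decodable for some $L$ in range. 3. If $C<H(P^*)$ (that is, the channel is not noiseless under $P^*$), then for all sufficiently large $n\in N$: for every integer $L<C/\delta$ the set of codewords of the random code is an $(L-1)$-list decodable code with probability at most $b_n$; and at least a fraction $1-2^{-n(1-R)}-b_n$ of all codes consisting of $M_n$ distinct words of $\mathcal T_n(\tau_n)$ have list size $L(\mathcal K)$ in range. The latter fraction also tends to $1$ as $n\to\infty$ in $N$. -/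

import Mathlib

open Filter Topology

noncomputable section

/-- The type (empirical distribution) of a word `v` of length `n`. -/
def wordType {α : Type*} {n : ℕ} (v : Fin n → α) : α → ℝ :=
  fun a => (Set.ncard {i : Fin n | v i = a} : ℝ) / n

/-- The set of all types of words of length `n` over the alphabet `α`. -/
def typesOfLength (α : Type*) (n : ℕ) : Set (α → ℝ) :=
  {τ | ∃ v : Fin n → α, wordType v = τ}

/-- The type class of `τ`: all words of length `n` whose type is `τ`. -/
def typeClass {α : Type*} (n : ℕ) (τ : α → ℝ) : Set (Fin n → α) :=
  {v | wordType v = τ}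

/-- Shannon entropy in bits. -/
def shannonEntropy {α : Type*} [Fintype α] (P : α → ℝ) : ℝ :=
  ∑ a, P a * Real.logb 2 (1 / P a)

/-- Mutual information in bits of a joint distribution (terms with `P (x, y) = 0` are zero). -/
def mutualInformation {α β : Type*} [Fintype α] [Fintype β] (P : α → β → ℝ) : ℝ :=
  ∑ a, ∑ b, P a b * Real.logb 2 (P a b / ((∑ b', P a b') * (∑ a', P a' b)))

/-- Probability of the event `E` under the uniform distribution on a finite type `Ω`,
that is, the fraction of elements of `Ω` lying in `E`. -/
def uniformProb {Ω : Type*} (E : Set Ω) : ℝ :=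
  (E.ncard : ℝ) / Nat.card Ω

/-- An adversarial channel with finite input, noise and output alphabets `X`, `S`, `Y`,
convex sets of admissible input and noise distributions, and a deterministic channel law.
At blocklength `n`, a word is admissible if its type lies in the constraint set. -/
structure AdversarialChannel (X S Y : Type*) [Fintype X] [Fintype S] where
  inputConstraint : Set (X → ℝ)
  inputConstraint_subset : inputConstraint ⊆ stdSimplex ℝ X
  inputConstraint_convex : Convex ℝ inputConstraint
  inputConstraint_nonempty : inputConstraint.Nonempty
  noiseConstraint : Set (S → ℝ)
  noiseConstraint_subset : noiseConstraint ⊆ stdSimplex ℝ S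
  noiseConstraint_convex : Convex ℝ noiseConstraint
  noiseConstraint_nonempty : noiseConstraint.Nonempty
  law : X → S → Y

namespace AdversarialChannel

variable {X S Y : Type*} [Fintype X] [Fintype S] (A : AdversarialChannel X S Y)

/-- The conditional distributions `P_{s|x}` for which the `s`-marginal of `P_x P_{s|x}`
satisfies the noise constraint. -/
def noiseStrategies (P : X → ℝ) : Set (X → S → ℝ) :=
  {V | (∀ x, V x ∈ stdSimplex ℝ S) ∧ (fun s => ∑ x, P x * V x s) ∈ A.noiseConstraint}

open Classical in
/-- The `(x, y)`-marginal of `P_x P_{s|x} W_{y|x,s}`. -/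
def inputOutput (P : X → ℝ) (V : X → S → ℝ) : X → Y → ℝ :=
  fun x y => ∑ s, if A.law x s = y then P x * V x s else 0

/-- `min I(x; y)` over all admissible `P_{s|x}`, for the input distribution `P`. -/
def minInformation [Fintype Y] (P : X → ℝ) : ℝ :=
  sInf ((fun V => mutualInformation (A.inputOutput P V)) '' A.noiseStrategies P)

/-- The list decoding capacity `C = max min I(x; y)`. -/
def capacity [Fintype Y] : ℝ :=
  sSup (A.minInformation '' A.inputConstraint)

/-- `P` is an input distribution attaining the maximum in the capacity. -/
def IsCapacityAchieving [Fintype Y] (P : X → ℝ) : Prop :=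
  P ∈ A.inputConstraint ∧ ∀ P' ∈ A.inputConstraint, A.minInformation P' ≤ A.minInformation P

/-- Admissible noise words of length `n`. -/
def noiseWords (n : ℕ) : Set (Fin n → S) :=
  {s | wordType s ∈ A.noiseConstraint}

/-- A set of words is confusable if a single output word `y` can be reached from each of them
by some admissible noise word. -/
def Confusable {n : ℕ} (l : Set (Fin n → X)) : Prop :=
  ∃ y : Fin n → Y, ∀ x ∈ l, ∃ s ∈ A.noiseWords n, ∀ i, A.law (x i) (s i) = y i

/-- The code `K` (a set of words) is `(L - 1)`-list decodable: no `L` distinct codewords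
are confusable. -/
def IsListDecodable {n : ℕ} (L : ℕ) (K : Set (Fin n → X)) : Prop :=
  ∀ l : Finset (Fin n → X), (l : Set (Fin n → X)) ⊆ K → l.card = L →
    ¬ A.Confusable (l : Set (Fin n → X))

/-- The encoder `c` with `M` messages is `(L - 1)`-list decodable: there are no `L` distinct
messages whose codewords are confusable. (Different messages may share a codeword.) -/
def IsMessageListDecodable {n M : ℕ} (L : ℕ) (c : Fin M → Fin n → X) : Prop :=
  ∀ J : Finset (Fin M), J.card = L → ¬ A.Confusable (c '' (J : Set (Fin M)))

/-- The least `L` for which the code `K` is `(L - 1)`-list decodable. -/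
def listSize {n : ℕ} (K : Set (Fin n → X)) : ℕ :=
  sInf {L | A.IsListDecodable L K}

/-- The least `L` for which the encoder `c` is `(L - 1)`-list decodable. -/
def messageListSize {n M : ℕ} (c : Fin M → Fin n → X) : ℕ :=
  sInf {L | A.IsMessageListDecodable L c}

/-- `L` lies in `[C / δ, (1 + log |Y|) / δ]`. The right end is rounded up to an integer when
`δ > 1` or `δ > C / 2`; otherwise it is not rounded. -/
def ListSizeRange [Fintype Y] (δ : ℝ) (L : ℕ) : Prop :=
  A.capacity / δ ≤ L ∧
  (L : ℝ) < (1 + Real.logb 2 (Fintype.card Y)) / δ + 1 ∧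
  (δ ≤ 1 → 2 * δ ≤ A.capacity → (L : ℝ) ≤ (1 + Real.logb 2 (Fintype.card Y)) / δ)

/-- Along the blocklengths in `N`, the admissible noise types become dense in the noise
constraint set. -/
def NoiseTypesDense (N : Set ℕ) : Prop :=
  ∀ Q ∈ A.noiseConstraint, ∀ ε > 0, ∀ᶠ n in atTop ⊓ 𝓟 N,
    ∃ σ ∈ A.noiseConstraint ∩ typesOfLength S n, ∀ s, |σ s - Q s| < ε

end AdversarialChannel

/-- The number `2 ^ (n R)` of codewords of a code of blocklength `n` and rate `R`, rounded down. -/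
def codeSize (n : ℕ) (R : ℝ) : ℕ :=
  ⌊(2 : ℝ) ^ ((n : ℝ) * R)⌋₊

/-- A random code: `M` codewords drawn independently and uniformly from the type class of `τ`
is a uniformly random element of this type. -/
abbrev CodewordTuple {X : Type*} (n M : ℕ) (τ : X → ℝ) : Type _ :=
  Fin M → typeClass n τ

/-- The words making up a tuple of codewords. -/
def CodewordTuple.encoder {X : Type*} {n M : ℕ} {τ : X → ℝ} (c : CodewordTuple n M τ) :
    Fin M → Fin n → X :=
  fun m => (c m : Fin n → X)

/-- The `τ`-constant composition codes with `M` codewords of length `n`. -/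
abbrev ConstCompCode {X : Type*} (n M : ℕ) (τ : X → ℝ) : Type _ :=
  {K : Set (Fin n → X) // K ⊆ typeClass n τ ∧ K.ncard = M}

end

/-! The proof combines the method of types with one union bound and one second moment argument.
Write `M` for the number of codewords. By Stirling, type classes have size `2^(nH)` up to polynomial
factors, so the words with a given joint type with `y` form a fraction `2^(-nI)` of the type class
(`abs_log_conditionalTypeClass_add_le`). Since the capacity bounds the information of every
admissible joint distribution from below, and some such distribution nearly attains it, two facts
follow for every `ε > 0` and large `n`. Every output is reachable from at most a fraction
`2^(-n(C-ε))` of the type class (`eventually_uniformProb_reaches_le`). Conversely, a single joint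
type defines a biregular graph of density `p ≥ 2^(-n(C+ε))` between the type class and a set of
outputs, all of whose edges are reachable pairs (`eventually_exists_biregular`).

Large `L`: a union bound over outputs and lists gives failure probability at most `M^L |Y|^n
2^(-nL(C-ε))`, whose exponent is `-n(L(δ-ε) - log|Y|)`. Some `L` in range makes this at most
`2^(-n(1-R))` and also exponentially small, even if `R ≥ 1` (`exists_sufficient_listSize`).

Small `L`, with `Lδ < C`: take `L` blocks of `m` random words and count the transversals with a
common neighbour, averaged over outputs. With `q = mp` the mean is `q^L`; biregularity bounds the
second moment by `2^L q^(2L)` as soon as `m q^(L-1) ≥ 1`, which is the condition `Lδ < C` up to `ε`.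
By Cauchy–Schwarz a confusable list exists with probability bounded below
(`le_uniformProb_exists_common_neighbour`). The code contains `n^2` disjoint systems of such blocks,
so all fail with probability at most `(1-p₀)^(n^2)`, which is below `2^(-nδ+b)` for any constant
`b`.

If lists must consist of distinct words, `C < H(P)` makes the neighbourhoods exponentially large, so
injective transversals are a constant fraction of all. Decodability passes to subcodes, and a
uniform `M`-subset is no more likely to lie in a family closed under subsets than the set of `M`
independent words (`uniformProb_finset_card_le_uniformProb_tuple`); this transfers the bound to
codes with distinct words. Monotonicity in `L` then locates the least list size
(`le_uniformProb_listSizeRange_sInf`). -/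

noncomputable section

/-! ### Types of words and the size of a type class -/

section Types

variable {α β : Type*} {n : ℕ}

open Classical in
lemma wordType_eq_sum (v : Fin n → α) (a : α) :
    wordType v a = (∑ i, if v i = a then (1 : ℝ) else 0) / n := by
  have : {i : Fin n | v i = a} = ((Finset.univ.filter fun i => v i = a : Finset (Fin n)) :
      Set (Fin n)) := by ext; simp
  rw [wordType, this, Set.ncard_coe_finset, Finset.sum_boole]

lemma wordType_nonneg (v : Fin n → α) (a : α) : 0 ≤ wordType v a := by
  unfold wordType; positivity

lemma ncard_eq_mul_wordType (v : Fin n → α) (a : α) :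
    ((Set.ncard {i : Fin n | v i = a} : ℕ) : ℝ) = n * wordType v a := by
  rcases Nat.eq_zero_or_pos n with rfl | hn
  · have : {i : Fin 0 | v i = a} = ∅ := Set.eq_empty_of_isEmpty _
    simp [this]
  · unfold wordType; field_simp

lemma sum_wordType [Fintype α] (hn : n ≠ 0) (v : Fin n → α) : ∑ a, wordType v a = 1 := by
  classical
  simp_rw [wordType_eq_sum, ← Finset.sum_div]
  rw [Finset.sum_comm]
  simp [hn]

lemma wordType_mem_stdSimplex [Fintype α] (hn : n ≠ 0) (v : Fin n → α) :
    wordType v ∈ stdSimplex ℝ α :=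
  ⟨wordType_nonneg v, sum_wordType hn v⟩

open Classical in
lemma wordType_comp [Fintype α] (f : α → β) (v : Fin n → α) (b : β) :
    wordType (fun i => f (v i)) b = ∑ a, if f a = b then wordType v a else 0 := by
  simp_rw [wordType_eq_sum]
  have : ∀ a, (if f a = b then (∑ i, if v i = a then (1 : ℝ) else 0) / n else 0)
      = (∑ i, if f a = b then if v i = a then (1 : ℝ) else 0 else 0) / n := by
    intro a; split_ifs <;> simp
  simp_rw [this, ← Finset.sum_div]
  rw [Finset.sum_comm]
  congr 1
  refine Finset.sum_congr rfl fun i _ => ?_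
  rw [Finset.sum_eq_single (v i)]
  · simp
  · intro a _ ha; simp [Ne.symm ha]
  · simp

lemma wordType_fst [Fintype α] [Fintype β] (v : Fin n → α × β) (a : α) :
    wordType (fun i => (v i).1) a = ∑ b, wordType v (a, b) := by
  classical
  rw [wordType_comp Prod.fst, Fintype.sum_prod_type, Finset.sum_eq_single a]
  · simp
  · intro a' _ ha; simp [ha]
  · simp

lemma wordType_snd [Fintype α] [Fintype β] (v : Fin n → α × β) (b : β) :
    wordType (fun i => (v i).2) b = ∑ a, wordType v (a, b) := by
  classical
  rw [wordType_comp Prod.snd, Fintype.sum_prod_type]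
  refine Finset.sum_congr rfl fun a _ => ?_
  simp

lemma wordType_comp_perm (v : Fin n → α) (π : Equiv.Perm (Fin n)) :
    wordType (v ∘ π) = wordType v := by
  classical
  funext a
  rw [wordType_eq_sum, wordType_eq_sum]
  congr 1
  exact Equiv.sum_comp π (fun i => if v i = a then (1 : ℝ) else 0)

lemma exists_perm_of_wordType_eq {v w : Fin n → α} (h : wordType v = wordType w) :
    ∃ π : Equiv.Perm (Fin n), w = v ∘ π := by
  classical
  have hc : ∀ a, Set.ncard {i : Fin n | w i = a} = Set.ncard {i : Fin n | v i = a} := by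
    intro a
    have := ncard_eq_mul_wordType v a
    rw [h, ← ncard_eq_mul_wordType w a] at this
    exact_mod_cast this.symm
  have e : ∀ a, {i // w i = a} ≃ {i // v i = a} := fun a =>
    (Finite.card_eq.mp (hc a)).some
  exact ⟨Equiv.ofFiberEquiv e, funext fun i => (Equiv.ofFiberEquiv_map e i).symm⟩

/-- Orbit–stabilizer: coordinate permutations act transitively on the type class, each fibre of `g ↦
v ∘ g` is a coset of the stabilizer of `v`, and the stabilizer permutes the positions of each letter
separately. -/
lemma factorial_eq_ncard_typeClass_mul [Fintype α] (v : Fin n → α) :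
    n.factorial = (typeClass n (wordType v)).ncard *
      ∏ a, (Set.ncard {i : Fin n | v i = a}).factorial := by
  classical
  set T : Finset (Fin n → α) := (typeClass n (wordType v)).toFinite.toFinset with hT
  have hmaps : ∀ g ∈ (Finset.univ : Finset (Equiv.Perm (Fin n))), v ∘ g ∈ T := by
    intro g _
    simp [hT, typeClass, wordType_comp_perm]
  have h := Finset.card_eq_sum_card_fiberwise hmaps
  rw [Finset.card_univ, Fintype.card_perm, Fintype.card_fin] at h
  rw [h, Finset.sum_const_nat (m := ∏ a, (Set.ncard {i : Fin n | v i = a}).factorial),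
    Set.ncard_eq_toFinset_card]
  intro w hw
  obtain ⟨π, rfl⟩ : ∃ π : Equiv.Perm (Fin n), w = v ∘ π := by
    refine exists_perm_of_wordType_eq ?_
    simpa [hT, typeClass, eq_comm] using hw
  rw [← DomMulAct.stabilizer_ncard v, ← Set.ncard_coe_finset]
  refine (Set.ncard_congr (fun g _ => g * π) ?_ ?_ ?_).symm
  · intro g hg
    have hg' : v ∘ g = v := hg
    have : v ∘ (g * π) = v ∘ π := by
      rw [Equiv.Perm.coe_mul, ← Function.comp_assoc, hg']
    simpa using this
  · intro a b _ _ hab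
    exact mul_right_cancel hab
  · intro g hg
    have hg' : v ∘ g = v ∘ π := by simpa using hg
    refine ⟨g * π⁻¹, ?_, by simp⟩
    change v ∘ (g * π⁻¹) = v
    rw [Equiv.Perm.coe_mul, ← Function.comp_assoc, hg', Function.comp_assoc, ← Equiv.Perm.coe_mul]
    simp

lemma log_factorial_lower (k : ℕ) : k * Real.log k - k ≤ Real.log k.factorial := by
  rcases Nat.eq_zero_or_pos k with rfl | hk
  · simp
  have h := Real.pow_div_factorial_le_exp (k : ℝ) (by positivity) k
  have hk' : (0 : ℝ) < k := by exact_mod_cast hk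
  have := Real.log_le_log (by positivity) h
  rw [Real.log_exp, Real.log_div (by positivity) (by positivity), Real.log_pow] at this
  linarith

lemma log_factorial_upper (k : ℕ) :
    Real.log k.factorial ≤ k * Real.log k - k + (1 + Real.log (k + 1)) := by
  -- The induction step amounts to `log (k / (k + 1)) ≤ -1 / (k + 1)`.
  have key : ∀ k : ℕ, 1 ≤ k → Real.log k.factorial ≤ (k + 1) * Real.log k - k + 1 := by
    intro k hk
    induction k, hk using Nat.le_induction with
    | base => simp
    | succ k hk ih =>
      have hk' : (0 : ℝ) < k := by exact_mod_cast hk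
      have h1 := Real.log_le_sub_one_of_pos (show (0 : ℝ) < k / (k + 1) by positivity)
      rw [Real.log_div (by positivity) (by positivity)] at h1
      have h2 : (k : ℝ) / (k + 1) - 1 = - (1 / (k + 1)) := by field_simp; ring
      rw [h2] at h1
      have h3 : (k + 1 : ℝ) * (Real.log k - Real.log (k + 1)) ≤ -1 := by
        calc _ ≤ (k + 1 : ℝ) * (- (1 / (k + 1))) :=
              mul_le_mul_of_nonneg_left h1 (by positivity)
          _ = -1 := by field_simp
      rw [Nat.factorial_succ, Nat.cast_mul, Real.log_mul (by positivity) (by positivity)]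
      push_cast
      nlinarith
  rcases Nat.eq_zero_or_pos k with rfl | hk
  · simp
  · have := key k hk
    have h4 : Real.log k ≤ Real.log (k + 1) :=
      Real.log_le_log (by exact_mod_cast hk) (by linarith)
    linarith

lemma log_two_mul_shannonEntropy [Fintype α] (P : α → ℝ) :
    shannonEntropy P * Real.log 2 = ∑ a, P a * Real.log (1 / P a) := by
  have h2 : Real.log 2 ≠ 0 := (Real.log_pos one_lt_two).ne'
  unfold shannonEntropy
  rw [Finset.sum_mul]
  refine Finset.sum_congr rfl fun a _ => ?_
  rw [Real.logb]; field_simp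

/-- The linear Stirling terms cancel because the letter counts sum to `n`. Each of the `|α| + 1`
factorials in the multinomial coefficient costs at most `1 + log (n + 1)`. -/
lemma abs_log_ncard_typeClass_sub_le [Fintype α] (v : Fin n → α) :
    |Real.log (typeClass n (wordType v)).ncard - n * (shannonEntropy (wordType v) * Real.log 2)|
      ≤ (Fintype.card α + 1) * (1 + Real.log (n + 1)) := by
  classical
  set k : α → ℕ := fun a => Set.ncard {i : Fin n | v i = a} with hk
  have hf := factorial_eq_ncard_typeClass_mul v
  have hT0 : (typeClass n (wordType v)).ncard ≠ 0 := by
    intro h; rw [h, zero_mul] at hf; exact n.factorial_ne_zero hf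
  have hlog : Real.log n.factorial = Real.log (typeClass n (wordType v)).ncard
      + ∑ a, Real.log (k a).factorial := by
    rw [hf, Nat.cast_mul, Real.log_mul (by exact_mod_cast hT0), Nat.cast_prod, Real.log_prod]
    · intro a _; exact_mod_cast (k a).factorial_ne_zero
    · rw [Nat.cast_prod]; exact Finset.prod_ne_zero_iff.2 fun a _ => by
        exact_mod_cast (k a).factorial_ne_zero
  have hka : ∀ a, ((k a : ℕ) : ℝ) = n * wordType v a := ncard_eq_mul_wordType v
  have hkn : ∀ a, k a ≤ n := fun a => by
    simpa using Set.ncard_le_card {i : Fin n | v i = a}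
  have hsum : n ≠ 0 → ∑ a, (k a : ℝ) = n := by
    intro hn
    simp_rw [hka, ← Finset.mul_sum, sum_wordType hn v, mul_one]
  have hH : n * (shannonEntropy (wordType v) * Real.log 2)
      = n * Real.log n - ∑ a, (k a : ℝ) * Real.log (k a) := by
    rcases Nat.eq_zero_or_pos n with h0 | hn
    · have : ∀ a, k a = 0 := fun a => by have := hkn a; omega
      simp [h0, this]
    have hn' : (0 : ℝ) < n := by exact_mod_cast hn
    rw [log_two_mul_shannonEntropy, Finset.mul_sum]
    calc ∑ a, n * (wordType v a * Real.log (1 / wordType v a))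
        = ∑ a, ((k a : ℝ) * Real.log n - (k a : ℝ) * Real.log (k a)) := by
          refine Finset.sum_congr rfl fun a _ => ?_
          rcases eq_or_ne (k a) 0 with h0 | h0
          · have h1 : wordType v a = 0 := by
              have := hka a; rw [h0] at this
              simpa [hn'.ne'] using this.symm
            simp [h0, h1]
          · have h1 : wordType v a = k a / n := by rw [hka]; field_simp
            have h2 : (k a : ℝ) ≠ 0 := by exact_mod_cast h0
            rw [h1, one_div_div, Real.log_div hn'.ne' h2]
            field_simp
      _ = _ := by rw [Finset.sum_sub_distrib, ← Finset.sum_mul, hsum hn.ne']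
  have hL : 0 ≤ Real.log ((n : ℝ) + 1) := Real.log_nonneg (by linarith [n.cast_nonneg (α := ℝ)])
  have hs : ∑ a, (k a : ℝ) = n := by
    rcases Nat.eq_zero_or_pos n with h0 | hn
    · have : ∀ a, k a = 0 := fun a => by have := hkn a; omega
      simp [h0, this]
    · exact hsum hn.ne'
  have hl1 : ∑ a, ((k a : ℝ) * Real.log (k a) - k a) ≤ ∑ a, Real.log (k a).factorial :=
    Finset.sum_le_sum fun a _ => log_factorial_lower (k a)
  have hl2 : ∑ a, Real.log (k a).factorial
      ≤ ∑ a, ((k a : ℝ) * Real.log (k a) - k a + (1 + Real.log (n + 1))) := by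
    refine Finset.sum_le_sum fun a _ => (log_factorial_upper (k a)).trans ?_
    have : Real.log (k a + 1) ≤ Real.log (n + 1) :=
      Real.log_le_log (by positivity) (by have := hkn a; gcongr)
    linarith
  rw [Finset.sum_sub_distrib, hs] at hl1
  rw [Finset.sum_add_distrib, Finset.sum_sub_distrib, hs, Finset.sum_const, Finset.card_univ,
    nsmul_eq_mul] at hl2
  have h1 := log_factorial_lower n
  have h2 := log_factorial_upper n
  rw [hH, abs_le]
  have hc : (0 : ℝ) ≤ Fintype.card α := by positivity
  constructor <;> nlinarith

end Types

/-! ### Conditional type classes -/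

section Conditional

variable {X Y : Type*} {n : ℕ}

/-- The words `x'` whose joint type with `y` is `Q`. -/
def conditionalTypeClass (Q : X × Y → ℝ) (y : Fin n → Y) : Set (Fin n → X) :=
  {x' | wordType (fun i => (x' i, y i)) = Q}

lemma ncard_setOf_comp_perm {p q : (Fin n → X) → Prop} (π : Equiv.Perm (Fin n))
    (h : ∀ x, p x ↔ q (x ∘ π)) : {x | p x}.ncard = {x | q x}.ncard := by
  refine Set.ncard_congr (fun x _ => x ∘ π) (fun x hx => (h x).1 hx) ?_ ?_
  · intro a b _ _ hab
    exact π.surjective.injective_comp_right hab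
  · intro x hx
    have hx' : x = (x ∘ π.symm) ∘ π := by funext i; simp
    refine ⟨x ∘ π.symm, (h _).2 ?_, hx'.symm⟩
    rw [← hx']; exact hx

lemma ncard_conditionalTypeClass_congr (Q : X × Y → ℝ) {y y' : Fin n → Y}
    (h : wordType y = wordType y') :
    (conditionalTypeClass Q y).ncard = (conditionalTypeClass Q y').ncard := by
  obtain ⟨π, rfl⟩ := exists_perm_of_wordType_eq h
  refine ncard_setOf_comp_perm π fun x => ?_
  rw [← wordType_comp_perm _ π]; rfl

lemma ncard_conditionalTypeClass_congr' (Q : X × Y → ℝ) {x x' : Fin n → X}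
    (h : wordType x = wordType x') :
    {y : Fin n → Y | wordType (fun i => (x i, y i)) = Q}.ncard
      = {y : Fin n → Y | wordType (fun i => (x' i, y i)) = Q}.ncard := by
  obtain ⟨π, rfl⟩ := exists_perm_of_wordType_eq h
  refine ncard_setOf_comp_perm π fun y => ?_
  rw [← wordType_comp_perm _ π]; rfl

/-- Project the joint type class to the second coordinate: the fibres are conditional type classes,
and permuting coordinates shows that they all have the same size. -/
lemma ncard_typeClass_prod [Finite X] [Finite Y] (v : Fin n → X × Y) :
    (typeClass n (wordType v)).ncard = (typeClass n (wordType fun i => (v i).2)).ncard *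
      (conditionalTypeClass (wordType v) fun i => (v i).2).ncard := by
  classical
  cases nonempty_fintype X
  cases nonempty_fintype Y
  have hsnd : ∀ w : Fin n → X × Y, wordType w = wordType v →
      wordType (fun i => (w i).2) = wordType fun i => (v i).2 := by
    intro w hw; funext b; rw [wordType_snd, wordType_snd, hw]
  set T : Finset (Fin n → X × Y) := (typeClass n (wordType v)).toFinite.toFinset with hT
  set B : Finset (Fin n → Y) := (typeClass n (wordType fun i => (v i).2)).toFinite.toFinset with hB
  have hmaps : ∀ w ∈ T, (fun i => (w i).2) ∈ B := by
    intro w hw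
    have hw' : wordType w = wordType v := by simpa [hT, typeClass] using hw
    simpa [hB, typeClass] using hsnd w hw'
  rw [Set.ncard_eq_toFinset_card _ (typeClass n (wordType v)).toFinite,
    Set.ncard_eq_toFinset_card _ (typeClass n (wordType fun i => (v i).2)).toFinite,
    Finset.card_eq_sum_card_fiberwise hmaps]
  refine Finset.sum_const_nat fun y hy => ?_
  have hy' : wordType y = wordType fun i => (v i).2 := by simpa [hB, typeClass] using hy
  rw [← ncard_conditionalTypeClass_congr (wordType v) hy', ← Set.ncard_coe_finset]
  refine Set.ncard_congr (fun w _ i => (w i).1) ?_ ?_ ?_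
  · intro w hw
    simp only [Finset.coe_filter, hT, Set.Finite.mem_toFinset, Set.mem_ofPred_eq] at hw
    obtain ⟨h1, rfl⟩ := hw
    exact h1
  · intro w w' hw hw' h
    simp only [Finset.coe_filter, Set.mem_ofPred_eq] at hw hw'
    funext i
    exact Prod.ext (congrFun h i) (congrFun (hw.2.trans hw'.2.symm) i)
  · intro x hx
    refine ⟨fun i => (x i, y i), ?_, rfl⟩
    simp only [Finset.coe_filter, hT, Set.Finite.mem_toFinset, Set.mem_ofPred_eq, and_true]
    exact hx

/-- The set of types of words of length `n` has polynomial size. -/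
lemma ncard_typesOfLength_le (α : Type*) [Fintype α] (n : ℕ) :
    (typesOfLength α n).Finite ∧ (typesOfLength α n).ncard ≤ (n + 1) ^ Fintype.card α := by
  classical
  have hsub : typesOfLength α n ⊆
      Set.range fun k : α → Fin (n + 1) => fun a => ((k a : ℕ) : ℝ) / n := by
    rintro _ ⟨v, rfl⟩
    have hkn : ∀ a, Set.ncard {i : Fin n | v i = a} ≤ n := fun a => by
      simpa using Set.ncard_le_card {i : Fin n | v i = a}
    exact ⟨fun a => ⟨_, Nat.lt_succ_of_le (hkn a)⟩, rfl⟩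
  refine ⟨(Set.finite_range _).subset hsub, (Set.ncard_le_ncard hsub (Set.finite_range _)).trans ?_⟩
  rw [← Set.image_univ]
  refine (Set.ncard_image_le Set.finite_univ).trans ?_
  simp [Set.ncard_univ]

end Conditional

/-! ### Mutual information through entropies -/

section Information

variable {α β : Type*} [Fintype α] [Fintype β]

/-- This form links information to type class sizes and gives continuity up to the boundary of the
simplex, where the quotient inside the logarithm degenerates. -/
lemma mutualInformation_eq_entropies (P : α → β → ℝ) (hP : ∀ a b, 0 ≤ P a b) :
    mutualInformation P = shannonEntropy (fun a => ∑ b, P a b)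
      + shannonEntropy (fun b => ∑ a, P a b) - shannonEntropy (fun p : α × β => P p.1 p.2) := by
  have key : ∀ a b, P a b * Real.logb 2 (P a b / ((∑ b', P a b') * ∑ a', P a' b))
      = P a b * Real.logb 2 (1 / ∑ b', P a b') + P a b * Real.logb 2 (1 / ∑ a', P a' b)
        - P a b * Real.logb 2 (1 / P a b) := by
    intro a b
    rcases (hP a b).eq_or_lt with h | h
    · simp [← h]
    have h1 : 0 < ∑ b', P a b' :=
      h.trans_le (Finset.single_le_sum (fun b _ => hP a b) (Finset.mem_univ b))
    have h2 : 0 < ∑ a', P a' b :=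
      h.trans_le (Finset.single_le_sum (f := fun a => P a b) (fun a _ => hP a b)
        (Finset.mem_univ a))
    rw [Real.logb_div h.ne' (by positivity), Real.logb_mul h1.ne' h2.ne', one_div, one_div, one_div,
      Real.logb_inv, Real.logb_inv, Real.logb_inv]
    ring
  unfold mutualInformation shannonEntropy
  simp_rw [key, Finset.sum_sub_distrib, Finset.sum_add_distrib]
  rw [Fintype.sum_prod_type]
  congr 2
  · simp_rw [Finset.sum_mul]
  · rw [Finset.sum_comm]; simp_rw [Finset.sum_mul]

/-- The conditional class has size `|T(x,y)| / |T(y)|`, so the logarithm of the ratio is `n (H(x,y)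
- H(y) - H(x)) = -n I` in nats. The constant adds the three errors `|X||Y| + 1`, `|X| + 1` and `|Y|
+ 1`. -/
lemma abs_log_conditionalTypeClass_add_le {X Y : Type*} [Fintype X] [Fintype Y] {n : ℕ}
    (v : Fin n → X × Y) :
    |Real.log ((conditionalTypeClass (wordType v) fun i => (v i).2).ncard
        / (typeClass n (wordType fun i => (v i).1)).ncard)
      + n * (mutualInformation (fun a b => wordType v (a, b)) * Real.log 2)|
      ≤ (Fintype.card X * Fintype.card Y + Fintype.card X + Fintype.card Y + 3)
        * (1 + Real.log (n + 1)) := by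
  have h := ncard_typeClass_prod v
  have hc : ((conditionalTypeClass (wordType v) fun i => (v i).2).ncard : ℝ) ≠ 0 := by
    have : (conditionalTypeClass (wordType v) fun i => (v i).2).ncard ≠ 0 :=
      (Set.ncard_pos (Set.toFinite _)).2
        (⟨fun i => (v i).1, rfl⟩ :
          (conditionalTypeClass (wordType v) fun i => (v i).2).Nonempty) |>.ne'
    exact_mod_cast this
  have hx := (Set.ncard_pos (Set.toFinite _)).2
    (⟨fun i => (v i).1, rfl⟩ : (typeClass n (wordType fun i => (v i).1)).Nonempty) |>.ne'
  have hy := (Set.ncard_pos (Set.toFinite _)).2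
    (⟨fun i => (v i).2, rfl⟩ : (typeClass n (wordType fun i => (v i).2)).Nonempty) |>.ne'
  have hlog : Real.log (typeClass n (wordType v)).ncard
      = Real.log (typeClass n (wordType fun i => (v i).2)).ncard
        + Real.log (conditionalTypeClass (wordType v) fun i => (v i).2).ncard := by
    rw [h, Nat.cast_mul, Real.log_mul (by exact_mod_cast hy) hc]
  rw [mutualInformation_eq_entropies _ fun a b => wordType_nonneg v _,
    Real.log_div hc (by exact_mod_cast hx)]
  have e1 : (fun a => ∑ b, wordType v (a, b)) = wordType fun i => (v i).1 :=
    funext fun a => (wordType_fst v a).symm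
  have e2 : (fun b => ∑ a, wordType v (a, b)) = wordType fun i => (v i).2 :=
    funext fun a => (wordType_snd v a).symm
  rw [e1, e2]
  have h1 := abs_le.1 (abs_log_ncard_typeClass_sub_le v)
  have h2 := abs_le.1 (abs_log_ncard_typeClass_sub_le fun i => (v i).1)
  have h3 := abs_le.1 (abs_log_ncard_typeClass_sub_le fun i => (v i).2)
  simp only [Fintype.card_prod, Nat.cast_mul] at h1
  rw [abs_le]
  change _ ∧ _ + (n : ℝ) * ((_ + _ - shannonEntropy (wordType v)) * _) ≤ _
  change _ ≤ _ + (n : ℝ) * ((_ + _ - shannonEntropy (wordType v)) * _) ∧ _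
  constructor <;> nlinarith

end Information


/-! ### Continuity and bounds for entropy -/

section Entropy

variable {α β : Type*} [Fintype α] [Fintype β]

lemma shannonEntropy_eq_sum_negMulLog (P : α → ℝ) :
    shannonEntropy P = (∑ a, Real.negMulLog (P a)) / Real.log 2 := by
  unfold shannonEntropy
  rw [Finset.sum_div]
  refine Finset.sum_congr rfl fun a _ => ?_
  rw [Real.logb, one_div, Real.log_inv, Real.negMulLog]; ring

lemma continuous_shannonEntropy : Continuous (shannonEntropy : (α → ℝ) → ℝ) := by
  have : (shannonEntropy : (α → ℝ) → ℝ)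
      = fun P => (∑ a, Real.negMulLog (P a)) / Real.log 2 :=
    funext shannonEntropy_eq_sum_negMulLog
  rw [this]
  refine Continuous.div_const ?_ _
  exact continuous_finsetSum _ fun a _ => Real.continuous_negMulLog.comp (continuous_apply a)

lemma shannonEntropy_nonneg {P : α → ℝ} (hP : P ∈ stdSimplex ℝ α) : 0 ≤ shannonEntropy P := by
  rw [shannonEntropy_eq_sum_negMulLog]
  refine div_nonneg (Finset.sum_nonneg fun a _ => Real.negMulLog_nonneg (hP.1 a) ?_)
    (Real.log_nonneg one_le_two)
  rw [← hP.2]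
  exact Finset.single_le_sum (fun a _ => hP.1 a) (Finset.mem_univ a)

lemma shannonEntropy_le_logb_card {P : α → ℝ} (hP : P ∈ stdSimplex ℝ α) :
    shannonEntropy P ≤ Real.logb 2 (Fintype.card α) := by
  have hne : Nonempty α := by
    by_contra h
    rw [not_nonempty_iff] at h
    have := hP.2
    simp at this
  have hc : (0 : ℝ) < Fintype.card α := by exact_mod_cast Fintype.card_pos
  have h2 : 0 < Real.log 2 := Real.log_pos one_lt_two
  rw [shannonEntropy_eq_sum_negMulLog, Real.logb]
  gcongr
  -- Gibbs' inequality against the uniform distribution: `log z ≤ z - 1` at `z = 1 / (|α| P a)`,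
  -- multiplied by `P a`. The correction terms sum to zero.
  have key : ∀ a, Real.negMulLog (P a) ≤
      P a * Real.log (Fintype.card α) + (1 / Fintype.card α - P a) := by
    intro a
    rcases (hP.1 a).eq_or_lt with h | h
    · rw [← h]; simp
    have := Real.log_le_sub_one_of_pos (show 0 < 1 / (Fintype.card α * P a) by positivity)
    rw [one_div, Real.log_inv, Real.log_mul hc.ne' h.ne'] at this
    have h3 := mul_le_mul_of_nonneg_left this h.le
    have h4 : P a * (((Fintype.card α : ℝ) * P a)⁻¹ - 1) = 1 / Fintype.card α - P a := by
      field_simp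
    rw [h4] at h3
    rw [Real.negMulLog]
    linarith
  refine (Finset.sum_le_sum fun a _ => key a).trans ?_
  rw [Finset.sum_add_distrib, ← Finset.sum_mul, Finset.sum_sub_distrib, hP.2]
  simp [hc.ne']

lemma shannonEntropy_fst_le {P : α → β → ℝ} (hP : ∀ a b, 0 ≤ P a b) :
    shannonEntropy (fun a => ∑ b, P a b) ≤ shannonEntropy (fun p : α × β => P p.1 p.2) := by
  unfold shannonEntropy
  rw [Fintype.sum_prod_type]
  refine Finset.sum_le_sum fun a _ => ?_
  rw [Finset.sum_mul]
  refine Finset.sum_le_sum fun b _ => ?_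
  rcases (hP a b).eq_or_lt with h | h
  · simp [← h]
  have h1 : P a b ≤ ∑ b', P a b' := Finset.single_le_sum (fun b _ => hP a b) (Finset.mem_univ b)
  refine mul_le_mul_of_nonneg_left ?_ h.le
  exact Real.logb_le_logb_of_le one_lt_two (by have := h.trans_le h1; positivity)
    (one_div_le_one_div_of_le h h1)

lemma shannonEntropy_snd_le {P : α → β → ℝ} (hP : ∀ a b, 0 ≤ P a b) :
    shannonEntropy (fun b => ∑ a, P a b) ≤ shannonEntropy (fun p : α × β => P p.1 p.2) := by
  refine (shannonEntropy_fst_le (P := fun b a => P a b) fun b a => hP a b).trans_eq ?_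
  exact Equiv.sum_comp (Equiv.prodComm β α) fun p => P p.1 p.2 * Real.logb 2 (1 / P p.1 p.2)

lemma mutualInformation_le_entropy_fst {P : α → β → ℝ} (hP : ∀ a b, 0 ≤ P a b) :
    mutualInformation P ≤ shannonEntropy (fun a => ∑ b, P a b) := by
  rw [mutualInformation_eq_entropies P hP]
  linarith [shannonEntropy_snd_le hP]

lemma mutualInformation_le_entropy_snd {P : α → β → ℝ} (hP : ∀ a b, 0 ≤ P a b) :
    mutualInformation P ≤ shannonEntropy (fun b => ∑ a, P a b) := by
  rw [mutualInformation_eq_entropies P hP]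
  linarith [shannonEntropy_fst_le hP]

end Entropy

/-! ### Information of the channel as a continuous function of the joint input-noise distribution -/

section Channel

variable {X S Y : Type*} [Fintype X] [Fintype S] [Fintype Y]

open Classical in
/-- The distribution of `(x, y)` when `(x, s)` has distribution `Q` and `y = law x s`. -/
def outputJoint (law : X → S → Y) (Q : X × S → ℝ) : X → Y → ℝ :=
  fun x y => ∑ s, if law x s = y then Q (x, s) else 0

omit [Fintype X] [Fintype Y] in
lemma outputJoint_nonneg (law : X → S → Y) {Q : X × S → ℝ} (hQ : ∀ p, 0 ≤ Q p) (x : X) (y : Y) :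
    0 ≤ outputJoint law Q x y :=
  Finset.sum_nonneg fun s _ => by split_ifs <;> simp [hQ]

omit [Fintype X] in
lemma sum_outputJoint (law : X → S → Y) (Q : X × S → ℝ) (x : X) :
    ∑ y, outputJoint law Q x y = ∑ s, Q (x, s) := by
  classical
  unfold outputJoint
  rw [Finset.sum_comm]
  simp

lemma outputJoint_snd_mem (law : X → S → Y) {Q : X × S → ℝ} (hQ : Q ∈ stdSimplex ℝ (X × S)) :
    (fun y => ∑ x, outputJoint law Q x y) ∈ stdSimplex ℝ Y := by
  refine ⟨fun y => Finset.sum_nonneg fun x _ => outputJoint_nonneg law hQ.1 x y, ?_⟩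
  rw [Finset.sum_comm]
  simp_rw [sum_outputJoint]
  rw [← Fintype.sum_prod_type]; exact hQ.2

lemma outputJoint_fst_mem {Q : X × S → ℝ} (hQ : Q ∈ stdSimplex ℝ (X × S)) :
    (fun x => ∑ s, Q (x, s)) ∈ stdSimplex ℝ X := by
  refine ⟨fun y => Finset.sum_nonneg fun x _ => hQ.1 _, ?_⟩
  rw [← Fintype.sum_prod_type]; exact hQ.2

lemma outputJoint_mem (law : X → S → Y) {Q : X × S → ℝ} (hQ : Q ∈ stdSimplex ℝ (X × S)) :
    (fun p : X × Y => outputJoint law Q p.1 p.2) ∈ stdSimplex ℝ (X × Y) := by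
  refine ⟨fun p => outputJoint_nonneg law hQ.1 _ _, ?_⟩
  rw [Fintype.sum_prod_type]
  simp_rw [sum_outputJoint]
  rw [← Fintype.sum_prod_type]; exact hQ.2

/-- The mutual information of input and output when `(x, s)` has distribution `Q`. -/
def channelInformation (law : X → S → Y) (Q : X × S → ℝ) : ℝ :=
  mutualInformation (outputJoint law Q)

lemma channelInformation_eq (law : X → S → Y) {Q : X × S → ℝ} (hQ : Q ∈ stdSimplex ℝ (X × S)) :
    channelInformation law Q = shannonEntropy (fun x => ∑ s, Q (x, s))
      + shannonEntropy (fun y => ∑ x, outputJoint law Q x y)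
      - shannonEntropy (fun p : X × Y => outputJoint law Q p.1 p.2) := by
  rw [channelInformation, mutualInformation_eq_entropies _ (outputJoint_nonneg law hQ.1)]
  simp_rw [sum_outputJoint]

lemma channelInformation_le_logb_card (law : X → S → Y) {Q : X × S → ℝ}
    (hQ : Q ∈ stdSimplex ℝ (X × S)) :
    channelInformation law Q ≤ Real.logb 2 (Fintype.card Y) :=
  (mutualInformation_le_entropy_snd (outputJoint_nonneg law hQ.1)).trans
    (shannonEntropy_le_logb_card (outputJoint_snd_mem law hQ))

lemma channelInformation_le_entropy (law : X → S → Y) {Q : X × S → ℝ}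
    (hQ : Q ∈ stdSimplex ℝ (X × S)) :
    channelInformation law Q ≤ shannonEntropy (fun x => ∑ s, Q (x, s)) := by
  refine (mutualInformation_le_entropy_fst (outputJoint_nonneg law hQ.1)).trans_eq ?_
  simp_rw [sum_outputJoint]

/-- A crude bound: it only ensures that the infimum defining the capacity is over a set bounded
below. -/
lemma neg_logb_card_le_channelInformation (law : X → S → Y) {Q : X × S → ℝ}
    (hQ : Q ∈ stdSimplex ℝ (X × S)) :
    -Real.logb 2 (Fintype.card (X × Y)) ≤ channelInformation law Q := by
  rw [channelInformation_eq law hQ]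
  linarith [shannonEntropy_le_logb_card (outputJoint_mem law hQ),
    shannonEntropy_nonneg (outputJoint_fst_mem hQ),
    shannonEntropy_nonneg (outputJoint_snd_mem law hQ)]

lemma continuousOn_channelInformation (law : X → S → Y) :
    ContinuousOn (channelInformation law) (stdSimplex ℝ (X × S)) := by
  have hJ : ∀ x y, Continuous fun Q : X × S → ℝ => outputJoint law Q x y := by
    intro x y
    refine continuous_finsetSum _ fun s _ => ?_
    split_ifs
    · exact continuous_apply _
    · exact continuous_const
  refine ContinuousOn.congr (f := fun Q => shannonEntropy (fun x => ∑ s, Q (x, s))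
      + shannonEntropy (fun y => ∑ x, outputJoint law Q x y)
      - shannonEntropy (fun p : X × Y => outputJoint law Q p.1 p.2)) ?_
    fun Q hQ => channelInformation_eq law hQ
  refine Continuous.continuousOn ?_
  refine ((continuous_shannonEntropy.comp ?_).add (continuous_shannonEntropy.comp ?_)).sub
    (continuous_shannonEntropy.comp ?_)
  · exact continuous_pi fun x => continuous_finsetSum _ fun s _ => continuous_apply _
  · exact continuous_pi fun y => continuous_finsetSum _ fun x _ => hJ x y
  · exact continuous_pi fun p => hJ _ _

/-- Uniform continuity on the compact simplex; one `η` must serve for joint types that vary with the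
words and with `n`. -/
lemma exists_abs_channelInformation_sub_lt (law : X → S → Y) {ε : ℝ} (hε : 0 < ε) :
    ∃ η > 0, ∀ Q ∈ stdSimplex ℝ (X × S), ∀ Q' ∈ stdSimplex ℝ (X × S),
      (∀ p, |Q p - Q' p| ≤ η) → |channelInformation law Q - channelInformation law Q'| < ε := by
  have hu := (isCompact_stdSimplex ℝ (X × S)).uniformContinuousOn_of_continuous
    (continuousOn_channelInformation law)
  obtain ⟨η, hη, h⟩ := Metric.uniformContinuousOn_iff.1 hu ε hε
  refine ⟨η / 2, by positivity, fun Q hQ Q' hQ' hd => ?_⟩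
  have : dist Q Q' ≤ η / 2 := (dist_pi_le_iff (by positivity)).2 hd
  exact h Q hQ Q' hQ' (by linarith)

omit [Fintype Y] in
/-- A joint distribution can be moved to a nearby first marginal without changing the second. -/
lemma exists_joint_with_fst {Q : X × S → ℝ} (hQ : Q ∈ stdSimplex ℝ (X × S)) {P : X → ℝ}
    (hP : P ∈ stdSimplex ℝ X) {η : ℝ} (hη : ∀ x, |P x - ∑ s, Q (x, s)| ≤ η) :
    ∃ Q' ∈ stdSimplex ℝ (X × S), (∀ x, ∑ s, Q' (x, s) = P x) ∧
      (∀ s, ∑ x, Q' (x, s) = ∑ x, Q (x, s)) ∧ ∀ p, |Q' p - Q p| ≤ η := by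
  set t : X → ℝ := fun x => ∑ s, Q (x, s) with ht
  have ht0 : ∀ x, 0 ≤ t x := fun x => Finset.sum_nonneg fun s _ => hQ.1 _
  have hQt : ∀ x s, Q (x, s) ≤ t x := fun x s =>
    Finset.single_le_sum (f := fun s => Q (x, s)) (fun s _ => hQ.1 _) (Finset.mem_univ s)
  -- Row `x` is scaled down to mass `min (t x) (P x)`. Then `u x` is the mass still missing from row
  -- `x`, `w s` the mass removed from column `s`, and both have the same total `d`. Adding the
  -- product `u x * w s / d` repairs rows and columns at once. If `d = 0` then `u` and `w` vanish,
  -- and division by zero gives the right value.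
  set ρ : X → ℝ := fun x => min 1 (P x / t x) with hρ
  have hρ0 : ∀ x, 0 ≤ ρ x := fun x => le_min zero_le_one (div_nonneg (hP.1 x) (ht0 x))
  have hρ1 : ∀ x, ρ x ≤ 1 := fun x => min_le_left _ _
  have hρt : ∀ x, ρ x * t x = min (t x) (P x) := by
    intro x
    rcases (ht0 x).eq_or_lt with h | h
    · rw [← h, mul_zero, min_eq_left (hP.1 x)]
    · simp only [hρ]
      rw [min_mul_of_nonneg _ _ h.le, one_mul, div_mul_cancel₀ _ h.ne']
  set u : X → ℝ := fun x => P x - ρ x * t x with hu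
  have hu0 : ∀ x, 0 ≤ u x := fun x => by
    simp only [hu]; rw [hρt]; linarith [min_le_right (t x) (P x)]
  have hη0 : ∀ x, u x ≤ η ∧ (1 - ρ x) * t x ≤ η := fun x => by
    have h1 := abs_le.1 (hη x)
    have hη' : 0 ≤ η := (abs_nonneg _).trans (hη x)
    simp only [hu]
    rw [sub_mul, hρt, one_mul]
    rcases min_cases (t x) (P x) with h | h <;> rw [h.1] <;> constructor <;> linarith
  set w : S → ℝ := fun s => ∑ x, (1 - ρ x) * Q (x, s) with hw
  have hw0 : ∀ s, 0 ≤ w s := fun s =>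
    Finset.sum_nonneg fun x _ => mul_nonneg (by linarith [hρ1 x]) (hQ.1 _)
  set d : ℝ := ∑ x, u x with hd
  have hdw : ∑ s, w s = d := by
    simp only [hw, hd, hu]
    rw [Finset.sum_comm, Finset.sum_sub_distrib, hP.2]
    simp_rw [← Finset.mul_sum, sub_mul, one_mul, Finset.sum_sub_distrib]
    congr 1
    simp only [← ht]
    rw [← hQ.2, Fintype.sum_prod_type]
  have hd0 : 0 ≤ d := Finset.sum_nonneg fun x _ => hu0 x
  have hdu : d = 0 → ∀ x, u x = 0 := fun h x =>
    (Finset.sum_eq_zero_iff_of_nonneg fun x _ => hu0 x).1 h x (Finset.mem_univ x)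
  have hdws : d = 0 → ∀ s, w s = 0 := fun h x =>
    (Finset.sum_eq_zero_iff_of_nonneg fun x _ => hw0 x).1 (hdw.trans h) x (Finset.mem_univ x)
  have hrow : ∀ x, ∑ s, (ρ x * Q (x, s) + u x * w s / d) = P x := by
    intro x
    rw [Finset.sum_add_distrib, ← Finset.mul_sum, ← Finset.sum_div, ← Finset.mul_sum, hdw]
    change ρ x * t x + _ = _
    rcases eq_or_ne d 0 with h | h
    · have := hdu h x
      rw [h, div_zero]; simp only [hu] at this; linarith
    · rw [mul_div_cancel_right₀ _ h]; simp [hu]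
  have hcol : ∀ s, ∑ x, (ρ x * Q (x, s) + u x * w s / d) = ∑ x, Q (x, s) := by
    intro s
    have h1 : ∑ x, u x * w s / d = w s := by
      rw [← Finset.sum_div, ← Finset.sum_mul, ← hd]
      rcases eq_or_ne d 0 with h | h
      · rw [h, div_zero, hdws h s]
      · rw [mul_comm, mul_div_cancel_right₀ _ h]
    rw [Finset.sum_add_distrib, h1]
    simp only [hw]
    rw [← Finset.sum_add_distrib]
    exact Finset.sum_congr rfl fun x _ => by ring
  refine ⟨fun p => ρ p.1 * Q p + u p.1 * w p.2 / d, ⟨fun p => ?_, ?_⟩, hrow, hcol, ?_⟩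
  · exact add_nonneg (mul_nonneg (hρ0 _) (hQ.1 _))
      (div_nonneg (mul_nonneg (hu0 _) (hw0 _)) hd0)
  · rw [Fintype.sum_prod_type]
    simp_rw [hrow]; exact hP.2
  · rintro ⟨x, s⟩
    have h1 : 0 ≤ (1 - ρ x) * Q (x, s) := mul_nonneg (by linarith [hρ1 x]) (hQ.1 _)
    have h2 : (1 - ρ x) * Q (x, s) ≤ η :=
      (mul_le_mul_of_nonneg_left (hQt x s) (by linarith [hρ1 x])).trans (hη0 x).2
    have h3 : 0 ≤ u x * w s / d := div_nonneg (mul_nonneg (hu0 _) (hw0 _)) hd0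
    have h4 : u x * w s / d ≤ η := by
      refine le_trans ?_ (hη0 x).1
      rw [mul_div_assoc]
      refine mul_le_of_le_one_right (hu0 x) (div_le_one_of_le₀ ?_ hd0)
      rw [← hdw]
      exact Finset.single_le_sum (fun s _ => hw0 s) (Finset.mem_univ s)
    simp only
    rw [abs_le]
    constructor <;> nlinarith

end Channel

/-! ### Capacity as an infimum over joint distributions of input and noise -/

namespace AdversarialChannel

variable {X S Y : Type*} [Fintype X] [Fintype S] [Fintype Y] {A : AdversarialChannel X S Y}

/-- The joint distributions of input and noise with input distribution `P` and admissible noise. -/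
def admissibleJoints (A : AdversarialChannel X S Y) (P : X → ℝ) : Set (X × S → ℝ) :=
  {Q | Q ∈ stdSimplex ℝ (X × S) ∧ (∀ x, ∑ s, Q (x, s) = P x) ∧
    (fun s => ∑ x, Q (x, s)) ∈ A.noiseConstraint}

omit [Fintype Y] in
lemma mul_mem_admissibleJoints {P : X → ℝ} (hP : P ∈ stdSimplex ℝ X) {V : X → S → ℝ}
    (hV : V ∈ A.noiseStrategies P) : (fun p : X × S => P p.1 * V p.1 p.2) ∈ A.admissibleJoints P := by
  refine ⟨⟨fun p => mul_nonneg (hP.1 _) ((hV.1 _).1 _), ?_⟩, fun x => ?_, hV.2⟩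
  · rw [Fintype.sum_prod_type]
    simp_rw [← Finset.mul_sum, (hV.1 _).2, mul_one]
    exact hP.2
  · simp only
    rw [← Finset.mul_sum, (hV.1 _).2, mul_one]

omit [Fintype Y] in
lemma exists_strategy_of_mem_admissibleJoints {P : X → ℝ} {Q : X × S → ℝ}
    (hQ : Q ∈ A.admissibleJoints P) :
    ∃ V ∈ A.noiseStrategies P, (fun p : X × S => P p.1 * V p.1 p.2) = Q := by
  classical
  obtain ⟨hQ1, hQ2, hQ3⟩ := hQ
  have hP0 : ∀ x, 0 ≤ P x := fun x => by
    rw [← hQ2]; exact Finset.sum_nonneg fun s _ => hQ1.1 _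
  -- Where `P x = 0` the conditional is arbitrary; the noise marginal of `Q` is a distribution at
  -- hand.
  set V : X → S → ℝ := fun x s => if P x = 0 then ∑ x', Q (x', s) else Q (x, s) / P x with hV
  have hmul : ∀ x s, P x * V x s = Q (x, s) := by
    intro x s
    simp only [hV]
    split_ifs with h
    · have h0 := (Finset.sum_eq_zero_iff_of_nonneg (f := fun s => Q (x, s))
        fun s _ => hQ1.1 _).1 ((hQ2 x).trans h) s (Finset.mem_univ s)
      rw [h, zero_mul]; exact h0.symm
    · field_simp
  refine ⟨V, ⟨fun x => ?_, ?_⟩, funext fun p => hmul p.1 p.2⟩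
  · by_cases h : P x = 0
    · have : V x = fun s => ∑ x', Q (x', s) := by funext s; simp [hV, h]
      rw [this]; exact A.noiseConstraint_subset hQ3
    · refine ⟨fun s => ?_, ?_⟩
      · simp only [hV, h, if_false]; exact div_nonneg (hQ1.1 _) (hP0 x)
      · simp only [hV, h, if_false]; rw [← Finset.sum_div, hQ2, div_self h]
  · simp_rw [hmul]; exact hQ3

lemma minInformation_eq {P : X → ℝ} (hP : P ∈ stdSimplex ℝ X) :
    A.minInformation P = sInf (channelInformation A.law '' A.admissibleJoints P) := by
  unfold minInformation
  congr 1
  ext t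
  constructor
  · rintro ⟨V, hV, rfl⟩
    exact ⟨_, mul_mem_admissibleJoints hP hV, rfl⟩
  · rintro ⟨Q, hQ, rfl⟩
    obtain ⟨V, hV, rfl⟩ := exists_strategy_of_mem_admissibleJoints hQ
    exact ⟨V, hV, rfl⟩

variable {P : X → ℝ}

lemma IsCapacityAchieving.mem_stdSimplex (hP : A.IsCapacityAchieving P) : P ∈ stdSimplex ℝ X :=
  A.inputConstraint_subset hP.1

lemma IsCapacityAchieving.capacity_eq (hP : A.IsCapacityAchieving P) :
    A.capacity = sInf (channelInformation A.law '' A.admissibleJoints P) := by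
  rw [← minInformation_eq hP.mem_stdSimplex]
  refine IsGreatest.csSup_eq ⟨⟨P, hP.1, rfl⟩, ?_⟩
  rintro _ ⟨P', hP', rfl⟩
  exact hP.2 P' hP'

lemma IsCapacityAchieving.capacity_le (hP : A.IsCapacityAchieving P) {Q : X × S → ℝ}
    (hQ : Q ∈ A.admissibleJoints P) : A.capacity ≤ channelInformation A.law Q := by
  rw [hP.capacity_eq]
  refine csInf_le ⟨-Real.logb 2 (Fintype.card (X × Y)), ?_⟩ ⟨Q, hQ, rfl⟩
  rintro _ ⟨Q', hQ', rfl⟩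
  exact neg_logb_card_le_channelInformation _ hQ'.1

omit [Fintype Y] in
lemma admissibleJoints_nonempty (hP : P ∈ stdSimplex ℝ X) : (A.admissibleJoints P).Nonempty := by
  obtain ⟨σ, hσ⟩ := A.noiseConstraint_nonempty
  refine ⟨_, mul_mem_admissibleJoints (V := fun _ => σ) hP
    ⟨fun _ => A.noiseConstraint_subset hσ, ?_⟩⟩
  simp_rw [← Finset.sum_mul, hP.2, one_mul]
  exact hσ

lemma IsCapacityAchieving.exists_channelInformation_lt (hP : A.IsCapacityAchieving P) {ε : ℝ}
    (hε : 0 < ε) : ∃ Q ∈ A.admissibleJoints P, channelInformation A.law Q < A.capacity + ε := by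
  have h : sInf (channelInformation A.law '' A.admissibleJoints P) < A.capacity + ε := by
    rw [← hP.capacity_eq]; linarith
  obtain ⟨_, ⟨Q, hQ, rfl⟩, hlt⟩ :=
    exists_lt_of_csInf_lt ((admissibleJoints_nonempty hP.mem_stdSimplex).image _) h
  exact ⟨Q, hQ, hlt⟩

lemma IsCapacityAchieving.capacity_le_logb_card (hP : A.IsCapacityAchieving P) :
    A.capacity ≤ Real.logb 2 (Fintype.card Y) := by
  obtain ⟨Q, hQ⟩ := A.admissibleJoints_nonempty hP.mem_stdSimplex
  exact (hP.capacity_le hQ).trans (channelInformation_le_logb_card _ hQ.1)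

lemma IsCapacityAchieving.capacity_le_entropy (hP : A.IsCapacityAchieving P) :
    A.capacity ≤ shannonEntropy P := by
  obtain ⟨Q, hQ⟩ := A.admissibleJoints_nonempty hP.mem_stdSimplex
  refine ((hP.capacity_le hQ).trans (channelInformation_le_entropy _ hQ.1)).trans_eq ?_
  rw [funext hQ.2.1]

/-- Near `P`, no admissible noise makes the information much smaller than the capacity. -/
lemma IsCapacityAchieving.exists_capacity_sub_le (hP : A.IsCapacityAchieving P) {ε : ℝ}
    (hε : 0 < ε) : ∃ η > 0, ∀ τ : X → ℝ, (∀ x, |P x - τ x| ≤ η) →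
      ∀ Q ∈ A.admissibleJoints τ, A.capacity - ε ≤ channelInformation A.law Q := by
  obtain ⟨η, hη, h⟩ := exists_abs_channelInformation_sub_lt A.law hε
  refine ⟨η, hη, fun τ hτ Q hQ => ?_⟩
  -- Correcting the input marginal to `P` leaves the noise marginal unchanged, so the noise
  -- constraint survives exactly, even though the constraint set need not be closed or open.
  obtain ⟨Q', h1, h2, h3, h4⟩ := exists_joint_with_fst hQ.1 hP.mem_stdSimplex (η := η)
    fun x => by rw [hQ.2.1]; exact hτ x
  have h5 := abs_lt.1 (h Q' h1 Q hQ.1 h4)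
  have h6 := hP.capacity_le (Q := Q') ⟨h1, h2, by rw [funext h3]; exact hQ.2.2⟩
  linarith [h5.2]

end AdversarialChannel


/-! ### Aligning two words to a prescribed joint type -/

section JointType

variable {X S : Type*}

lemma exists_injective_lift {α ι κ : Type*} [Finite ι] [Finite κ] (ℓ : ι → α) (v : κ → α)
    (h : ∀ a, Nat.card {i // ℓ i = a} ≤ Nat.card {k // v k = a}) :
    ∃ f : ι → κ, Function.Injective f ∧ ∀ i, v (f i) = ℓ i := by
  classical
  cases nonempty_fintype ι
  cases nonempty_fintype κ
  have e : ∀ a, {i // ℓ i = a} ↪ {k // v k = a} := fun a =>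
    (Function.Embedding.nonempty_of_card_le
      (by simpa only [Nat.card_eq_fintype_card] using h a)).some
  refine ⟨fun i => (e (ℓ i) ⟨i, rfl⟩).1, fun i j hij => ?_, fun i => (e (ℓ i) ⟨i, rfl⟩).2⟩
  have hl : ℓ i = ℓ j := by
    have h1 := (e (ℓ i) ⟨i, rfl⟩).2
    have h2 := (e (ℓ j) ⟨j, rfl⟩).2
    rw [← h1, ← h2]; exact congrArg v hij
  -- The embeddings depend on the label; transport along `ℓ i = ℓ j` lets injectivity of a single
  -- one be used.
  have key : ∀ a (ha : ℓ i = a), (e (ℓ i) ⟨i, rfl⟩).1 = (e a ⟨i, ha⟩).1 := by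
    rintro _ rfl; rfl
  have h3 : (e (ℓ j) ⟨i, hl⟩) = e (ℓ j) ⟨j, rfl⟩ := Subtype.ext ((key _ hl).symm.trans hij)
  exact congrArg Subtype.val ((e (ℓ j)).injective h3)

lemma exists_perm_extending {n : ℕ} {ι : Type*} {f g : ι → Fin n} (hf : Function.Injective f)
    (hg : Function.Injective g) : ∃ π : Equiv.Perm (Fin n), ∀ i, π (f i) = g i := by
  classical
  let e : {k // k ∈ Set.range f} ≃ {k // k ∈ Set.range g} :=
    (Equiv.ofInjective f hf).symm.trans (Equiv.ofInjective g hg)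
  refine ⟨e.extendSubtype, fun i => ?_⟩
  rw [Equiv.extendSubtype_apply_of_mem e _ ⟨i, rfl⟩]
  simp [e]

/-- If any cell exceeds `η`, the `η` subtracted from that one cell already pays for the deviation of
the marginal; otherwise all terms vanish. -/
lemma sum_floor_sub_le {ι : Type*} [Fintype ι] {q : ι → ℝ} (hq : ∀ i, 0 ≤ q i) {η t : ℝ}
    (hη : 0 ≤ η) (ht : 0 ≤ t) (hqt : |t - ∑ i, q i| ≤ η) (n : ℕ) :
    ((∑ i, ⌊n * max 0 (q i - η)⌋₊ : ℕ) : ℝ) ≤ n * t := by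
  classical
  have h1 : ∑ i, max 0 (q i - η) ≤ t := by
    by_cases h : ∀ i, q i ≤ η
    · rw [Finset.sum_eq_zero fun i _ => max_eq_left (by linarith [h i])]
      exact ht
    · push Not at h
      obtain ⟨j, hj⟩ := h
      rw [← Finset.add_sum_erase _ _ (Finset.mem_univ j), max_eq_right (by linarith)]
      have h2 : ∑ i ∈ Finset.univ.erase j, max 0 (q i - η) ≤ ∑ i ∈ Finset.univ.erase j, q i :=
        Finset.sum_le_sum fun i _ => max_le (hq i) (by linarith)
      have h3 := Finset.add_sum_erase Finset.univ q (Finset.mem_univ j)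
      have := abs_le.1 hqt
      linarith
  push_cast
  calc ∑ i, ((⌊n * max 0 (q i - η)⌋₊ : ℕ) : ℝ) ≤ ∑ i, n * max 0 (q i - η) :=
        Finset.sum_le_sum fun i _ => Nat.floor_le (by positivity)
    _ ≤ n * t := by rw [← Finset.mul_sum]; gcongr

lemma card_sigma_subtype {ι α : Type*} [Fintype ι] [DecidableEq α] (c : ι → ℕ) (ℓ : ι → α) (a : α) :
    Nat.card {i : Σ p : ι, Fin (c p) // ℓ i.1 = a} = ∑ p, if ℓ p = a then c p else 0 := by
  classical
  rw [Nat.card_eq_fintype_card, Fintype.card_subtype, Finset.card_filter, Fintype.sum_sigma]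
  refine Finset.sum_congr rfl fun p _ => ?_
  split_ifs with h <;> simp

/-- Two words with nearly prescribed types can be aligned by a permutation so that their joint
type is close to a prescribed joint distribution. -/
lemma exists_perm_jointType_close [Fintype X] [Fintype S] {Q : X × S → ℝ}
    (hQ : Q ∈ stdSimplex ℝ (X × S)) {ε : ℝ} (hε : 0 < ε) :
    ∃ η > 0, ∃ n₀ : ℕ, ∀ n ≥ n₀, ∀ (x : Fin n → X) (s : Fin n → S),
      (∀ a, |wordType x a - ∑ b, Q (a, b)| ≤ η) → (∀ b, |wordType s b - ∑ a, Q (a, b)| ≤ η) →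
      ∃ π : Equiv.Perm (Fin n), ∀ p, |wordType (fun i => (x i, s (π i))) p - Q p| ≤ ε := by
  classical
  set m : ℝ := (Fintype.card (X × S) : ℝ) with hm
  have hm0 : 0 < m := by
    rw [hm]
    have : Nonempty (X × S) := by
      by_contra h
      rw [not_nonempty_iff] at h
      have := hQ.2
      simp at this
    exact_mod_cast Fintype.card_pos
  set η : ℝ := ε / (2 * (m + 1)) with hη
  have hη0 : 0 < η := by positivity
  obtain ⟨n₀, hn₀⟩ := exists_nat_gt (1 / η)
  refine ⟨η, hη0, n₀, fun n hn x s hx hs => ?_⟩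
  have hn' : 1 / η < n := hn₀.trans_le (by exact_mod_cast hn)
  have hnpos : (0 : ℝ) < n := (by positivity : 0 < 1 / η).trans hn'
  have hn0 : n ≠ 0 := by rintro rfl; simp at hnpos
  -- Reserve `c (a, b)` positions for the pair `(a, b)`. The subtraction of `η` makes these slots
  -- fit among the occurrences of `a` in `x` and of `b` in `s`. The permutation matches the two
  -- placements; the remaining positions are left uncontrolled.
  set c : X × S → ℕ := fun p => ⌊n * max 0 (Q p - η)⌋₊ with hc
  obtain ⟨f, hf, hfx⟩ := exists_injective_lift (fun i : Σ p : X × S, Fin (c p) => i.1.1) x (by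
    intro a
    rw [card_sigma_subtype c Prod.fst a, Fintype.sum_prod_type, Finset.sum_eq_single a]
    rotate_left
    · intro a' _ ha; simp [ha]
    · simp
    have h1 := sum_floor_sub_le (q := fun b => Q (a, b)) (fun b => hQ.1 _) hη0.le
      (wordType_nonneg x a) (hx a) n
    rw [← ncard_eq_mul_wordType] at h1
    simp only [if_true]
    exact Nat.cast_le.1 h1)
  obtain ⟨g, hg, hgs⟩ := exists_injective_lift (fun i : Σ p : X × S, Fin (c p) => i.1.2) s (by
    intro b
    rw [card_sigma_subtype c Prod.snd b, Fintype.sum_prod_type_right, Finset.sum_eq_single b]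
    rotate_left
    · intro a' _ ha; simp [ha]
    · simp
    have h1 := sum_floor_sub_le (q := fun a => Q (a, b)) (fun b => hQ.1 _) hη0.le
      (wordType_nonneg s b) (hs b) n
    rw [← ncard_eq_mul_wordType] at h1
    simp only [if_true]
    exact Nat.cast_le.1 h1)
  obtain ⟨π, hπ⟩ := exists_perm_extending hf hg
  refine ⟨π, ?_⟩
  set J := wordType (fun i => (x i, s (π i))) with hJ
  have hcount : ∀ p, (c p : ℝ) ≤ n * J p := by
    intro p
    rw [hJ, ← ncard_eq_mul_wordType]
    have : Nat.card (Fin (c p)) ≤ Nat.card {i : Fin n | (x i, s (π i)) = p} := by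
      refine Nat.card_le_card_of_injective (fun k => ⟨f ⟨p, k⟩, ?_⟩) ?_
      · have h1 := hfx ⟨p, k⟩
        have h2 := hgs ⟨p, k⟩
        rw [← hπ] at h2
        exact Prod.ext h1 h2
      · intro k k' hkk
        have := hf (congrArg Subtype.val hkk)
        simpa using this
    rw [Nat.card_eq_fintype_card, Fintype.card_fin] at this
    exact Nat.cast_le.2 this
  -- One `η` is the reserve and one absorbs the floor, as `1 < n * η`. Lower bounds suffice: `J` and
  -- `Q` both sum to `1`, so the excess at one pair is at most the total deficit allowed.
  have hlow : ∀ p, Q p - 2 * η ≤ J p := by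
    intro p
    have h1 := (Nat.sub_one_lt_floor (n * max 0 (Q p - η))).trans_le (hcount p)
    have h2 : n * (Q p - η) ≤ n * max 0 (Q p - η) := by gcongr; exact le_max_right _ _
    have h3 : 1 < n * η := by rwa [div_lt_iff₀ hη0] at hn'
    have h4 : n * (Q p - 2 * η) ≤ n * J p := by nlinarith
    exact le_of_mul_le_mul_left h4 hnpos
  have hJ1 : ∑ p, J p = 1 := sum_wordType hn0 _
  have hε2 : m * (2 * η) ≤ ε ∧ 2 * η ≤ ε := by
    have : (m + 1) * (2 * η) = ε := by rw [hη]; field_simp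
    constructor <;> nlinarith
  intro p
  have hsum : J p - (Q p - 2 * η) ≤ ∑ p, (J p - (Q p - 2 * η)) :=
    Finset.single_le_sum (f := fun p => J p - (Q p - 2 * η))
      (fun p _ => by linarith [hlow p]) (Finset.mem_univ p)
  rw [Finset.sum_sub_distrib, Finset.sum_sub_distrib, hJ1, hQ.2, Finset.sum_const,
    Finset.card_univ, nsmul_eq_mul, ← hm] at hsum
  rw [abs_le]
  constructor <;> linarith [hlow p, hε2.1, hε2.2]

end JointType


/-! ### Uniform probability and independence of coordinates -/

section UniformProb

open scoped BigOperators

variable {Ω Ω' ι κ T B : Type*}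

open Classical in
/-- The real number `1` if `p` holds and `0` otherwise. -/
def truthValue (p : Prop) : ℝ := if p then 1 else 0

lemma truthValue_of {p : Prop} (h : p) : truthValue p = 1 := if_pos h

lemma truthValue_of_not {p : Prop} (h : ¬p) : truthValue p = 0 := if_neg h

lemma truthValue_nonneg (p : Prop) : 0 ≤ truthValue p := by
  unfold truthValue; split_ifs <;> norm_num

lemma truthValue_mono {p q : Prop} (h : p → q) : truthValue p ≤ truthValue q := by
  by_cases hp : p
  · rw [truthValue_of hp, truthValue_of (h hp)]
  · rw [truthValue_of_not hp]; exact truthValue_nonneg q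

lemma truthValue_and (p q : Prop) : truthValue (p ∧ q) = truthValue p * truthValue q := by
  unfold truthValue
  by_cases hp : p <;> by_cases hq : q <;> simp [hp, hq]

lemma truthValue_forall [Fintype ι] (p : ι → Prop) :
    truthValue (∀ i, p i) = ∏ i, truthValue (p i) := by
  classical
  unfold truthValue
  rw [Fintype.prod_boole]
  congr

lemma uniformProb_eq_expect [Fintype Ω] (p : Ω → Prop) :
    uniformProb {ω | p ω} = 𝔼 ω, truthValue (p ω) := by
  classical
  have : {ω | p ω} = ((Finset.univ.filter p : Finset Ω) : Set Ω) := by ext; simp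
  rw [uniformProb, this, Set.ncard_coe_finset, Fintype.expect_eq_sum_div_card,
    Nat.card_eq_fintype_card]
  unfold truthValue
  rw [Finset.sum_boole]

lemma uniformProb_nonneg (E : Set Ω) : 0 ≤ uniformProb E := by
  unfold uniformProb; positivity

lemma uniformProb_mono [Finite Ω] {E F : Set Ω} (h : E ⊆ F) : uniformProb E ≤ uniformProb F := by
  unfold uniformProb
  gcongr
  exact Set.toFinite _

lemma uniformProb_le_one [Finite Ω] (E : Set Ω) : uniformProb E ≤ 1 := by
  unfold uniformProb
  refine div_le_one_of_le₀ ?_ (by positivity)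
  exact_mod_cast Set.ncard_le_card E

lemma uniformProb_add_compl [Finite Ω] [Nonempty Ω] (E : Set Ω) :
    uniformProb E + uniformProb Eᶜ = 1 := by
  have h := Set.ncard_add_ncard_compl E
  have hc : (Nat.card Ω : ℝ) ≠ 0 := by exact_mod_cast Nat.card_pos.ne'
  unfold uniformProb
  rw [← add_div, ← Nat.cast_add, h, div_self hc]

lemma uniformProb_union_le (E F : Set Ω) :
    uniformProb (E ∪ F) ≤ uniformProb E + uniformProb F := by
  unfold uniformProb
  rw [← add_div]
  gcongr
  exact_mod_cast Set.ncard_union_le E F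

lemma uniformProb_exists_le [Fintype Ω] [Fintype ι] (p : ι → Ω → Prop) :
    uniformProb {ω | ∃ i, p i ω} ≤ ∑ i, uniformProb {ω | p i ω} := by
  simp_rw [uniformProb_eq_expect]
  rw [← Finset.expect_sum_comm]
  refine Finset.expect_le_expect fun ω _ => ?_
  by_cases h : ∃ i, p i ω
  · obtain ⟨i, hi⟩ := h
    exact (truthValue_mono fun _ => hi).trans
      (Finset.single_le_sum (fun i _ => truthValue_nonneg (p i ω)) (Finset.mem_univ i))
  · rw [truthValue_of_not h]
    exact Finset.sum_nonneg fun i _ => truthValue_nonneg _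

/-- Distinct coordinates of a uniform tuple are again uniform and independent: split the tuple into
the coordinates in the range of `e` and the rest, and average out the rest. -/
lemma expect_comp_injective [Fintype ι] [Fintype κ] [DecidableEq ι] [DecidableEq κ] [Fintype T]
    [Nonempty T] {e : ι → κ}
    (he : Function.Injective e) (g : (ι → T) → ℝ) :
    𝔼 c : κ → T, g (fun i => c (e i)) = 𝔼 x, g x := by
  classical
  let F := Equiv.piEquivPiSubtypeProd (fun k => k ∈ Set.range e) (fun _ => T)
  let G : ({k // k ∈ Set.range e} → T) ≃ (ι → T) :=
    Equiv.arrowCongr (Equiv.ofInjective e he).symm (Equiv.refl T)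
  let H := F.trans (Equiv.prodCongr G (Equiv.refl _))
  rw [Fintype.expect_equiv H _ (fun q => g q.1)]
  · rw [← Finset.univ_product_univ, Finset.expect_product]
    refine Finset.expect_congr rfl fun x _ => ?_
    exact Fintype.expect_const (ι := {k // k ∉ Set.range e} → T) (g x)
  · intro c
    rfl

lemma expect_curry_comp_injective {ι' : Type*} [Fintype ι] [Fintype κ] [Fintype ι'] [DecidableEq ι]
    [DecidableEq κ] [DecidableEq ι'] [Fintype T] [Nonempty T] {a : ι → κ} {b : ι → ι'} (he : Function.Injective fun i => (a i, b i))
    (g : (ι → T) → ℝ) :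
    𝔼 u : κ → ι' → T, g (fun i => u (a i) (b i)) = 𝔼 x, g x := by
  rw [← expect_comp_injective he g]
  exact (Fintype.expect_equiv (Equiv.curry κ ι' T) (fun c => g fun i => c (a i, b i))
    (fun u => g fun i => u (a i) (b i)) fun c => rfl).symm

lemma expect_prod_eq_pow [Fintype Ω] (h : Ω → ℝ) (n : ℕ) :
    𝔼 c : Fin n → Ω, ∏ j, h (c j) = (𝔼 ω, h ω) ^ n := by
  rw [Finset.expect_pow, Fintype.piFinset_univ]

lemma uniformProb_forall_eq_pow [Fintype Ω] (p : Ω → Prop) (n : ℕ) :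
    uniformProb {c : Fin n → Ω | ∀ j, p (c j)} = uniformProb {ω | p ω} ^ n := by
  rw [uniformProb_eq_expect, uniformProb_eq_expect, ← expect_prod_eq_pow]
  simp_rw [truthValue_forall]

lemma uniformProb_comp_injective [Fintype ι] [Fintype κ] [Fintype T] [Nonempty T] {e : ι → κ}
    (he : Function.Injective e) (p : (ι → T) → Prop) :
    uniformProb {c : κ → T | p (fun i => c (e i))} = uniformProb {x | p x} := by
  classical
  rw [uniformProb_eq_expect, uniformProb_eq_expect]
  exact expect_comp_injective he fun x => truthValue (p x)

lemma expect_two_coordinates [Fintype κ] [DecidableEq κ] [Fintype T] [Nonempty T] {i j : κ} (hij : i ≠ j)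
    (g h : T → ℝ) : 𝔼 c : κ → T, g (c i) * h (c j) = (𝔼 t, g t) * 𝔼 t, h t := by
  have he : Function.Injective (![i, j] : Fin 2 → κ) := by
    intro a b hab
    fin_cases a <;> fin_cases b <;> simp_all
  have := expect_comp_injective (T := T) he (fun x => g (x 0) * h (x 1))
  simp only [Matrix.cons_val_zero, Matrix.cons_val_one] at this
  rw [this, Fintype.expect_equiv (piFinTwoEquiv fun _ => T) (fun x => g (x 0) * h (x 1)) (fun q => g q.1 * h q.2) fun _ => rfl,
    ← Finset.univ_product_univ, Finset.expect_product, Fintype.expect_mul_expect]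

lemma expect_one_coordinate [Fintype κ] [DecidableEq κ] [Fintype T] [Nonempty T] (i : κ) (g : T → ℝ) :
    𝔼 c : κ → T, g (c i) = 𝔼 t, g t := by
  have he : Function.Injective (fun _ : Unit => i) := fun _ _ _ => rfl
  have := expect_comp_injective (T := T) he (fun x => g (x ()))
  rw [this]
  exact Fintype.expect_equiv (Equiv.funUnique Unit T) (fun x => g (x ())) g fun _ => rfl

end UniformProb

/-! ### The second moment argument for common neighbours -/

section SecondMoment

open scoped BigOperators

variable {T B : Type*} [Fintype T] [Fintype B] [Nonempty T] [Nonempty B] {r : T → B → Prop} {p : ℝ}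

/-- The number of words of the block `v` related to `y`. -/
def hitCount (r : T → B → Prop) {m : ℕ} (v : Fin m → T) (y : B) : ℝ :=
  ∑ i, truthValue (r (v i) y)

omit [Fintype T] [Fintype B] [Nonempty T] [Nonempty B] in
lemma hitCount_nonneg {m : ℕ} (v : Fin m → T) (y : B) : 0 ≤ hitCount r v y :=
  Finset.sum_nonneg fun _ _ => truthValue_nonneg _

omit [Fintype B] [Nonempty B] in
-- Pairs of different positions are independent and contribute `p ^ 2` each; the `m` diagonal pairs
-- give the codegree term. Counting `p ^ 2` for the diagonal as well only weakens the bound.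
lemma expect_hitCount_mul_le (hp : ∀ y, uniformProb {x | r x y} = p) (m : ℕ) (y y' : B) :
    𝔼 v : Fin m → T, hitCount r v y * hitCount r v y'
      ≤ m * uniformProb {x | r x y ∧ r x y'} + (m * p) ^ 2 := by
  have hp' : ∀ y, 𝔼 x, (truthValue (r x y)) = p := fun y => by
    rw [← uniformProb_eq_expect, hp]
  have hterm : ∀ i j : Fin m,
      𝔼 v : Fin m → T, (truthValue (r (v i) y)) * (truthValue (r (v j) y'))
        ≤ (if i = j then uniformProb {x | r x y ∧ r x y'} else 0) + p ^ 2 := by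
    intro i j
    split_ifs with h
    · subst h
      rw [expect_one_coordinate i
        fun x => (truthValue (r x y)) * (truthValue (r x y'))]
      rw [uniformProb_eq_expect]
      have : 0 ≤ p ^ 2 := sq_nonneg p
      refine le_trans (le_of_eq ?_) (le_add_of_nonneg_right this)
      exact Finset.expect_congr rfl fun x _ => (truthValue_and _ _).symm
    · rw [expect_two_coordinates h (fun x => truthValue (r x y))
        (fun x => truthValue (r x y')), hp', hp', zero_add, sq]
  unfold hitCount
  simp_rw [Finset.sum_mul_sum]
  rw [Finset.expect_sum_comm]
  simp_rw [Finset.expect_sum_comm]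
  refine (Finset.sum_le_sum fun i _ => Finset.sum_le_sum fun j _ => hterm i j).trans_eq ?_
  simp only [Finset.sum_add_distrib, Finset.sum_ite_eq, Finset.mem_univ, if_true, Finset.sum_const,
    Finset.card_univ, Fintype.card_fin, nsmul_eq_mul]
  ring

omit [Fintype B] [Nonempty B] [Nonempty T] in
lemma uniformProb_and_le (hp : ∀ y, uniformProb {x | r x y} = p) (y y' : B) :
    uniformProb {x | r x y ∧ r x y'} ≤ p := by
  rw [← hp y]; exact uniformProb_mono fun x hx => hx.1

omit [Nonempty B] in
-- Exchange the averages: for fixed `x` the two outputs are independent, each adjacent with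
-- probability `p`. This is where regularity on the side of the words enters.
lemma expect_uniformProb_and (hp' : ∀ x, uniformProb {y | r x y} = p) :
    𝔼 y : B, 𝔼 y' : B, uniformProb {x | r x y ∧ r x y'} = p ^ 2 := by
  have hp : ∀ x, 𝔼 y, (truthValue (r x y)) = p := fun x => by
    rw [← uniformProb_eq_expect, hp']
  have h1 : ∀ y y', uniformProb {x | r x y ∧ r x y'}
      = 𝔼 x, (truthValue (r x y)) * (truthValue (r x y')) := by
    intro y y'
    rw [uniformProb_eq_expect]
    exact Finset.expect_congr rfl fun x _ => truthValue_and _ _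
  simp_rw [h1]
  have h2 : ∀ y, 𝔼 y', 𝔼 x, (truthValue (r x y)) * (truthValue (r x y'))
      = 𝔼 x, 𝔼 y', (truthValue (r x y)) * (truthValue (r x y')) :=
    fun y => Finset.expect_comm _ _ _
  simp_rw [h2]
  rw [Finset.expect_comm]
  simp_rw [← Fintype.expect_mul_expect, hp]
  rw [Fintype.expect_const, sq]

/-- In a biregular bipartite graph of density `p`, a system of `L` random blocks of `m` vertices has,
with probability bounded below, a good transversal with a common neighbour. -/
theorem le_uniformProb_exists_common_neighbour (hp : ∀ y, uniformProb {x | r x y} = p)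
    (hp' : ∀ x, uniformProb {y | r x y} = p) (hp0 : 0 < p) {L m : ℕ} (hL : 1 ≤ L) (hm0 : 0 < m)
    {good : (Fin L → T) → Prop} {c : ℝ} (hc : 0 ≤ c)
    (hgood : ∀ y, c * p ^ L ≤ uniformProb {x : Fin L → T | good x ∧ ∀ j, r (x j) y})
    (hm : 1 ≤ m * (m * p) ^ (L - 1)) :
    c ^ 2 / 2 ^ L ≤ uniformProb {u : Fin L → Fin m → T |
      ∃ f : Fin L → Fin m, good (fun j => u j (f j)) ∧ ∃ y, ∀ j, r (u j (f j)) y} := by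
  set q : ℝ := m * p with hq
  have hq0 : 0 < q := by positivity
  set E : (Fin L → Fin m → T) → Prop := fun u =>
    ∃ f : Fin L → Fin m, good (fun j => u j (f j)) ∧ ∃ y, ∀ j, r (u j (f j)) y with hE
  -- `W` counts good transversals and vanishes off the event `E`. `Z` drops goodness, so that it is
  -- a product over blocks and its second moment factorises.
  set W : (Fin L → Fin m → T) → ℝ := fun u => 𝔼 y : B, ∑ f : Fin L → Fin m,
    truthValue (good (fun j => u j (f j)) ∧ ∀ j, r (u j (f j)) y) with hW
  set Z : (Fin L → Fin m → T) → ℝ := fun u => 𝔼 y : B, ∏ j, hitCount r (u j) y with hZ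
  have hW0 : ∀ u, 0 ≤ W u := fun u => Finset.expect_nonneg fun y _ =>
    Finset.sum_nonneg fun f _ => truthValue_nonneg _
  have hWZ : ∀ u, W u ≤ Z u := by
    intro u
    refine Finset.expect_le_expect fun y _ => ?_
    unfold hitCount
    rw [Fintype.prod_sum]
    refine Finset.sum_le_sum fun f _ => ?_
    rw [← truthValue_forall]
    exact truthValue_mono fun h => h.2
  have hWE : ∀ u, W u * (truthValue (E u)) = W u := by
    intro u
    by_cases h : E u
    · rw [truthValue_of h, mul_one]
    · rw [truthValue_of_not h, mul_zero, eq_comm]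
      refine Finset.expect_eq_zero fun y _ => Finset.sum_eq_zero fun f _ => truthValue_of_not ?_
      rintro ⟨h1, h2⟩
      exact h ⟨f, h1, y, h2⟩
  have hfirst : c * q ^ L ≤ 𝔼 u, W u := by
    simp only [hW]
    rw [Finset.expect_comm]
    refine Finset.le_expect Finset.univ_nonempty fun y _ => ?_
    rw [Finset.expect_sum_comm]
    have : ∀ f : Fin L → Fin m, c * p ^ L ≤ 𝔼 u : Fin L → Fin m → T,
        truthValue (good (fun j => u j (f j)) ∧ ∀ j, r (u j (f j)) y) := by
      intro f
      rw [expect_curry_comp_injective (a := fun j : Fin L => j) (b := f)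
        (fun i j h => congrArg Prod.fst h)
        (fun x : Fin L → T => truthValue (good x ∧ ∀ j, r (x j) y)),
        ← uniformProb_eq_expect]
      exact hgood y
    refine le_trans (le_of_eq ?_) (Finset.sum_le_sum fun f _ => this f)
    rw [Finset.sum_const, Finset.card_univ, Fintype.card_fun, Fintype.card_fin, Fintype.card_fin,
      nsmul_eq_mul, hq]
    push_cast
    ring
  have hsecond : 𝔼 u, W u ^ 2 ≤ 2 ^ L * q ^ (2 * L) := by
    have h1 : 𝔼 u, W u ^ 2 ≤ 𝔼 u, Z u ^ 2 :=
      Finset.expect_le_expect fun u _ => pow_le_pow_left₀ (hW0 u) (hWZ u) 2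
    have h2 : 𝔼 u, Z u ^ 2 = 𝔼 y : B, 𝔼 y' : B,
        (𝔼 v : Fin m → T, hitCount r v y * hitCount r v y') ^ L := by
      have : ∀ u, Z u ^ 2 = 𝔼 y : B, 𝔼 y' : B, ∏ j, (hitCount r (u j) y * hitCount r (u j) y') := by
        intro u
        rw [sq]
        simp only [hZ]
        rw [Fintype.expect_mul_expect]
        simp_rw [Finset.prod_mul_distrib]
      simp_rw [this]
      rw [Finset.expect_comm]
      refine Finset.expect_congr rfl fun y _ => ?_
      rw [Finset.expect_comm]
      refine Finset.expect_congr rfl fun y' _ => ?_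
      exact expect_prod_eq_pow (fun v : Fin m → T => hitCount r v y * hitCount r v y') L
    -- Convexity splits the power. The codegree term is at most `q`, so all but one of its `L`
    -- factors are replaced by `q`; what remains is linear in the codegree and can be averaged
    -- exactly over `y` and `y'`.
    have h3 : ∀ y y', (𝔼 v : Fin m → T, hitCount r v y * hitCount r v y') ^ L
        ≤ 2 ^ (L - 1) * (q ^ (L - 1) * (m * uniformProb {x | r x y ∧ r x y'}) + q ^ (2 * L)) := by
      intro y y'
      have ha0 : 0 ≤ m * uniformProb {x | r x y ∧ r x y'} :=
        mul_nonneg (by positivity) (uniformProb_nonneg _)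
      have ha1 : m * uniformProb {x | r x y ∧ r x y'} ≤ q :=
        mul_le_mul_of_nonneg_left (uniformProb_and_le hp y y') (by positivity)
      refine (pow_le_pow_left₀ (Finset.expect_nonneg fun v _ =>
        mul_nonneg (hitCount_nonneg _ _) (hitCount_nonneg _ _))
        (expect_hitCount_mul_le hp m y y') L).trans ?_
      refine (add_pow_le ha0 (sq_nonneg _) L).trans ?_
      rw [← pow_mul]
      gcongr
      calc (m * uniformProb {x | r x y ∧ r x y'}) ^ L
          = (m * uniformProb {x | r x y ∧ r x y'}) ^ (L - 1)
            * (m * uniformProb {x | r x y ∧ r x y'}) := by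
            rw [← pow_succ, Nat.sub_add_cancel hL]
        _ ≤ _ := by gcongr
    have h4 : 𝔼 y : B, 𝔼 y' : B, (2 ^ (L - 1) *
        (q ^ (L - 1) * (m * uniformProb {x | r x y ∧ r x y'}) + q ^ (2 * L)))
        = 2 ^ (L - 1) * (q ^ (L - 1) * (m * p ^ 2) + q ^ (2 * L)) := by
      simp_rw [← Finset.mul_expect, Finset.expect_add_distrib, ← Finset.mul_expect,
        Fintype.expect_const]
      rw [expect_uniformProb_and hp']
    have h5 : q ^ (L - 1) * (m * p ^ 2) ≤ q ^ (2 * L) := by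
      have e : q ^ (2 * L) = q ^ (L - 1) * (m * p ^ 2) * (m * q ^ (L - 1)) := by
        obtain ⟨k, rfl⟩ : ∃ k, L = k + 1 := ⟨L - 1, (Nat.sub_add_cancel hL).symm⟩
        simp only [Nat.add_sub_cancel]
        rw [show 2 * (k + 1) = k + k + 2 by ring, pow_add, pow_add, hq]
        ring
      rw [e]
      exact le_mul_of_one_le_right (by positivity) hm
    calc 𝔼 u, W u ^ 2 ≤ 𝔼 y : B, 𝔼 y' : B, (2 ^ (L - 1) *
        (q ^ (L - 1) * (m * uniformProb {x | r x y ∧ r x y'}) + q ^ (2 * L))) := by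
          rw [h2] at h1
          exact h1.trans (Finset.expect_le_expect fun y _ =>
            Finset.expect_le_expect fun y' _ => h3 y y')
      _ ≤ 2 ^ (L - 1) * (q ^ (2 * L) + q ^ (2 * L)) := by rw [h4]; gcongr
      _ = 2 ^ L * q ^ (2 * L) := by
          conv_rhs => rw [← Nat.sub_add_cancel hL, pow_succ]
          rw [Nat.sub_add_cancel hL]; ring
  -- Cauchy–Schwarz for `W = W * 1_E`: the square of the mean of `W` is at most its second moment
  -- times the probability of `E`.
  have hCS := Finset.expect_mul_sq_le_sq_mul_sq Finset.univ W (fun u => truthValue (E u))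
  simp_rw [hWE] at hCS
  have hind : ∀ u, (truthValue (E u)) ^ 2 = truthValue (E u) := by
    intro u
    unfold truthValue
    split_ifs <;> norm_num
  simp_rw [hind] at hCS
  rw [← uniformProb_eq_expect] at hCS
  have hfin : (c * q ^ L) ^ 2 ≤ 2 ^ L * q ^ (2 * L) * uniformProb {u | E u} :=
    (pow_le_pow_left₀ (by positivity) hfirst 2).trans
      (hCS.trans (mul_le_mul_of_nonneg_right hsecond (uniformProb_nonneg _)))
  rw [div_le_iff₀ (by positivity)]
  have e : (c * q ^ L) ^ 2 = c ^ 2 * q ^ (2 * L) := by rw [mul_pow, ← pow_mul, mul_comm L 2]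
  rw [e] at hfin
  have hq2 : 0 < q ^ (2 * L) := by positivity
  refine le_of_mul_le_mul_right ?_ hq2
  linarith

end SecondMoment


/-! ### Amplification by disjoint blocks, and the union bound for independent codewords -/

section Tuples

variable {Ω Ω' T B : Type*}

lemma uniformProb_congr_equiv (e : Ω ≃ Ω') {p : Ω → Prop} {q : Ω' → Prop}
    (h : ∀ ω, p ω ↔ q (e ω)) : uniformProb {ω | p ω} = uniformProb {ω | q ω} := by
  have h1 : {ω | p ω}.ncard = {ω | q ω}.ncard :=
    Nat.card_congr (e.subtypeEquiv h)
  unfold uniformProb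
  rw [h1, Nat.card_congr e]

/-- If an event has probability at least `p₀` for one system of blocks, it is unlikely to fail on
all of many disjoint systems of blocks. -/
lemma uniformProb_le_one_sub_pow [Fintype T] [Nonempty T] {K L m M : ℕ} (hM : K * (L * m) ≤ M)
    {E : (Fin L → Fin m → T) → Prop} {F : (Fin M → T) → Prop} {p₀ : ℝ}
    (hE : p₀ ≤ uniformProb {u | E u})
    (hF : ∀ c, F c → ∀ e : Fin L → Fin m → Fin M, (∀ j i j' i', e j i = e j' i' → j = j') →
      ¬E fun j i => c (e j i)) :
    uniformProb {c | F c} ≤ (1 - p₀) ^ K := by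
  classical
  obtain ⟨e⟩ : Nonempty (Fin K × Fin L × Fin m ↪ Fin M) :=
    Function.Embedding.nonempty_of_card_le (by simpa using hM)
  have h1 : uniformProb {c | F c}
      ≤ uniformProb {c : Fin M → T | ∀ k, ¬E fun j i => c (e (k, j, i))} := by
    refine uniformProb_mono fun c hc k => hF c hc (fun j i => e (k, j, i)) ?_
    intro j i j' i' h
    have := e.injective h
    simp only [Prod.mk.injEq] at this
    exact this.2.1
  have h2 : uniformProb {c : Fin M → T | ∀ k, ¬E fun j i => c (e (k, j, i))}
      = uniformProb {x : Fin K × Fin L × Fin m → T | ∀ k, ¬E fun j i => x (k, j, i)} :=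
    uniformProb_comp_injective e.injective
      fun x : Fin K × Fin L × Fin m → T => ∀ k, ¬E fun j i => x (k, j, i)
  have h3 : uniformProb {x : Fin K × Fin L × Fin m → T | ∀ k, ¬E fun j i => x (k, j, i)}
      = uniformProb {u : Fin K → Fin L → Fin m → T | ∀ k, ¬E (u k)} :=
    uniformProb_congr_equiv ((Equiv.curry _ _ _).trans
      (Equiv.arrowCongr (Equiv.refl _) (Equiv.curry _ _ _))) fun x => Iff.rfl
  rw [h2, h3, uniformProb_forall_eq_pow (fun u => ¬E u)] at h1
  refine h1.trans (pow_le_pow_left₀ (uniformProb_nonneg _) ?_ K)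
  have h4 := uniformProb_add_compl {u : Fin L → Fin m → T | E u}
  have h5 : {u : Fin L → Fin m → T | ¬E u} = {u | E u}ᶜ := rfl
  rw [h5]; linarith

lemma uniformProb_exists_tuple_le [Fintype T] [Nonempty T] [Fintype B] {r : T → B → Prop} {p : ℝ}
    (hp : ∀ y, uniformProb {x | r x y} ≤ p) (L M : ℕ) :
    uniformProb {c : Fin M → T |
        ∃ f : Fin L → Fin M, Function.Injective f ∧ ∃ y, ∀ j, r (c (f j)) y}
      ≤ (M : ℝ) ^ L * Fintype.card B * p ^ L := by
  classical
  have h1 : uniformProb {c : Fin M → T |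
        ∃ f : Fin L → Fin M, Function.Injective f ∧ ∃ y, ∀ j, r (c (f j)) y}
      ≤ uniformProb {c : Fin M → T | ∃ q : (Fin L → Fin M) × B,
        Function.Injective q.1 ∧ ∀ j, r (c (q.1 j)) q.2} := by
    refine uniformProb_mono ?_
    rintro c ⟨f, hf, y, hy⟩
    exact ⟨(f, y), hf, hy⟩
  refine h1.trans ((uniformProb_exists_le _).trans ?_)
  have h2 : ∀ q : (Fin L → Fin M) × B, uniformProb {c : Fin M → T |
      Function.Injective q.1 ∧ ∀ j, r (c (q.1 j)) q.2} ≤ p ^ L := by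
    rintro ⟨f, y⟩
    have hp0 : 0 ≤ p := (uniformProb_nonneg _).trans (hp y)
    by_cases hf : Function.Injective f
    · have h3 : uniformProb {c : Fin M → T | ∀ j, r (c (f j)) y} = _ :=
        uniformProb_comp_injective hf fun x : Fin L → T => ∀ j, r (x j) y
      refine (uniformProb_mono fun c hc => hc.2).trans (h3.trans_le ?_)
      rw [uniformProb_forall_eq_pow (fun x => r x y)]
      exact pow_le_pow_left₀ (uniformProb_nonneg _) (hp y) L
    · have : {c : Fin M → T | Function.Injective f ∧ ∀ j, r (c (f j)) y} = ∅ := by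
        ext c; simp [hf]
      change uniformProb {c : Fin M → T | Function.Injective f ∧ ∀ j, r (c (f j)) y} ≤ _
      rw [this]
      simp only [uniformProb, Set.ncard_empty, Nat.cast_zero, zero_div]
      positivity
  refine (Finset.sum_le_sum fun q _ => h2 q).trans_eq ?_
  rw [Finset.sum_const, Finset.card_univ, Fintype.card_prod, Fintype.card_fun, Fintype.card_fin,
    Fintype.card_fin, nsmul_eq_mul]
  push_cast
  ring

end Tuples

/-! ### Uniformly random codes of distinct words -/

section Subsets

variable {T B : Type*} [Fintype T]

lemma uniformProb_finset_card_eq (M : ℕ) (p : Finset T → Prop) [DecidablePred p] :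
    uniformProb {K : {K : Finset T // K.card = M} | p K.1}
      = (((Finset.powersetCard M Finset.univ).filter p).card : ℝ) / (Fintype.card T).choose M := by
  have h1 : {K : {K : Finset T // K.card = M} | p K.1}.ncard
      = ((Finset.powersetCard M Finset.univ).filter p).card := by
    rw [← Set.ncard_coe_finset]
    refine Set.ncard_congr (fun K _ => K.1) ?_ (fun K K' _ _ h => Subtype.ext h) ?_
    · intro K hK
      have hK' : p K.1 := hK
      simp [hK', K.2]
    · intro K hK
      have hK' : K.card = M ∧ p K := by simpa using hK
      exact ⟨⟨K, hK'.1⟩, hK'.2, rfl⟩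
  have h2 : Nat.card {K : Finset T // K.card = M} = (Fintype.card T).choose M := by
    classical
    rw [Nat.card_eq_fintype_card, Fintype.card_finset_len]
  rw [uniformProb, h1, h2]

lemma descFactorial_mul_pow_le {N t : ℕ} (h : N ≤ t) (L : ℕ) :
    N.descFactorial L * t ^ L ≤ t.descFactorial L * N ^ L := by
  induction L with
  | zero => simp
  | succ k ih =>
    rw [Nat.descFactorial_succ, Nat.descFactorial_succ, pow_succ, pow_succ]
    have h1 : (N - k) * t ≤ (t - k) * N := by
      rw [Nat.sub_mul, Nat.sub_mul, mul_comm t N]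
      exact Nat.sub_le_sub_left (Nat.mul_le_mul_left k h) _
    calc (N - k) * N.descFactorial k * (t ^ k * t)
        = ((N - k) * t) * (N.descFactorial k * t ^ k) := by ring
      _ ≤ ((t - k) * N) * (t.descFactorial k * N ^ k) := Nat.mul_le_mul h1 ih
      _ = _ := by ring

/-- Drawing without replacement hits a set of density at most `p` in all `L` draws no more often
than drawing with replacement. -/
lemma choose_le_pow_mul_choose {N t : ℕ} (h : N ≤ t) {p : ℝ} (hp : N ≤ p * t) (L : ℕ) :
    (N.choose L : ℝ) ≤ p ^ L * t.choose L := by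
  rcases Nat.eq_zero_or_pos t with rfl | ht
  · obtain rfl : N = 0 := by omega
    rcases Nat.eq_zero_or_pos L with rfl | hL
    · simp
    · simp [Nat.choose_eq_zero_of_lt hL]
  have ht' : (0 : ℝ) < t := by exact_mod_cast ht
  have h1 : (N.choose L : ℝ) * t ^ L ≤ t.choose L * N ^ L := by
    have h2 := descFactorial_mul_pow_le h L
    rw [Nat.descFactorial_eq_factorial_mul_choose, Nat.descFactorial_eq_factorial_mul_choose,
      mul_assoc, mul_assoc] at h2
    exact_mod_cast Nat.le_of_mul_le_mul_left h2 L.factorial_pos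
  have h3 : (N : ℝ) ^ L ≤ p ^ L * t ^ L := by
    rw [← mul_pow]; exact pow_le_pow_left₀ (by positivity) hp L
  refine le_of_mul_le_mul_right (h1.trans ?_) (pow_pos ht' L)
  calc (t.choose L : ℝ) * N ^ L ≤ t.choose L * (p ^ L * t ^ L) := by gcongr
    _ = _ := by ring

lemma card_powersetCard_filter_superset_le [DecidableEq T] (M : ℕ) (J : Finset T) :
    ((Finset.powersetCard M Finset.univ).filter (J ⊆ ·)).card
      ≤ (Fintype.card T - J.card).choose (M - J.card) := by
  have : (Fintype.card T - J.card).choose (M - J.card)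
      = (Finset.powersetCard (M - J.card) Jᶜ).card := by
    rw [Finset.card_powersetCard, Finset.card_compl]
  rw [this]
  refine Finset.card_le_card_of_injOn (fun K => K \ J) ?_ ?_
  · intro K hK
    simp only [Finset.coe_filter, Finset.mem_powersetCard, Finset.subset_univ, true_and,
      Set.mem_ofPred_eq] at hK
    simp only [Finset.mem_coe, Finset.mem_powersetCard]
    refine ⟨fun x hx => ?_, by rw [Finset.card_sdiff_of_subset hK.2, hK.1]⟩
    simpa using (Finset.mem_sdiff.1 hx).2
  · intro K hK K' hK' h
    simp only [Finset.coe_filter, Finset.mem_powersetCard, Finset.subset_univ, true_and,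
      Set.mem_ofPred_eq] at hK hK'
    rw [← Finset.sdiff_union_of_subset hK.2, ← Finset.sdiff_union_of_subset hK'.2]
    exact congrArg (· ∪ J) h

lemma uniformProb_exists_subset_le [Fintype B] {r : T → B → Prop} {p : ℝ}
    (hp : ∀ y, uniformProb {x | r x y} ≤ p) (L M : ℕ) :
    uniformProb {K : {K : Finset T // K.card = M} |
        ∃ J ⊆ K.1, J.card = L ∧ ∃ y, ∀ x ∈ J, r x y}
      ≤ (M : ℝ) ^ L * Fintype.card B * p ^ L := by
  classical
  rcases isEmpty_or_nonempty B with hB | ⟨⟨y₀⟩⟩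
  · have : {K : {K : Finset T // K.card = M} |
        ∃ J ⊆ K.1, J.card = L ∧ ∃ y, ∀ x ∈ J, r x y} = ∅ := by
      ext K
      simp
    rw [this]; simp [uniformProb]
  have hp0 : 0 ≤ p := (uniformProb_nonneg _).trans (hp y₀)
  rw [uniformProb_finset_card_eq M fun K => ∃ J ⊆ K, J.card = L ∧ ∃ y, ∀ x ∈ J, r x y]
  refine div_le_of_le_mul₀ (by positivity) (by positivity) ?_
  set t := Fintype.card T with ht
  set Nb : B → Finset T := fun y => Finset.univ.filter fun x => r x y with hNb
  rcases lt_or_ge M L with hLM | hLM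
  · rw [Finset.filter_false_of_mem]
    · simp only [Finset.card_empty, Nat.cast_zero]; positivity
    · rintro K hK ⟨J, hJ, hJL, -⟩
      have h1 := Finset.card_le_card hJ
      rw [(Finset.mem_powersetCard.1 hK).2] at h1
      omega
  have hsub : ((Finset.powersetCard M Finset.univ).filter
      fun K : Finset T => ∃ J ⊆ K, J.card = L ∧ ∃ y, ∀ x ∈ J, r x y) ⊆
      Finset.univ.biUnion fun y => (Finset.powersetCard L (Nb y)).biUnion fun J =>
        (Finset.powersetCard M Finset.univ).filter (J ⊆ ·) := by
    intro K hK
    obtain ⟨hK, J, hJ, hJL, y, hy⟩ := Finset.mem_filter.1 hK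
    simp only [Finset.mem_biUnion, Finset.mem_univ, true_and]
    refine ⟨y, J, Finset.mem_powersetCard.2 ⟨fun x hx => ?_, hJL⟩, Finset.mem_filter.2 ⟨hK, hJ⟩⟩
    simpa [hNb] using hy x hx
  have hinner : ∀ y, ((Finset.powersetCard L (Nb y)).biUnion fun J =>
        (Finset.powersetCard M Finset.univ).filter (J ⊆ ·)).card
        ≤ (Nb y).card.choose L * (t - L).choose (M - L) := by
    intro y
    rw [← Finset.card_powersetCard]
    refine Finset.card_biUnion_le_card_mul _ _ _ fun J hJ => ?_
    have h1 := card_powersetCard_filter_superset_le M J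
    rwa [(Finset.mem_powersetCard.1 hJ).2] at h1
  have hreal : ∀ y, (((Nb y).card.choose L * (t - L).choose (M - L) : ℕ) : ℝ)
      ≤ p ^ L * (M : ℝ) ^ L * t.choose M := by
    intro y
    have h1 : ((Nb y).card : ℝ) ≤ p * t := by
      have h2 := hp y
      have e : {x | r x y} = ((Nb y : Finset T) : Set T) := by ext; simp [hNb]
      rw [uniformProb, e, Set.ncard_coe_finset, Nat.card_eq_fintype_card] at h2
      rcases Nat.eq_zero_or_pos t with h0 | h0
      · have : (Nb y).card ≤ t := Finset.card_le_univ _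
        have h3 : (Nb y).card = 0 := by omega
        simp [h3, h0]
      · rwa [div_le_iff₀ (by exact_mod_cast h0)] at h2
    have h3 := choose_le_pow_mul_choose (Finset.card_le_univ (Nb y)) h1 L
    -- Counts pairs of an `M`-set and an `L`-subset of it in two ways. It turns the count of codes
    -- containing a bad list into the same bound as for independent codewords.
    have h4 : (t.choose M : ℝ) * M.choose L = t.choose L * (t - L).choose (M - L) := by
      exact_mod_cast Nat.choose_mul hLM
    have h5 : (M.choose L : ℝ) ≤ (M : ℝ) ^ L := by exact_mod_cast Nat.choose_le_pow M L
    push_cast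
    calc ((Nb y).card.choose L : ℝ) * (t - L).choose (M - L)
        ≤ p ^ L * t.choose L * (t - L).choose (M - L) := by gcongr
      _ = p ^ L * (M.choose L * t.choose M) := by rw [mul_assoc, ← h4]; ring
      _ ≤ p ^ L * ((M : ℝ) ^ L * t.choose M) := by gcongr
      _ = _ := by ring
  calc ((((Finset.powersetCard M Finset.univ).filter
      fun K : Finset T => ∃ J ⊆ K, J.card = L ∧ ∃ y, ∀ x ∈ J, r x y).card : ℕ) : ℝ)
      ≤ ((∑ y, (Nb y).card.choose L * (t - L).choose (M - L) : ℕ) : ℝ) := by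
        exact_mod_cast (Finset.card_le_card hsub).trans
          (Finset.card_biUnion_le.trans (Finset.sum_le_sum fun y _ => hinner y))
    _ ≤ ∑ y : B, p ^ L * (M : ℝ) ^ L * t.choose M := by
        rw [Nat.cast_sum]
        exact Finset.sum_le_sum fun y _ => hreal y
    _ = _ := by
        rw [Finset.sum_const, Finset.card_univ, nsmul_eq_mul]; ring

/-- The fraction of `r`-subsets lying in a family closed under subsets is antitone in `r`. -/
lemma uniformProb_finset_card_antitone {p : Finset T → Prop}
    (hp : ∀ J K, J ⊆ K → p K → p J) {k M : ℕ} (hk : k ≤ M) :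
    uniformProb {K : {K : Finset T // K.card = M} | p K.1}
      ≤ uniformProb {K : {K : Finset T // K.card = k} | p K.1} := by
  classical
  induction M, hk using Nat.le_induction with
  | base => exact le_rfl
  | succ M hk ih =>
    refine le_trans ?_ ih
    rw [uniformProb_finset_card_eq, uniformProb_finset_card_eq]
    -- Local LYM: passing to the shadow does not decrease the density in a layer, and closure under
    -- subsets keeps the shadow inside the family.
    have h := Finset.local_lubell_yamamoto_meshalkin_inequality_div (𝕜 := ℝ) (r := M + 1)
      (𝒜 := (Finset.powersetCard (M + 1) Finset.univ).filter p) (Nat.succ_ne_zero M) (by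
        intro K hK
        have hK' : K.card = M + 1 ∧ p K := by simpa using hK
        exact hK'.1)
    refine h.trans ?_
    simp only [Nat.add_sub_cancel]
    gcongr
    intro K hK
    obtain ⟨K', hK', a, ha, rfl⟩ := Finset.mem_shadow_iff.1 hK
    obtain ⟨h1, h2⟩ := Finset.mem_filter.1 hK'
    refine Finset.mem_filter.2 ⟨Finset.mem_powersetCard.2 ⟨Finset.subset_univ _, ?_⟩,
      hp _ _ (Finset.erase_subset _ _) h2⟩
    rw [Finset.card_erase_of_mem ha, (Finset.mem_powersetCard.1 h1).2, Nat.add_sub_cancel]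

/-- A permutation of `T` carrying one `k`-set to another gives a bijection between the tuples with
these images. Hence, given its size, the image of a uniform tuple is a uniform subset. -/
lemma exists_card_filter_image_eq [DecidableEq T] (M k : ℕ) :
    ∃ s : ℕ, ∀ K : Finset T, K.card = k →
      ((Finset.univ : Finset (Fin M → T)).filter
        fun c => Finset.univ.image c = K).card = s := by
  by_cases h : ∃ K₀ : Finset T, K₀.card = k
  · obtain ⟨K₀, hK₀⟩ := h
    refine ⟨((Finset.univ : Finset (Fin M → T)).filter fun c => Finset.univ.image c = K₀).card,
      fun K hK => ?_⟩
    let e : {x // x ∈ K} ≃ {x // x ∈ K₀} := Finset.equivOfCardEq (hK.trans hK₀.symm)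
    have he : K.image e.extendSubtype = K₀ := by
      refine Finset.eq_of_subset_of_card_le ?_ ?_
      · intro x hx
        obtain ⟨z, hz, rfl⟩ := Finset.mem_image.1 hx
        rw [Equiv.extendSubtype_apply_of_mem e z hz]
        exact (e ⟨z, hz⟩).2
      · rw [Finset.card_image_of_injective _ e.extendSubtype.injective, hK, hK₀]
    have himg : ∀ c : Fin M → T, Finset.univ.image (e.extendSubtype ∘ c)
        = (Finset.univ.image c).image e.extendSubtype := fun c => (Finset.image_image).symm
    refine Finset.card_bij (fun c _ => e.extendSubtype ∘ c) ?_ ?_ ?_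
    · intro c hc
      simp only [Finset.mem_filter, Finset.mem_univ, true_and] at hc ⊢
      rw [himg, hc, he]
    · intro c _ c' _ hcc
      exact e.extendSubtype.injective.comp_left hcc
    · intro c hc
      simp only [Finset.mem_filter, Finset.mem_univ, true_and] at hc
      have hc' : e.extendSubtype ∘ (e.extendSubtype.symm ∘ c) = c := by funext i; simp
      refine ⟨e.extendSubtype.symm ∘ c, ?_, hc'⟩
      simp only [Finset.mem_filter, Finset.mem_univ, true_and]
      refine Finset.image_injective e.extendSubtype.injective ?_
      rw [← himg, hc', hc, he]
  · exact ⟨0, fun K hK => absurd ⟨K, hK⟩ h⟩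

/-- A uniformly random `M`-subset is less likely to lie in a family closed under subsets than the
set of `M` independent uniformly random elements. -/
theorem uniformProb_finset_card_le_uniformProb_tuple [Nonempty T] [DecidableEq T]
    {p : Finset T → Prop} (hp : ∀ J K, J ⊆ K → p K → p J) (M : ℕ) :
    uniformProb {K : {K : Finset T // K.card = M} | p K.1}
      ≤ uniformProb {c : Fin M → T | p (Finset.univ.image c)} := by
  classical
  choose s hs using fun k => exists_card_filter_image_eq (T := T) M k
  set f := uniformProb {K : {K : Finset T // K.card = M} | p K.1} with hf
  -- Repeated words only shrink the image to a uniform `k`-set with `k ≤ M`, where the density of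
  -- the family is at least `f`. Summing over `k` with weights `s k` gives the claim.
  have hcard : ∀ k ≤ M, f * (Fintype.card T).choose k
      ≤ ((Finset.powersetCard k Finset.univ).filter p).card := by
    intro k hk
    have h1 := uniformProb_finset_card_antitone hp hk
    rw [uniformProb_finset_card_eq k p] at h1
    rcases Nat.eq_zero_or_pos ((Fintype.card T).choose k) with h0 | h0
    · rw [h0]; simp
    · rwa [le_div_iff₀ (by exact_mod_cast h0)] at h1
  have hcount : ∀ q : Finset T → Prop,
      ((Finset.univ : Finset (Fin M → T)).filter fun c => q (Finset.univ.image c)).card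
        = ∑ k ∈ Finset.range (M + 1), ((Finset.powersetCard k Finset.univ).filter q).card * s k := by
    intro q
    rw [Finset.card_eq_sum_card_fiberwise (f := fun c => (Finset.univ.image c).card)
      (t := Finset.range (M + 1))]
    · refine Finset.sum_congr rfl fun k _ => ?_
      rw [Finset.card_eq_sum_card_fiberwise (f := fun c => Finset.univ.image c)
        (t := (Finset.powersetCard k Finset.univ).filter q)]
      · refine Finset.sum_const_nat fun K hK => ?_
        obtain ⟨h1, h2⟩ := Finset.mem_filter.1 hK
        have h3 := (Finset.mem_powersetCard.1 h1).2
        rw [← hs k K h3]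
        congr 1
        ext c
        simp only [Finset.mem_filter, Finset.mem_univ, true_and]
        constructor
        · exact fun h => h.2
        · intro h; rw [h]; exact ⟨⟨h2, h3⟩, rfl⟩
      · intro c hc
        simp only [Finset.coe_filter, Finset.mem_filter, Finset.mem_univ, true_and,
          Set.mem_ofPred_eq] at hc
        simpa using ⟨hc.2, hc.1⟩
    · intro c _
      have := Finset.card_image_le (s := (Finset.univ : Finset (Fin M))) (f := c)
      rw [Finset.card_univ, Fintype.card_fin] at this
      simpa [Nat.lt_succ_iff] using this
  have htot := hcount fun _ => True
  have hpp := hcount p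
  simp only [Finset.filter_true, Finset.card_univ, Finset.card_powersetCard] at htot
  have e : {c : Fin M → T | p (Finset.univ.image c)}
      = ((Finset.univ.filter fun c : Fin M → T => p (Finset.univ.image c) :
        Finset (Fin M → T)) : Set (Fin M → T)) := by ext; simp
  have hpos : (0 : ℝ) < Fintype.card (Fin M → T) := by exact_mod_cast Fintype.card_pos
  rw [uniformProb, e, Set.ncard_coe_finset, Nat.card_eq_fintype_card, le_div_iff₀ hpos, htot, hpp]
  push_cast
  rw [Finset.mul_sum]
  refine Finset.sum_le_sum fun k hk => ?_
  rw [← mul_assoc]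
  gcongr
  exact hcard k (Nat.lt_succ_iff.1 (Finset.mem_range.1 hk))

/-- Uniformly random subsets of a set, as sets and as finite sets of elements of the subtype. -/
lemma uniformProb_set_ncard_eq {α : Type*} (U : Set α) [Finite U] (M : ℕ) (p : Set α → Prop) :
    uniformProb {K : {K : Set α // K ⊆ U ∧ K.ncard = M} | p K.1}
      = uniformProb {K : {K : Finset U // K.card = M} | p (Subtype.val '' (K.1 : Set U))} := by
  classical
  have hval : Function.Injective (Subtype.val : U → α) := Subtype.val_injective
  let φ : {K : Finset U // K.card = M} → {K : Set α // K ⊆ U ∧ K.ncard = M} := fun K =>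
    ⟨Subtype.val '' (K.1 : Set U), by rintro _ ⟨x, _, rfl⟩; exact x.2, by
      rw [Set.ncard_image_of_injective _ hval, Set.ncard_coe_finset, K.2]⟩
  have hφ : Function.Bijective φ := by
    constructor
    · intro K K' h
      have h1 : Subtype.val '' (K.1 : Set U) = Subtype.val '' (K'.1 : Set U) :=
        congrArg Subtype.val h
      exact Subtype.ext (Finset.coe_injective (hval.image_injective h1))
    · rintro ⟨K, hKU, hKM⟩
      have hfin : (Subtype.val ⁻¹' K : Set U).Finite := Set.toFinite _
      have himg : Subtype.val '' (Subtype.val ⁻¹' K : Set U) = K := by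
        rw [Subtype.image_preimage_coe, Set.inter_eq_right.2 hKU]
      refine ⟨⟨hfin.toFinset, ?_⟩, Subtype.ext ?_⟩
      · rw [← Set.ncard_eq_toFinset_card _ hfin, ← Set.ncard_image_of_injective _ hval, himg, hKM]
      · change Subtype.val '' ((hfin.toFinset : Finset U) : Set U) = K
        rw [Set.Finite.coe_toFinset, himg]
  exact (uniformProb_congr_equiv (Equiv.ofBijective φ hφ) (p := fun K => p (Subtype.val '' (K.1 : Set U)))
    (q := fun K => p K.1) fun K => Iff.rfl).symm

end Subsets


/-! ### Absorbing polynomial factors -/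

section Asymptotics

lemma eventually_mul_one_add_log_le (c : ℝ) {a : ℝ} (ha : 0 < a) :
    ∀ᶠ n : ℕ in atTop, c * (1 + Real.log (n + 1)) ≤ a * n := by
  have h1 : (fun n : ℕ => Real.log ((n : ℝ) + 1)) =o[atTop] fun n : ℕ => (n : ℝ) + 1 :=
    Real.isLittleO_log_id_atTop.comp_tendsto
      (tendsto_atTop_add_const_right _ _ tendsto_natCast_atTop_atTop)
  set b : ℝ := a / (2 * (|c| + 1)) with hb
  have hb0 : 0 < b := by positivity
  have h2 := h1.bound hb0
  have h3 : ∀ᶠ n : ℕ in atTop, (1 + b) / b ≤ (n : ℝ) :=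
    tendsto_natCast_atTop_atTop.eventually_ge_atTop _
  filter_upwards [h2, h3] with n h2 h3
  have hn : (0 : ℝ) ≤ n := n.cast_nonneg
  have hl : 0 ≤ Real.log ((n : ℝ) + 1) := Real.log_nonneg (by linarith)
  rw [Real.norm_of_nonneg hl, Real.norm_of_nonneg (by linarith)] at h2
  rw [div_le_iff₀ hb0] at h3
  have h4 : 1 + Real.log ((n : ℝ) + 1) ≤ 2 * b * n := by nlinarith
  calc c * (1 + Real.log ((n : ℝ) + 1)) ≤ (|c| + 1) * (1 + Real.log ((n : ℝ) + 1)) := by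
        gcongr; linarith [le_abs_self c]
    _ ≤ (|c| + 1) * (2 * b * n) := by gcongr
    _ = a * n := by rw [hb]; field_simp

lemma two_rpow_eq_exp (t : ℝ) : (2 : ℝ) ^ t = Real.exp (t * Real.log 2) := by
  rw [Real.rpow_def_of_pos two_pos, mul_comm]

lemma tendsto_two_rpow_neg_mul {a : ℝ} (ha : 0 < a) (b : ℝ) :
    Tendsto (fun n : ℕ => (2 : ℝ) ^ (-((n : ℝ) * a) + b)) atTop (𝓝 0) := by
  have h1 : Tendsto (fun n : ℕ => -((n : ℝ) * a) + b) atTop atBot := by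
    refine tendsto_atBot_add_const_right _ _ (tendsto_neg_atTop_atBot.comp ?_)
    exact tendsto_natCast_atTop_atTop.atTop_mul_const ha
  simp_rw [two_rpow_eq_exp]
  exact Real.tendsto_exp_atBot.comp (h1.atBot_mul_const (Real.log_pos one_lt_two))

end Asymptotics

section Subtype

lemma uniformProb_subtype {α : Type*} (U : Set α) (p : α → Prop) :
    uniformProb {x : U | p x} = ({x | x ∈ U ∧ p x}.ncard : ℝ) / U.ncard := by
  have h : {x : U | p x}.ncard = {x | x ∈ U ∧ p x}.ncard := by
    rw [← Set.ncard_image_of_injective _ Subtype.val_injective]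
    congr 1
    ext x
    simp [and_comm]
  rw [uniformProb, h, Nat.card_coe_set_eq]

/-- Double counting: both constants equal the edge density. -/
lemma eq_of_forall_uniformProb_eq {T B : Type*} [Finite T] [Finite B] [Nonempty T] [Nonempty B]
    {r : T → B → Prop} {p p' : ℝ} (hp : ∀ y, uniformProb {x | r x y} = p)
    (hp' : ∀ x, uniformProb {y | r x y} = p') : p' = p := by
  cases nonempty_fintype T
  cases nonempty_fintype B
  simp_rw [uniformProb_eq_expect] at hp hp'
  have h1 : Finset.univ.expect (fun y : B => Finset.univ.expect fun x : T => truthValue (r x y))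
      = p := by
    simp_rw [hp]; exact Fintype.expect_const p
  have h2 : Finset.univ.expect (fun x : T => Finset.univ.expect fun y : B => truthValue (r x y))
      = p' := by
    simp_rw [hp']; exact Fintype.expect_const p'
  rw [← h1, ← h2, Finset.expect_comm]

end Subtype

/-! ### How many words of a type class reach an output -/

namespace AdversarialChannel

variable {X S Y : Type*} [Fintype X] [Fintype S] {A : AdversarialChannel X S Y}

/-- The output word `y` can be reached from `x` by some admissible noise word. -/
def Reaches (A : AdversarialChannel X S Y) {n : ℕ} (x : Fin n → X) (y : Fin n → Y) : Prop :=
  ∃ s ∈ A.noiseWords n, ∀ i, A.law (x i) (s i) = y i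

lemma wordType_input_output {n : ℕ} (x : Fin n → X) (s : Fin n → S) (a : X) (b : Y) :
    wordType (fun i => (x i, A.law (x i) (s i))) (a, b)
      = outputJoint A.law (wordType fun i => (x i, s i)) a b := by
  classical
  have h := wordType_comp (fun p : X × S => (p.1, A.law p.1 p.2)) (fun i => (x i, s i)) (a, b)
  refine h.trans ?_
  rw [Fintype.sum_prod_type, Finset.sum_eq_single a]
  · unfold outputJoint
    refine Finset.sum_congr rfl fun s' _ => ?_
    simp
  · intro a' _ ha; simp [ha]
  · simp

lemma mem_admissibleJoints_wordType [Fintype Y] {n : ℕ} (hn : n ≠ 0) (x : Fin n → X)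
    {s : Fin n → S} (hs : s ∈ A.noiseWords n) :
    wordType (fun i => (x i, s i)) ∈ A.admissibleJoints (wordType x) := by
  refine ⟨wordType_mem_stdSimplex hn _, fun a => (wordType_fst _ a).symm, ?_⟩
  have : (fun b => ∑ a, wordType (fun i => (x i, s i)) (a, b)) = wordType s :=
    funext fun b => (wordType_snd (fun i => (x i, s i)) b).symm
  rw [this]; exact hs

variable [Fintype Y]

lemma mutualInformation_wordType {n : ℕ} (x : Fin n → X) (s : Fin n → S) :
    mutualInformation (fun a b => wordType (fun i => (x i, A.law (x i) (s i))) (a, b))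
      = channelInformation A.law (wordType fun i => (x i, s i)) := by
  simp_rw [wordType_input_output]
  rfl

variable {P : X → ℝ} {N : Set ℕ} {τ : ℕ → X → ℝ}

omit [Fintype S] [Fintype Y] in
lemma eventually_forall_abs_sub_le (hlim : Tendsto τ (atTop ⊓ 𝓟 N) (𝓝 P)) {η : ℝ} (hη : 0 < η) :
    ∀ᶠ n in atTop ⊓ 𝓟 N, ∀ x, |P x - τ n x| ≤ η := by
  refine eventually_all.2 fun x => ?_
  have h := Metric.tendsto_nhds.1 (tendsto_pi_nhds.1 hlim x) η hη
  filter_upwards [h] with n hn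
  rw [Real.dist_eq, abs_sub_comm] at hn
  exact hn.le

/-- No output word is reachable from much more than a fraction `2 ^ (-n C)` of the type class. -/
lemma IsCapacityAchieving.eventually_uniformProb_reaches_le (hP : A.IsCapacityAchieving P)
    (hlim : Tendsto τ (atTop ⊓ 𝓟 N) (𝓝 P)) {ε : ℝ} (hε : 0 < ε) :
    ∀ᶠ n in atTop ⊓ 𝓟 N, ∀ y : Fin n → Y,
      uniformProb {x : typeClass n (τ n) | A.Reaches x.1 y}
        ≤ (2 : ℝ) ^ (-((n : ℝ) * (A.capacity - ε))) := by
  have h2 : 0 < Real.log 2 := Real.log_pos one_lt_two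
  obtain ⟨η, hη, hcap⟩ := hP.exists_capacity_sub_le (half_pos hε)
  set k : ℝ := (Fintype.card X * Fintype.card Y + Fintype.card X + Fintype.card Y + 3 : ℝ)
    with hk
  have hpoly := eventually_mul_one_add_log_le (k + Fintype.card (X × Y))
    (show 0 < ε / 2 * Real.log 2 by positivity)
  filter_upwards [hpoly.filter_mono inf_le_left,
    (eventually_ge_atTop 1).filter_mono inf_le_left, eventually_forall_abs_sub_le hlim hη]
    with n hpoly hn1 hclose y
  have hn0 : n ≠ 0 := by omega
  rw [uniformProb_subtype (typeClass n (τ n)) fun x => A.Reaches x y]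
  set t : ℝ := ((typeClass n (τ n)).ncard : ℝ) with ht
  refine div_le_of_le_mul₀ (by positivity) (by positivity) ?_
  set l : ℝ := Real.log (n + 1) with hl
  have hl0 : 0 ≤ l := Real.log_nonneg (by linarith [n.cast_nonneg (α := ℝ)])
  set b : ℝ := Real.exp (-(n * (A.capacity - ε / 2)) * Real.log 2 + k * (1 + l)) * t with hb
  -- Split the words reaching `y` by their joint type with `y`. A nonempty piece contains some `x`
  -- with an admissible noise word, so its information is at least `C - ε / 2`, and this bounds the
  -- whole conditional class. There are only polynomially many joint types.
  have hpiece : ∀ Q : X × Y → ℝ, (({x | (x ∈ typeClass n (τ n) ∧ A.Reaches x y) ∧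
      wordType (fun i => (x i, y i)) = Q}.ncard : ℕ) : ℝ) ≤ b := by
    intro Q
    rcases Set.eq_empty_or_nonempty {x | (x ∈ typeClass n (τ n) ∧ A.Reaches x y) ∧
      wordType (fun i => (x i, y i)) = Q} with h0 | ⟨x, ⟨hxT, s, hs, hxs⟩, hxQ⟩
    · rw [h0, Set.ncard_empty, Nat.cast_zero]; positivity
    have hy : y = fun i => A.law (x i) (s i) := funext fun i => (hxs i).symm
    have hxT' : wordType x = τ n := hxT
    have hI : A.capacity - ε / 2 ≤ channelInformation A.law (wordType fun i => (x i, s i)) := by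
      refine hcap (τ n) hclose _ ?_
      rw [← hxT']; exact mem_admissibleJoints_wordType hn0 x hs
    have habs := (abs_le.1 (abs_log_conditionalTypeClass_add_le fun i => (x i, y i))).2
    have hMI : mutualInformation (fun a b => wordType (fun i => (x i, y i)) (a, b))
        = channelInformation A.law (wordType fun i => (x i, s i)) := by
      rw [hy]; exact mutualInformation_wordType x s
    rw [hMI, hxQ] at habs
    simp only [← hk, ← hl] at habs
    have hT : (typeClass n (wordType x)).ncard = (typeClass n (τ n)).ncard := by rw [hxT']
    rw [hT, ← ht] at habs
    have hsub : {x | (x ∈ typeClass n (τ n) ∧ A.Reaches x y) ∧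
      wordType (fun i => (x i, y i)) = Q} ⊆ conditionalTypeClass Q y := fun x' hx' => hx'.2
    have hcpos : 0 < (conditionalTypeClass Q y).ncard :=
      (Set.ncard_pos (Set.toFinite _)).2 ⟨x, hxQ⟩
    have htpos : 0 < t := by
      rw [ht]
      exact_mod_cast (Set.ncard_pos (Set.toFinite _)).2 (⟨x, hxT⟩ : (typeClass n (τ n)).Nonempty)
    have hcpos' : (0 : ℝ) < (conditionalTypeClass Q y).ncard := by exact_mod_cast hcpos
    have hle : Real.log ((conditionalTypeClass Q y).ncard / t)
        ≤ -(n * (A.capacity - ε / 2)) * Real.log 2 + k * (1 + l) := by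
      have h3 : n * ((A.capacity - ε / 2) * Real.log 2)
        ≤ n * (channelInformation A.law (wordType fun i => (x i, s i)) * Real.log 2) := by gcongr
      nlinarith
    rw [Real.log_le_iff_le_exp (by positivity), div_le_iff₀ htpos] at hle
    refine le_trans ?_ hle
    exact_mod_cast Set.ncard_le_ncard hsub (Set.toFinite _)
  have hcover : {x | x ∈ typeClass n (τ n) ∧ A.Reaches x y}
      ⊆ ⋃ Q ∈ (ncard_typesOfLength_le (X × Y) n).1.toFinset,
        {x | (x ∈ typeClass n (τ n) ∧ A.Reaches x y) ∧ wordType (fun i => (x i, y i)) = Q} := by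
    intro x hx
    simp only [Set.mem_iUnion]
    exact ⟨wordType fun i => (x i, y i), by simpa using ⟨_, rfl⟩, hx, rfl⟩
  have hnum : (({x | x ∈ typeClass n (τ n) ∧ A.Reaches x y}.ncard : ℕ) : ℝ)
      ≤ ((n : ℝ) + 1) ^ Fintype.card (X × Y) * b := by
    have h3 := (Set.ncard_le_ncard hcover (Set.toFinite _)).trans
      (Finset.set_ncard_biUnion_le _ _)
    have h4 : ((∑ Q ∈ (ncard_typesOfLength_le (X × Y) n).1.toFinset,
        {x | (x ∈ typeClass n (τ n) ∧ A.Reaches x y) ∧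
          wordType (fun i => (x i, y i)) = Q}.ncard : ℕ) : ℝ)
        ≤ ((ncard_typesOfLength_le (X × Y) n).1.toFinset.card : ℝ) * b := by
      rw [Nat.cast_sum, ← nsmul_eq_mul]
      exact Finset.sum_le_card_nsmul _ _ _ fun Q _ => hpiece Q
    have h5 : ((ncard_typesOfLength_le (X × Y) n).1.toFinset.card : ℝ)
        ≤ ((n : ℝ) + 1) ^ Fintype.card (X × Y) := by
      rw [← Set.ncard_eq_toFinset_card _ (ncard_typesOfLength_le (X × Y) n).1]
      exact_mod_cast (ncard_typesOfLength_le (X × Y) n).2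
    exact ((Nat.cast_le.2 h3).trans h4).trans (by gcongr)
  refine hnum.trans ?_
  rw [hb, two_rpow_eq_exp, ← mul_assoc]
  gcongr
  have h6 : ((n : ℝ) + 1) ^ Fintype.card (X × Y) = Real.exp (Fintype.card (X × Y) * l) := by
    rw [hl, mul_comm, Real.exp_mul, Real.exp_log (by positivity), Real.rpow_natCast]
  rw [h6, ← Real.exp_add, Real.exp_le_exp]
  nlinarith [(Fintype.card (X × Y)).cast_nonneg (α := ℝ)]

/-- Along the blocklengths in `N` there is a biregular bipartite graph of density almost
`2 ^ (-n C)` between the type class and a set of output words, joining words to outputs that they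
reach. -/
lemma IsCapacityAchieving.eventually_exists_biregular (hP : A.IsCapacityAchieving P)
    (hN : A.NoiseTypesDense N) (hτ : ∀ n ∈ N, τ n ∈ typesOfLength X n)
    (hlim : Tendsto τ (atTop ⊓ 𝓟 N) (𝓝 P)) {ε : ℝ} (hε : 0 < ε) :
    ∀ᶠ n in atTop ⊓ 𝓟 N, ∃ (B : Set (Fin n → Y)) (r : typeClass n (τ n) → B → Prop) (p : ℝ),
      B.Nonempty ∧ (∀ y, uniformProb {x | r x y} = p) ∧ (∀ x, uniformProb {y | r x y} = p) ∧
      (2 : ℝ) ^ (-((n : ℝ) * (A.capacity + ε))) ≤ p ∧ ∀ x y, r x y → A.Reaches x.1 y.1 := by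
  have h2 : 0 < Real.log 2 := Real.log_pos one_lt_two
  have hε4 : 0 < ε / 4 := by positivity
  obtain ⟨Q, hQ, hQlt⟩ := hP.exists_channelInformation_lt hε4
  obtain ⟨η, hη, hcont⟩ := exists_abs_channelInformation_sub_lt A.law hε4
  obtain ⟨η', hη', n₀, hjoint⟩ := exists_perm_jointType_close hQ.1 hη
  set k : ℝ := (Fintype.card X * Fintype.card Y + Fintype.card X + Fintype.card Y + 3 : ℝ)
    with hk
  have hpoly := eventually_mul_one_add_log_le k (show 0 < ε / 2 * Real.log 2 by positivity)
  filter_upwards [hpoly.filter_mono inf_le_left,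
    (eventually_ge_atTop (max 1 n₀)).filter_mono inf_le_left, eventually_forall_abs_sub_le hlim hη',
    eventually_inf_principal.2 (Eventually.of_forall fun n (hn : n ∈ N) => hn),
    hN _ hQ.2.2 η' hη']
    with n hpoly hn1 hclose hnN hnoise
  have hn0 : n ≠ 0 := by have := le_max_left 1 n₀; omega
  obtain ⟨x₀, hx₀⟩ := hτ n hnN
  obtain ⟨σ, ⟨hσ, s₁, rfl⟩, hσQ⟩ := hnoise
  -- Permuting an admissible noise word keeps its type, hence its admissibility, while bringing its
  -- joint type with `x₀` close to the nearly optimal `Q`.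
  obtain ⟨π, hπ⟩ := hjoint n ((le_max_right 1 n₀).trans hn1) x₀ s₁
    (fun a => by rw [hQ.2.1, hx₀, abs_sub_comm]; exact hclose a) fun b => (hσQ b).le
  set s₀ : Fin n → S := s₁ ∘ π with hs₀
  have hs₀mem : s₀ ∈ A.noiseWords n := by
    change wordType s₀ ∈ A.noiseConstraint
    rw [hs₀, wordType_comp_perm]; exact hσ
  set y₀ : Fin n → Y := fun i => A.law (x₀ i) (s₀ i) with hy₀
  set Q₀ : X × Y → ℝ := wordType fun i => (x₀ i, y₀ i) with hQ₀
  have hinfo : mutualInformation (fun a b => Q₀ (a, b)) ≤ A.capacity + ε / 2 := by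
    have h3 : mutualInformation (fun a b => Q₀ (a, b))
        = channelInformation A.law (wordType fun i => (x₀ i, s₀ i)) :=
      mutualInformation_wordType x₀ s₀
    have h4 := abs_lt.1 (hcont _ (wordType_mem_stdSimplex hn0 fun i => (x₀ i, s₀ i)) Q hQ.1 hπ)
    rw [h3]; linarith [h4.2]
  have hfst : ∀ (x : Fin n → X) (y : Fin n → Y), wordType (fun i => (x i, y i)) = Q₀ →
      wordType x = τ n := by
    intro x y h
    rw [← hx₀]; funext a
    have h3 := wordType_fst (fun i => (x i, y i)) a
    rw [h, hQ₀, ← wordType_fst] at h3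
    exact h3
  have hsnd : ∀ (x : Fin n → X) (y : Fin n → Y), wordType (fun i => (x i, y i)) = Q₀ →
      wordType y = wordType y₀ := by
    intro x y h
    funext a
    have h3 := wordType_snd (fun i => (x i, y i)) a
    rw [h, hQ₀, ← wordType_snd] at h3
    exact h3
  let B : Set (Fin n → Y) := typeClass n (wordType y₀)
  -- Restricting adjacency to one joint type makes the graph biregular, since coordinate
  -- permutations act transitively on both sides; reachability itself need not be biregular.
  let r : typeClass n (τ n) → B → Prop := fun x y => wordType (fun i => (x.1 i, y.1 i)) = Q₀
  have hx₀T : x₀ ∈ typeClass n (τ n) := hx₀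
  have hy₀B : y₀ ∈ B := rfl
  have : Nonempty (typeClass n (τ n)) := ⟨⟨x₀, hx₀T⟩⟩
  have : Nonempty B := ⟨⟨y₀, hy₀B⟩⟩
  have hp : ∀ y, uniformProb {x | r x y}
      = ((conditionalTypeClass Q₀ y₀).ncard : ℝ) / (typeClass n (τ n)).ncard := by
    intro y
    have h3 := uniformProb_subtype (typeClass n (τ n)) fun x =>
      wordType (fun i => (x i, y.1 i)) = Q₀
    have h4 : {x | x ∈ typeClass n (τ n) ∧ wordType (fun i => (x i, y.1 i)) = Q₀}
        = conditionalTypeClass Q₀ y.1 := by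
      ext x
      exact ⟨fun h => h.2, fun h => ⟨hfst x y.1 h, h⟩⟩
    rw [h4, ncard_conditionalTypeClass_congr Q₀ (show wordType y.1 = wordType y₀ from y.2)] at h3
    exact h3
  have hp' : ∀ x, uniformProb {y | r x y}
      = ({y : Fin n → Y | wordType (fun i => (x₀ i, y i)) = Q₀}.ncard : ℝ) / B.ncard := by
    intro x
    have h3 := uniformProb_subtype B fun y => wordType (fun i => (x.1 i, y i)) = Q₀
    have h4 : {y | y ∈ B ∧ wordType (fun i => (x.1 i, y i)) = Q₀}
        = {y : Fin n → Y | wordType (fun i => (x.1 i, y i)) = Q₀} := by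
      ext y
      exact ⟨fun h => h.2, fun h => ⟨hsnd x.1 y h, h⟩⟩
    have h5 : wordType x.1 = wordType x₀ := (show wordType x.1 = τ n from x.2).trans hx₀.symm
    rw [h4, ncard_conditionalTypeClass_congr' Q₀ h5] at h3
    exact h3
  have heq := eq_of_forall_uniformProb_eq hp hp'
  refine ⟨B, r, _, ⟨y₀, hy₀B⟩, hp, fun x => (hp' x).trans heq, ?_, ?_⟩
  · have habs := (abs_le.1 (abs_log_conditionalTypeClass_add_le fun i => (x₀ i, y₀ i))).1
    simp only [← hk, ← hQ₀] at habs
    have hT : (typeClass n (wordType x₀)).ncard = (typeClass n (τ n)).ncard := by rw [hx₀]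
    have hc : (conditionalTypeClass Q₀ fun i => y₀ i) = conditionalTypeClass Q₀ y₀ := rfl
    have hx : (wordType fun i => x₀ i) = wordType x₀ := rfl
    rw [hc, hx, hT] at habs
    have hcpos : (0 : ℝ) < (conditionalTypeClass Q₀ y₀).ncard := by
      exact_mod_cast (Set.ncard_pos (Set.toFinite _)).2
        (⟨x₀, rfl⟩ : (conditionalTypeClass Q₀ y₀).Nonempty)
    have htpos : (0 : ℝ) < (typeClass n (τ n)).ncard := by
      exact_mod_cast (Set.ncard_pos (Set.toFinite _)).2 (⟨x₀, hx₀T⟩ : (typeClass n (τ n)).Nonempty)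
    rw [two_rpow_eq_exp, ← Real.le_log_iff_exp_le (by positivity)]
    have h3 : n * (mutualInformation (fun a b => Q₀ (a, b)) * Real.log 2)
        ≤ n * ((A.capacity + ε / 2) * Real.log 2) := by gcongr
    nlinarith
  · intro x y hxy
    -- A pair of joint type `Q₀` is a coordinate permutation of `(x₀, y₀)`, so the same permutation
    -- of `s₀` leads from `x` to `y`.
    obtain ⟨ρ, hρ⟩ := exists_perm_of_wordType_eq (show wordType (fun i => (x₀ i, y₀ i))
      = wordType (fun i => (x.1 i, y.1 i)) from hxy.symm)
    refine ⟨s₀ ∘ ρ, ?_, fun i => ?_⟩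
    · change wordType (s₀ ∘ ρ) ∈ A.noiseConstraint
      rw [wordType_comp_perm]; exact hs₀mem
    · have h3 := congrFun hρ i
      simp only [Function.comp_apply, Prod.mk.injEq] at h3
      rw [h3.1, h3.2]; rfl

omit [Fintype S] [Fintype Y] in
/-- The type classes have exponential size given by the entropy. -/
lemma eventually_le_ncard_typeClass (hτ : ∀ n ∈ N, τ n ∈ typesOfLength X n)
    (hlim : Tendsto τ (atTop ⊓ 𝓟 N) (𝓝 P)) {ε : ℝ} (hε : 0 < ε) :
    ∀ᶠ n : ℕ in atTop ⊓ 𝓟 N,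
      (2 : ℝ) ^ ((n : ℝ) * (shannonEntropy P - ε)) ≤ (typeClass n (τ n)).ncard := by
  have h2 : 0 < Real.log 2 := Real.log_pos one_lt_two
  have hH : Tendsto (fun n => shannonEntropy (τ n)) (atTop ⊓ 𝓟 N) (𝓝 (shannonEntropy P)) :=
    (continuous_shannonEntropy.tendsto P).comp hlim
  have hpoly := eventually_mul_one_add_log_le (Fintype.card X + 1)
    (show 0 < ε / 2 * Real.log 2 by positivity)
  filter_upwards [hpoly.filter_mono inf_le_left,
    hH.eventually_const_lt (show shannonEntropy P - ε / 2 < shannonEntropy P by linarith),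
    eventually_inf_principal.2 (Eventually.of_forall fun n (hn : n ∈ N) => hn)] with n hpoly hH hnN
  obtain ⟨x₀, hx₀⟩ := hτ n hnN
  have htpos : (0 : ℝ) < (typeClass n (τ n)).ncard := by
    exact_mod_cast (Set.ncard_pos (Set.toFinite _)).2 (⟨x₀, hx₀⟩ : (typeClass n (τ n)).Nonempty)
  have habs := (abs_le.1 (abs_log_ncard_typeClass_sub_le x₀)).1
  rw [hx₀] at habs
  rw [two_rpow_eq_exp, ← Real.le_log_iff_exp_le htpos]
  have h3 : (n : ℝ) * ((shannonEntropy P - ε / 2) * Real.log 2)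
      ≤ n * (shannonEntropy (τ n) * Real.log 2) := by gcongr
  nlinarith

end AdversarialChannel


/-! ### Numerical estimates -/

section Estimates

lemma codeSize_le (n : ℕ) (R : ℝ) : (codeSize n R : ℝ) ≤ (2 : ℝ) ^ ((n : ℝ) * R) :=
  Nat.floor_le (by positivity)

lemma lt_codeSize_add_one (n : ℕ) (R : ℝ) : (2 : ℝ) ^ ((n : ℝ) * R) < codeSize n R + 1 :=
  Nat.lt_floor_add_one _

lemma eventually_sq_mul_le_two_rpow {L : ℕ} (hL : 1 ≤ L) {ε : ℝ} (hε : 0 < ε) :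
    ∀ᶠ n : ℕ in atTop, 2 * ((n : ℝ) ^ 2 * L) ≤ (2 : ℝ) ^ ((n : ℝ) * ε) := by
  have hL' : (0 : ℝ) < L := by exact_mod_cast hL
  filter_upwards [eventually_mul_one_add_log_le (2 + |Real.log (2 * L)|)
    (show 0 < ε * Real.log 2 from mul_pos hε (Real.log_pos one_lt_two))] with n hn
  have hn0 : (0 : ℝ) ≤ n := n.cast_nonneg
  have hl : 0 ≤ Real.log ((n : ℝ) + 1) := Real.log_nonneg (by linarith)
  calc 2 * ((n : ℝ) ^ 2 * L) ≤ ((n : ℝ) + 1) ^ 2 * (2 * L) := by nlinarith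
    _ = Real.exp (Real.log (((n : ℝ) + 1) ^ 2 * (2 * L))) :=
        (Real.exp_log (by positivity)).symm
    _ ≤ (2 : ℝ) ^ ((n : ℝ) * ε) := by
        rw [two_rpow_eq_exp, Real.exp_le_exp, Real.log_mul (by positivity) (by positivity),
          Real.log_pow]
        push_cast
        nlinarith [le_abs_self (Real.log (2 * L)), abs_nonneg (Real.log (2 * L)),
          mul_nonneg (abs_nonneg (Real.log (2 * L))) hl]

lemma eventually_le_codeSize_div {L : ℕ} (hL : 1 ≤ L) {R ε : ℝ} (hε : 0 < ε) (hεR : ε ≤ R) :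
    ∀ᶠ n : ℕ in atTop,
      (2 : ℝ) ^ ((n : ℝ) * (R - ε)) ≤ ((codeSize n R / (n ^ 2 * L) : ℕ) : ℝ) := by
  filter_upwards [eventually_sq_mul_le_two_rpow hL hε, eventually_ge_atTop 1] with n hn hn1
  have hb : 0 < n ^ 2 * L := by positivity
  have h1 : codeSize n R + 1 ≤ n ^ 2 * L * (codeSize n R / (n ^ 2 * L) + 1) :=
    Nat.lt_mul_div_succ _ hb
  have h2 : ((codeSize n R : ℝ) + 1)
      ≤ (n : ℝ) ^ 2 * L * (((codeSize n R / (n ^ 2 * L) : ℕ) : ℝ) + 1) := by exact_mod_cast h1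
  have h3 := (lt_codeSize_add_one n R).le.trans h2
  have hu : (1 : ℝ) ≤ (2 : ℝ) ^ ((n : ℝ) * (R - ε)) :=
    Real.one_le_rpow one_le_two (mul_nonneg n.cast_nonneg (by linarith))
  have h4 : (2 : ℝ) ^ ((n : ℝ) * R) = (2 : ℝ) ^ ((n : ℝ) * ε) * (2 : ℝ) ^ ((n : ℝ) * (R - ε)) := by
    rw [← Real.rpow_add two_pos]; congr 1; ring
  have hb' : (0 : ℝ) < (n : ℝ) ^ 2 * L := by exact_mod_cast hb
  rw [h4] at h3
  have h5 : (n : ℝ) ^ 2 * L * (2 * (2 : ℝ) ^ ((n : ℝ) * (R - ε)))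
      ≤ (n : ℝ) ^ 2 * L * (((codeSize n R / (n ^ 2 * L) : ℕ) : ℝ) + 1) := by
    refine le_trans ?_ h3
    have := mul_le_mul_of_nonneg_right hn (zero_le_one.trans hu)
    linarith
  have h6 := le_of_mul_le_mul_left h5 hb'
  linarith

/-- The quadratic exponent beats every linear one, which is why the code is cut into `n ^ 2` systems
and why the constant `b` may be arbitrary. -/
lemma eventually_one_sub_pow_le {p₀ : ℝ} (h0 : 0 < p₀) (h1 : p₀ ≤ 1) (a b : ℝ) :
    ∀ᶠ n : ℕ in atTop, (1 - p₀) ^ n ^ 2 ≤ (2 : ℝ) ^ (-((n : ℝ) * a) + b) := by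
  have h2 : 0 < Real.log 2 := Real.log_pos one_lt_two
  filter_upwards [tendsto_natCast_atTop_atTop.eventually_ge_atTop
    ((|a| + |b|) * Real.log 2 / p₀), eventually_ge_atTop 1] with n hn hn1
  rw [div_le_iff₀ h0] at hn
  have hn1' : (1 : ℝ) ≤ n := by exact_mod_cast hn1
  calc (1 - p₀) ^ n ^ 2 ≤ Real.exp (-p₀) ^ n ^ 2 :=
        pow_le_pow_left₀ (by linarith) (Real.one_sub_le_exp_neg p₀) _
    _ = Real.exp (-(p₀ * n ^ 2)) := by rw [← Real.exp_nat_mul]; push_cast; congr 1; ring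
    _ ≤ _ := by
        rw [two_rpow_eq_exp, Real.exp_le_exp]
        have h3 : (n : ℝ) * a - b ≤ n * (|a| + |b|) := by
          nlinarith [le_abs_self a, neg_abs_le b, abs_nonneg b]
        have h4 : n * ((|a| + |b|) * Real.log 2) ≤ n * (n * p₀) := by gcongr
        nlinarith

lemma pow_mul_card_mul_pow_le {Y : Type*} [Fintype Y] [Nonempty Y] {C R δ ε a : ℝ} {L : ℕ}
    (hR : R = C - δ) (ha : a ≤ L * (δ - ε) - Real.logb 2 (Fintype.card Y)) (n : ℕ) :
    (codeSize n R : ℝ) ^ L * Fintype.card (Fin n → Y) * ((2 : ℝ) ^ (-((n : ℝ) * (C - ε)))) ^ L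
      ≤ (2 : ℝ) ^ (-((n : ℝ) * a)) := by
  have hY : (0 : ℝ) < Fintype.card Y := by exact_mod_cast Fintype.card_pos
  have h1 : (Fintype.card (Fin n → Y) : ℝ)
      = (2 : ℝ) ^ ((n : ℝ) * Real.logb 2 (Fintype.card Y)) := by
    rw [Fintype.card_fun, Fintype.card_fin, mul_comm, Real.rpow_mul two_pos.le,
      Real.rpow_logb two_pos (by norm_num) hY, Real.rpow_natCast]
    push_cast; rfl
  have h2 : (codeSize n R : ℝ) ^ L ≤ (2 : ℝ) ^ ((n : ℝ) * R * L) := by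
    rw [Real.rpow_mul_natCast two_pos.le]
    exact pow_le_pow_left₀ (by positivity) (codeSize_le n R) L
  rw [h1, ← Real.rpow_mul_natCast two_pos.le]
  calc (codeSize n R : ℝ) ^ L * (2 : ℝ) ^ ((n : ℝ) * Real.logb 2 (Fintype.card Y))
        * (2 : ℝ) ^ (-((n : ℝ) * (C - ε)) * L)
      ≤ (2 : ℝ) ^ ((n : ℝ) * R * L) * (2 : ℝ) ^ ((n : ℝ) * Real.logb 2 (Fintype.card Y))
        * (2 : ℝ) ^ (-((n : ℝ) * (C - ε)) * L) := by gcongr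
    _ = (2 : ℝ) ^ ((n : ℝ) * (-(L * (δ - ε) - Real.logb 2 (Fintype.card Y)))) := by
        rw [← Real.rpow_add two_pos, ← Real.rpow_add two_pos, hR]; congr 1; ring
    _ ≤ _ := by
        refine Real.rpow_le_rpow_of_exponent_le one_le_two ?_
        have := mul_le_mul_of_nonneg_left ha (n.cast_nonneg (α := ℝ))
        linarith

/-- The injective tuples in `s` are counted by a falling factorial, each factor of which is at least
half of `s.ncard`. -/
lemma half_pow_mul_pow_le_uniformProb_injective {T : Type*} [Finite T] [Nonempty T] (s : Set T)
    {L : ℕ} (hs : 2 * L ≤ s.ncard) :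
    (1 / 2 : ℝ) ^ L * uniformProb s ^ L
      ≤ uniformProb {x : Fin L → T | Function.Injective x ∧ ∀ j, x j ∈ s} := by
  classical
  cases nonempty_fintype T
  have h1 : {x : Fin L → T | Function.Injective x ∧ ∀ j, x j ∈ s}.ncard
      = s.ncard.descFactorial L := by
    have e : {x : Fin L → T | Function.Injective x ∧ ∀ j, x j ∈ s}.ncard
        = Nat.card (Fin L ↪ s) := by
      refine Nat.card_congr ⟨fun x => ⟨fun j => ⟨x.1 j, x.2.2 j⟩, fun i j h =>
        x.2.1 (congrArg Subtype.val h)⟩, fun f => ⟨fun j => (f j).1, fun i j h =>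
        f.injective (Subtype.ext h), fun j => (f j).2⟩, fun x => rfl, fun f => rfl⟩
    rw [e, Nat.card_eq_fintype_card, Fintype.card_embedding_eq, Fintype.card_fin,
      ← Nat.card_eq_fintype_card, Nat.card_coe_set_eq]
  have h2 : ((s.ncard : ℝ) / 2) ^ L ≤ (s.ncard.descFactorial L : ℝ) := by
    have h3 : (((s.ncard + 1 - L) ^ L : ℕ) : ℝ) ≤ s.ncard.descFactorial L := by
      exact_mod_cast Nat.pow_sub_le_descFactorial _ _
    refine le_trans ?_ h3
    push_cast
    refine pow_le_pow_left₀ (by positivity) ?_ L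
    rw [Nat.cast_sub (by omega)]
    have : (2 * L : ℝ) ≤ s.ncard := by exact_mod_cast hs
    push_cast; linarith
  have hT : (0 : ℝ) < Fintype.card T := by exact_mod_cast Fintype.card_pos
  rw [uniformProb, uniformProb, h1, Nat.card_eq_fintype_card, Nat.card_eq_fintype_card,
    Fintype.card_fun, Fintype.card_fin, ← mul_pow]
  rw [le_div_iff₀ (by positivity)]
  refine le_trans (le_of_eq ?_) h2
  push_cast
  rw [← mul_pow]
  congr 1
  field_simp

end Estimates

/-! ### List decodability below `C / δ` -/

namespace AdversarialChannel

variable {X S Y : Type*} [Fintype X] [Fintype S] {A : AdversarialChannel X S Y}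

lemma Confusable.mono {n : ℕ} {l l' : Set (Fin n → X)} (h : l ⊆ l') (hl : A.Confusable l') :
    A.Confusable l := by
  obtain ⟨y, hy⟩ := hl
  exact ⟨y, fun x hx => hy x (h hx)⟩

lemma IsMessageListDecodable.succ {n M L : ℕ} {c : Fin M → Fin n → X}
    (h : A.IsMessageListDecodable L c) : A.IsMessageListDecodable (L + 1) c := by
  intro J hJ hconf
  obtain ⟨J', hJ', hc⟩ := Finset.exists_subset_card_eq (show L ≤ J.card by omega)
  exact h J' hc (hconf.mono (Set.image_mono (Finset.coe_subset.2 hJ')))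

lemma IsListDecodable.succ {n L : ℕ} {K : Set (Fin n → X)}
    (h : A.IsListDecodable L K) : A.IsListDecodable (L + 1) K := by
  intro J hJK hJ hconf
  obtain ⟨J', hJ', hc⟩ := Finset.exists_subset_card_eq (show L ≤ J.card by omega)
  exact h J' ((Finset.coe_subset.2 hJ').trans hJK) hc (hconf.mono (Finset.coe_subset.2 hJ'))

lemma IsListDecodable.anti {n L : ℕ} {K K' : Set (Fin n → X)} (hK : K ⊆ K')
    (h : A.IsListDecodable L K') : A.IsListDecodable L K :=
  fun l hl hc => h l (hl.trans hK) hc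

lemma not_isMessageListDecodable_iff {n M L : ℕ} {c : Fin M → Fin n → X} :
    ¬A.IsMessageListDecodable L c ↔
      ∃ f : Fin L → Fin M, Function.Injective f ∧ ∃ y, ∀ j, A.Reaches (c (f j)) y := by
  classical
  constructor
  · intro h
    unfold IsMessageListDecodable at h
    push Not at h
    obtain ⟨J, hJ, y, hy⟩ := h
    refine ⟨fun j => (J.equivFinOfCardEq hJ).symm j, fun i j hij => ?_, y, fun j => ?_⟩
    · exact (J.equivFinOfCardEq hJ).symm.injective (Subtype.ext hij)
    · exact hy _ ⟨_, ((J.equivFinOfCardEq hJ).symm j).2, rfl⟩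
  · rintro ⟨f, hf, y, hy⟩ h
    refine h (Finset.univ.image f) ?_ ⟨y, ?_⟩
    · rw [Finset.card_image_of_injective _ hf, Finset.card_univ, Fintype.card_fin]
    · rintro _ ⟨m, hm, rfl⟩
      obtain ⟨j, _, rfl⟩ := Finset.mem_image.1 (Finset.mem_coe.1 hm)
      exact hy j

lemma not_isListDecodable_of_injective {n L : ℕ} {K : Set (Fin n → X)} {x : Fin L → Fin n → X}
    (hx : Function.Injective x) (hK : ∀ j, x j ∈ K) {y : Fin n → Y} (hy : ∀ j, A.Reaches (x j) y) :
    ¬A.IsListDecodable L K := by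
  classical
  intro h
  refine h (Finset.univ.image x) ?_ ?_ ⟨y, ?_⟩
  · intro z hz
    obtain ⟨j, _, rfl⟩ := Finset.mem_image.1 (Finset.mem_coe.1 hz)
    exact hK j
  · rw [Finset.card_image_of_injective _ hx, Finset.card_univ, Fintype.card_fin]
  · intro z hz
    obtain ⟨j, _, rfl⟩ := Finset.mem_image.1 (Finset.mem_coe.1 hz)
    exact hy j

lemma exists_of_not_isListDecodable {n L : ℕ} {U : Set (Fin n → X)} {K : Finset U}
    (h : ¬A.IsListDecodable L (Subtype.val '' (K : Set U))) :
    ∃ J ⊆ K, J.card = L ∧ ∃ y, ∀ x ∈ J, A.Reaches x.1 y := by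
  classical
  unfold IsListDecodable at h
  push Not at h
  obtain ⟨l, hlK, hl, y, hy⟩ := h
  refine ⟨K.filter fun x => x.1 ∈ l, Finset.filter_subset _ _, ?_, y, fun x hx => ?_⟩
  · rw [← hl, ← Finset.card_image_of_injective _ (Subtype.val_injective (p := (· ∈ U)))]
    congr 1
    ext z
    constructor
    · intro hz
      obtain ⟨x, hx, rfl⟩ := Finset.mem_image.1 hz
      exact (Finset.mem_filter.1 hx).2
    · intro hz
      obtain ⟨x, hx, rfl⟩ := hlK (Finset.mem_coe.2 hz)
      exact Finset.mem_image.2 ⟨x, Finset.mem_filter.2 ⟨Finset.mem_coe.1 hx, hz⟩, rfl⟩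
  · exact hy _ (Finset.mem_coe.2 (Finset.mem_filter.1 hx).2)

variable [Fintype Y] {P : X → ℝ} {N : Set ℕ} {τ : ℕ → X → ℝ}

/-- Below the list size `C / δ`, a random code has a good confusable list except with very small
probability. -/
lemma IsCapacityAchieving.eventually_uniformProb_no_good_list_le (hP : A.IsCapacityAchieving P)
    (hN : A.NoiseTypesDense N) (hτ : ∀ n ∈ N, τ n ∈ typesOfLength X n)
    (hlim : Tendsto τ (atTop ⊓ 𝓟 N) (𝓝 P)) {δ R : ℝ} (hδ : 0 < δ) (hR : R = A.capacity - δ)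
    {L : ℕ} (hL : 1 ≤ L) (hLC : L * δ < A.capacity) {c : ℝ} (hc0 : 0 < c) (hc1 : c ≤ 1)
    {ε₀ : ℝ} (hε₀ : 0 < ε₀) {good : ∀ n, (Fin L → typeClass n (τ n)) → Prop}
    (hgood : ∀ᶠ n : ℕ in atTop ⊓ 𝓟 N, ∀ s : Set (typeClass n (τ n)),
      (2 : ℝ) ^ (-((n : ℝ) * (A.capacity + ε₀))) ≤ uniformProb s →
        c * uniformProb s ^ L ≤ uniformProb {x | good n x ∧ ∀ j, x j ∈ s}) (b : ℝ) :
    ∀ᶠ n : ℕ in atTop ⊓ 𝓟 N, ∀ F : CodewordTuple n (codeSize n R) (τ n) → Prop,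
      (∀ c, F c → ∀ f : Fin L → Fin (codeSize n R), Function.Injective f →
        good n (fun j => c (f j)) → ¬∃ y, ∀ j, A.Reaches (c (f j)).1 y) →
      uniformProb {c | F c} ≤ (2 : ℝ) ^ (-((n : ℝ) * δ) + b) := by
  have hL' : (1 : ℝ) ≤ L := by exact_mod_cast hL
  have hR0 : 0 < R := by nlinarith
  -- The three bounds serve, in order, the hypothesis on `good`, the block size `m ≥ 2^(n(R-ε)) ≥
  -- 1`, and the condition of the second moment argument.
  set ε : ℝ := min ε₀ (min R ((A.capacity - L * δ) / (2 * L))) with hε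
  have hε0 : 0 < ε := lt_min hε₀ (lt_min hR0 (div_pos (by linarith) (by linarith)))
  have hεε₀ : ε ≤ ε₀ := min_le_left _ _
  have hεR : ε ≤ R := (min_le_right _ _).trans (min_le_left _ _)
  have hεL : 2 * L * ε ≤ A.capacity - L * δ := by
    have h1 : ε ≤ (A.capacity - L * δ) / (2 * L) := (min_le_right _ _).trans (min_le_right _ _)
    rw [le_div_iff₀ (by positivity)] at h1
    linarith
  set p₀ : ℝ := c ^ 2 / 2 ^ L with hp₀
  have hp₀0 : 0 < p₀ := by positivity
  have hp₀1 : p₀ ≤ 1 := div_le_one_of_le₀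
    ((pow_le_one₀ hc0.le hc1).trans (one_le_pow₀ one_le_two)) (by positivity)
  filter_upwards [hP.eventually_exists_biregular hN hτ hlim hε0, hgood,
    (eventually_le_codeSize_div hL hε0 hεR).filter_mono inf_le_left,
    (eventually_one_sub_pow_le hp₀0 hp₀1 δ b).filter_mono inf_le_left,
    eventually_inf_principal.2 (Eventually.of_forall fun n (hn : n ∈ N) => hn)]
    with n hbireg hgood hm hpow hnN F hF
  obtain ⟨B, r, p, hBne, hp, hp', hpge, hreach⟩ := hbireg
  obtain ⟨x₀, hx₀⟩ := hτ n hnN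
  have : Nonempty (typeClass n (τ n)) := ⟨⟨x₀, hx₀⟩⟩
  have : Nonempty B := hBne.to_subtype
  have : Fintype (typeClass n (τ n)) := Fintype.ofFinite _
  have : Fintype B := Fintype.ofFinite _
  set m := codeSize n R / (n ^ 2 * L) with hmdef
  have hu : (0 : ℝ) < (2 : ℝ) ^ ((n : ℝ) * (R - ε)) := by positivity
  have hv : (0 : ℝ) < (2 : ℝ) ^ (-((n : ℝ) * (A.capacity + ε))) := by positivity
  have hm0 : 0 < m := by
    have : (0 : ℝ) < m := hu.trans_le hm
    exact_mod_cast this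
  have hp0 : 0 < p := hv.trans_le hpge
  -- The exponent is `(R - ε) + (L - 1)(R - C - 2ε) = C - Lδ - (2L - 1)ε`, nonnegative by the choice
  -- of `ε`.
  have hmq : (1 : ℝ) ≤ m * (m * p) ^ (L - 1) := by
    calc (1 : ℝ) ≤ (2 : ℝ) ^ ((n : ℝ) * (A.capacity - L * δ - (2 * L - 1) * ε)) :=
          Real.one_le_rpow one_le_two (mul_nonneg n.cast_nonneg (by nlinarith))
      _ = (2 : ℝ) ^ ((n : ℝ) * (R - ε)) * ((2 : ℝ) ^ ((n : ℝ) * (R - ε)) *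
            (2 : ℝ) ^ (-((n : ℝ) * (A.capacity + ε)))) ^ (L - 1) := by
          rw [← Real.rpow_add two_pos, ← Real.rpow_mul_natCast two_pos.le, ← Real.rpow_add two_pos,
            Nat.cast_sub hL, hR]
          congr 1; push_cast; ring
      _ ≤ _ := by gcongr
  have hE := le_uniformProb_exists_common_neighbour hp hp' hp0 hL hm0 (good := good n) hc0.le
    (fun y => by
      have h1 := hgood {x | r x y} (by
        rw [hp]
        refine le_trans ?_ hpge
        refine Real.rpow_le_rpow_of_exponent_le one_le_two ?_
        have := mul_le_mul_of_nonneg_left hεε₀ (n.cast_nonneg (α := ℝ))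
        linarith)
      rw [hp] at h1
      exact h1) hmq
  refine (uniformProb_le_one_sub_pow (K := n ^ 2) (L := L) (m := m) ?_ hE ?_).trans hpow
  · rw [← mul_assoc]; exact Nat.mul_div_le _ _
  · rintro c hc e he ⟨f, hgf, y, hy⟩
    refine hF c hc (fun j => e j (f j)) (fun i j hij => he _ _ _ _ hij) hgf ⟨y.1, fun j => ?_⟩
    exact hreach _ _ (hy j)

lemma eventually_uniformProb_isMessageListDecodable_le (hP : A.IsCapacityAchieving P)
    (hN : A.NoiseTypesDense N) (hτ : ∀ n ∈ N, τ n ∈ typesOfLength X n)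
    (hlim : Tendsto τ (atTop ⊓ 𝓟 N) (𝓝 P)) {δ R : ℝ} (hδ : 0 < δ) (hR : R = A.capacity - δ)
    {L : ℕ} (hL : 1 ≤ L) (hLC : L * δ < A.capacity) (b : ℝ) :
    ∀ᶠ n : ℕ in atTop ⊓ 𝓟 N, uniformProb {c : CodewordTuple n (codeSize n R) (τ n) |
      A.IsMessageListDecodable L c.encoder} ≤ (2 : ℝ) ^ (-((n : ℝ) * δ) + b) := by
  filter_upwards [hP.eventually_uniformProb_no_good_list_le hN hτ hlim hδ hR hL hLC one_pos le_rfl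
    one_pos (good := fun _ _ => True) (Eventually.of_forall fun n s _ => by
      have : Fintype (typeClass n (τ n)) := Fintype.ofFinite _
      have h1 := uniformProb_forall_eq_pow (fun x : typeClass n (τ n) => x ∈ s) L
      simp only [true_and, one_mul]
      exact h1.ge) b] with n hn
  refine hn _ fun c hc f hf _ hy => ?_
  exact not_isMessageListDecodable_iff.2 ⟨f, hf, hy⟩ hc

lemma eventually_uniformProb_isListDecodable_range_le (hP : A.IsCapacityAchieving P)
    (hN : A.NoiseTypesDense N) (hτ : ∀ n ∈ N, τ n ∈ typesOfLength X n)
    (hlim : Tendsto τ (atTop ⊓ 𝓟 N) (𝓝 P)) (hC : A.capacity < shannonEntropy P)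
    {δ R : ℝ} (hδ : 0 < δ) (hR : R = A.capacity - δ)
    {L : ℕ} (hL : 1 ≤ L) (hLC : L * δ < A.capacity) (b : ℝ) :
    ∀ᶠ n : ℕ in atTop ⊓ 𝓟 N, uniformProb {c : CodewordTuple n (codeSize n R) (τ n) |
      A.IsListDecodable L (Set.range c.encoder)} ≤ (2 : ℝ) ^ (-((n : ℝ) * δ) + b) := by
  -- A neighbourhood of density at least `2^(-n(C+ε))` in a type class of size at least `2^(n(H-ε))`
  -- has at least `2^(nε)` words, eventually more than `2L`.
  set ε : ℝ := (shannonEntropy P - A.capacity) / 3 with hε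
  have hε0 : 0 < ε := by rw [hε]; linarith
  have hbig : ∀ᶠ n : ℕ in atTop, 2 * (((n : ℝ)) ^ 2 * L) ≤ (2 : ℝ) ^ ((n : ℝ) * ε) :=
    eventually_sq_mul_le_two_rpow hL hε0
  filter_upwards [hP.eventually_uniformProb_no_good_list_le hN hτ hlim hδ hR hL hLC
    (c := (1 / 2 : ℝ) ^ L) (by positivity) (pow_le_one₀ (by norm_num) (by norm_num)) hε0
    (good := fun _ x => Function.Injective x) (by
      filter_upwards [eventually_le_ncard_typeClass hτ hlim hε0, hbig.filter_mono inf_le_left,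
        (eventually_ge_atTop 1).filter_mono inf_le_left] with n hcard hbig hn1 s hs
      have htpos : (0 : ℝ) < (typeClass n (τ n)).ncard :=
        (by positivity : (0 : ℝ) < _).trans_le hcard
      have hne : (typeClass n (τ n)).Nonempty :=
        (Set.ncard_pos (Set.toFinite _)).1 (by exact_mod_cast htpos)
      have : Nonempty (typeClass n (τ n)) := hne.to_subtype
      refine half_pow_mul_pow_le_uniformProb_injective s ?_
      rw [uniformProb, Nat.card_coe_set_eq, le_div_iff₀ htpos] at hs
      have h1 : (2 : ℝ) ^ ((n : ℝ) * ε) ≤ s.ncard := by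
        refine le_trans ?_ hs
        calc (2 : ℝ) ^ ((n : ℝ) * ε)
            = (2 : ℝ) ^ (-((n : ℝ) * (A.capacity + ε)))
              * (2 : ℝ) ^ ((n : ℝ) * (shannonEntropy P - ε)) := by
              rw [← Real.rpow_add two_pos, hε]; congr 1; ring
          _ ≤ _ := by gcongr
      have h2 : (2 * L : ℝ) ≤ s.ncard := by
        refine le_trans ?_ (hbig.trans h1)
        have hn1' : (1 : ℝ) ≤ (n : ℝ) ^ 2 := one_le_pow₀ (by exact_mod_cast hn1)
        nlinarith [L.cast_nonneg (α := ℝ)]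
      exact_mod_cast h2) b] with n hn
  refine hn _ fun c hc f hf hinj => ?_
  rintro ⟨y, hy⟩
  exact not_isListDecodable_of_injective (x := fun j => (c (f j)).1)
    (Subtype.val_injective.comp hinj) (fun j => Set.mem_range_self (f := c.encoder) (f j)) hy hc

end AdversarialChannel


/-! ### Locating the list size -/

namespace AdversarialChannel

variable {X S Y : Type*} [Fintype X] [Fintype S] [Fintype Y] {A : AdversarialChannel X S Y}
  {P : X → ℝ} {N : Set ℕ} {τ : ℕ → X → ℝ}

/-- If decodability is monotone in `L`, unlikely below `C / δ` and likely at some list size in the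
range, then the least list size is likely to be in the range. -/
lemma le_uniformProb_listSizeRange_sInf {Ω : Type*} [Finite Ω] [Nonempty Ω] {δ u v : ℝ} {L₀ : ℕ}
    (hL₀ : A.ListSizeRange δ L₀) (dec : ℕ → Ω → Prop) (hdec : ∀ L ω, dec L ω → dec (L + 1) ω)
    (hu : uniformProb {ω | ¬dec L₀ ω} ≤ u) (hv0 : 0 ≤ v)
    (hv : ∀ L : ℕ, (L : ℝ) < A.capacity / δ → uniformProb {ω | dec L ω} ≤ v) :
    1 - u - v ≤ uniformProb {ω | A.ListSizeRange δ (sInf {L | dec L ω})} := by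
  have hmono : ∀ ω L L', L ≤ L' → dec L ω → dec L' ω := by
    intro ω L L' hLL' h
    induction L', hLL' using Nat.le_induction with
    | base => exact h
    | succ k _ ih => exact hdec k ω ih
  set G : Set Ω := {ω | A.ListSizeRange δ (sInf {L | dec L ω})} with hG
  set D : Set Ω := {ω | ∃ L : ℕ, (L : ℝ) < A.capacity / δ ∧ dec L ω} with hD
  -- The events are nested in `L`, so `D` lies in the event for the largest integer below `C / δ`;
  -- no union bound is needed and `v` is not multiplied.
  have hDv : uniformProb D ≤ v := by
    by_cases h : ∃ L : ℕ, (L : ℝ) < A.capacity / δ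
    · obtain ⟨L₁, hL₁⟩ := h
      have h1 : 0 < ⌈A.capacity / δ⌉₊ := (Nat.zero_le L₁).trans_lt (Nat.lt_ceil.2 hL₁)
      have h2 : ((⌈A.capacity / δ⌉₊ - 1 : ℕ) : ℝ) < A.capacity / δ := Nat.lt_ceil.1 (by omega)
      refine (uniformProb_mono ?_).trans (hv _ h2)
      rintro ω ⟨L, hL, hdL⟩
      have h3 := Nat.lt_ceil.2 hL
      exact hmono ω L _ (by omega) hdL
    · have : D = ∅ := by
        ext ω
        constructor
        · rintro ⟨L, hL, _⟩; exact (h ⟨L, hL⟩).elim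
        · intro h; exact h.elim
      rw [this]
      simpa [uniformProb] using hv0
  have hsub : Gᶜ ⊆ {ω | ¬dec L₀ ω} ∪ D := by
    intro ω hω
    by_cases h : dec L₀ ω
    · right
      have hle : sInf {L | dec L ω} ≤ L₀ := Nat.sInf_le h
      -- Decodability at `L₀` excludes the default value `0` of the infimum of the empty set.
      have hmem : dec (sInf {L | dec L ω}) ω := Nat.sInf_mem (⟨L₀, h⟩ : {L | dec L ω}.Nonempty)
      have hle' : ((sInf {L | dec L ω} : ℕ) : ℝ) ≤ L₀ := by exact_mod_cast hle
      refine ⟨sInf {L | dec L ω}, ?_, hmem⟩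
      by_contra hge
      push Not at hge
      exact hω ⟨hge, hle'.trans_lt hL₀.2.1, fun h1 h2 => hle'.trans (hL₀.2.2 h1 h2)⟩
    · left; exact h
  have h1 := uniformProb_add_compl G
  have h2 := (uniformProb_mono hsub).trans (uniformProb_union_le _ _)
  linarith

lemma IsCapacityAchieving.nonempty_output (hP : A.IsCapacityAchieving P) : Nonempty Y := by
  obtain ⟨Q, hQ⟩ := A.admissibleJoints_nonempty hP.mem_stdSimplex
  by_contra h
  rw [not_nonempty_iff] at h
  have := (outputJoint_snd_mem A.law hQ.1).2
  simp at this

omit [Fintype Y] in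
/-- Bounds for failing to be list decodable at `L`, from a bound on the reachable fraction. -/
lemma uniformProb_not_decodable_le [Finite Y] {n M L : ℕ} {σ : X → ℝ} (hσ : σ ∈ typesOfLength X n)
    {p : ℝ} (hp : ∀ y : Fin n → Y, uniformProb {x : typeClass n σ | A.Reaches x.1 y} ≤ p) :
    uniformProb {c : CodewordTuple n M σ | ¬A.IsMessageListDecodable L c.encoder}
        ≤ (M : ℝ) ^ L * Nat.card (Fin n → Y) * p ^ L ∧
      uniformProb {K : ConstCompCode n M σ | ¬A.IsListDecodable L K.1}
        ≤ (M : ℝ) ^ L * Nat.card (Fin n → Y) * p ^ L := by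
  classical
  cases nonempty_fintype Y
  obtain ⟨x₀, hx₀⟩ := hσ
  have : Nonempty (typeClass n σ) := ⟨⟨x₀, hx₀⟩⟩
  have : Fintype (typeClass n σ) := Fintype.ofFinite _
  rw [Nat.card_eq_fintype_card]
  constructor
  · refine (uniformProb_mono fun c hc => ?_).trans
      (uniformProb_exists_tuple_le (r := fun (x : typeClass n σ) y => A.Reaches x.1 y) hp L M)
    exact not_isMessageListDecodable_iff.1 hc
  · refine (uniformProb_set_ncard_eq (typeClass n σ) M fun K => ¬A.IsListDecodable L K).trans_le ?_
    refine (uniformProb_mono fun K hK => ?_).trans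
      (uniformProb_exists_subset_le (r := fun (x : typeClass n σ) y => A.Reaches x.1 y) hp L M)
    exact exists_of_not_isListDecodable hK

omit [Fintype Y] in
lemma uniformProb_not_decodable_eq_zero {n M L : ℕ} (σ : X → ℝ) (hML : M < L) :
    uniformProb {c : CodewordTuple n M σ | ¬A.IsMessageListDecodable L c.encoder} = 0 ∧
      uniformProb {K : ConstCompCode n M σ | ¬A.IsListDecodable L K.1} = 0 := by
  constructor
  · have : {c : CodewordTuple n M σ | ¬A.IsMessageListDecodable L c.encoder} = ∅ := by
      refine Set.eq_empty_of_forall_notMem fun c hc => hc ?_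
      intro J hJ
      have := Finset.card_le_univ J
      rw [Fintype.card_fin] at this
      omega
    rw [this]; simp [uniformProb]
  · have : {K : ConstCompCode n M σ | ¬A.IsListDecodable L K.1} = ∅ := by
      refine Set.eq_empty_of_forall_notMem fun K hK => hK ?_
      intro J hJK hJ
      have h1 := Set.ncard_le_ncard hJK (Set.toFinite _)
      rw [Set.ncard_coe_finset, K.2.2] at h1
      omega
    rw [this]; simp [uniformProb]

/-- Some list size in the range is sufficient with high probability. -/
lemma IsCapacityAchieving.exists_sufficient_listSize (hP : A.IsCapacityAchieving P)
    (hτ : ∀ n ∈ N, τ n ∈ typesOfLength X n) (hlim : Tendsto τ (atTop ⊓ 𝓟 N) (𝓝 P))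
    {δ R : ℝ} (hδ : 0 < δ) (hR : R = A.capacity - δ) :
    ∃ L₀ : ℕ, A.ListSizeRange δ L₀ ∧ ∃ θ > 0, ∀ᶠ n : ℕ in atTop ⊓ 𝓟 N, ∃ u : ℝ,
      u ≤ (2 : ℝ) ^ (-((n : ℝ) * (1 - R))) ∧ u ≤ (2 : ℝ) ^ (-((n : ℝ) * θ)) ∧
      uniformProb {c : CodewordTuple n (codeSize n R) (τ n) |
        ¬A.IsMessageListDecodable L₀ c.encoder} ≤ u ∧
      uniformProb {K : ConstCompCode n (codeSize n R) (τ n) | ¬A.IsListDecodable L₀ K.1} ≤ u := by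
  have hYne := hP.nonempty_output
  have hCY := hP.capacity_le_logb_card
  set y : ℝ := Real.logb 2 (Fintype.card Y) with hy
  have hy0 : 0 ≤ y := Real.logb_nonneg one_lt_two (by exact_mod_cast Fintype.card_pos)
  rcases lt_or_ge 0 R with hR0 | hR0
  · set C := A.capacity with hC
    -- The union bound needs `Lδ > y + 1 - R` for the exponent `1 - R`, and `Lδ > y` for any decay
    -- at all when `R ≥ 1`. As `R > 0`, `a < 1 + y`, which leaves room for an integer in range.
    set a : ℝ := max y (y + 1 - R) with ha
    have hay : y ≤ a := le_max_left _ _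
    have haR : y + 1 - R ≤ a := le_max_right _ _
    have ha0 : 0 ≤ a := hy0.trans hay
    have ha1 : a < 1 + y := max_lt (by linarith) (by linarith)
    set L₀ : ℕ := max (⌊a / δ⌋₊ + 1) ⌈C / δ⌉₊ with hL₀
    have hCδ : 0 ≤ C / δ := div_nonneg (by linarith) hδ.le
    have hfl : ((⌊a / δ⌋₊ + 1 : ℕ) : ℝ) ≤ a / δ + 1 := by
      push_cast; linarith [Nat.floor_le (div_nonneg ha0 hδ.le)]
    have hce : ((⌈C / δ⌉₊ : ℕ) : ℝ) ≤ C / δ + 1 := (Nat.ceil_lt_add_one hCδ).le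
    have hL₀le : (L₀ : ℝ) ≤ max (a / δ + 1) (C / δ + 1) := by
      rw [hL₀, Nat.cast_max]; exact max_le_max hfl hce
    have hL₀a : a < L₀ * δ := by
      rw [← div_lt_iff₀ hδ]
      have h2 : a / δ < ((⌊a / δ⌋₊ + 1 : ℕ) : ℝ) := by push_cast; exact Nat.lt_floor_add_one _
      exact h2.trans_le (by exact_mod_cast le_max_left _ _)
    have hL₀0 : (0 : ℝ) < L₀ := by
      have := ha0.trans_lt hL₀a
      exact pos_of_mul_pos_left this hδ.le
    refine ⟨L₀, ⟨?_, ?_, ?_⟩, (L₀ * δ - a) / 2, by linarith, ?_⟩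
    · exact (Nat.le_ceil _).trans (by exact_mod_cast le_max_right _ _)
    · refine hL₀le.trans_lt (max_lt ?_ ?_)
      · gcongr
      · gcongr; linarith
    -- Rounding up costs at most `δ` in `Lδ`. It is affordable because `y + δ ≤ y + 1`, `2δ ≤ C`
    -- means `δ ≤ R`, and `C ≤ y`.
    · intro hδ1 h2δ
      refine hL₀le.trans (max_le ?_ ?_)
      · rw [div_add_one hδ.ne', ← hy]
        refine (div_le_div_iff_of_pos_right hδ).2 ?_
        rcases max_cases y (y + 1 - R) with h | h <;> rw [ha, h.1] <;> linarith
      · rw [div_add_one hδ.ne', ← hy]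
        refine (div_le_div_iff_of_pos_right hδ).2 ?_
        linarith
    · set ε : ℝ := (L₀ * δ - a) / (2 * L₀) with hε
      have hε0 : 0 < ε := div_pos (by linarith) (by linarith)
      have hLε : L₀ * ε = (L₀ * δ - a) / 2 := by rw [hε]; field_simp
      filter_upwards [hP.eventually_uniformProb_reaches_le hlim hε0,
        eventually_inf_principal.2 (Eventually.of_forall fun n (hn : n ∈ N) => hn)] with n hn hnN
      have h3 := uniformProb_not_decodable_le (M := codeSize n R) (L := L₀) (hτ n hnN) hn
      rw [Nat.card_eq_fintype_card] at h3
      refine ⟨_, ?_, ?_, h3.1, h3.2⟩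
      · refine pow_mul_card_mul_pow_le hR ?_ n
        rw [← hy, mul_sub, hLε]; linarith
      · refine pow_mul_card_mul_pow_le hR ?_ n
        rw [← hy, mul_sub, hLε]; linarith
  -- For `R ≤ 0` the code eventually has no words if `R < 0`, and one word if `R = 0`, so lists of
  -- size `1`, respectively `2`, do not exist. The sharper upper end of the range is not claimed
  -- here, as `2δ ≤ C` would contradict `C ≤ δ`.
  · have key : ∃ L₀ : ℕ, A.ListSizeRange δ L₀ ∧
        ∀ᶠ n : ℕ in atTop ⊓ 𝓟 N, codeSize n R < L₀ := by
      have hCδ : A.capacity / δ ≤ 1 := by rw [div_le_one hδ]; linarith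
      rcases hR0.lt_or_eq with hlt | heq
      · refine ⟨1, ⟨by simpa using hCδ, ?_, fun h1 h2 => by linarith⟩, ?_⟩
        · rw [← hy]
          have : 0 < (1 + y) / δ := by positivity
          push_cast; linarith
        · filter_upwards [(eventually_ge_atTop 1).filter_mono inf_le_left] with n hn
          unfold codeSize
          rw [Nat.floor_lt (by positivity), Nat.cast_one]
          exact Real.rpow_lt_one_of_one_lt_of_neg one_lt_two
            (mul_neg_of_pos_of_neg (by exact_mod_cast hn) hlt)
      · refine ⟨2, ⟨by push_cast; linarith, ?_, fun h1 h2 => by linarith⟩, ?_⟩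
        · rw [← hy]
          have : 1 < (1 + y) / δ := by rw [one_lt_div hδ]; linarith
          push_cast; linarith
        · refine Eventually.of_forall fun n => ?_
          unfold codeSize
          rw [heq, mul_zero, Real.rpow_zero, Nat.floor_one]
          norm_num
    obtain ⟨L₀, hL₀, hev⟩ := key
    refine ⟨L₀, hL₀, 1, one_pos, ?_⟩
    filter_upwards [hev] with n hn
    have h3 := uniformProb_not_decodable_eq_zero (A := A) (n := n) (τ n) hn
    exact ⟨0, by positivity, by positivity, h3.1.le, h3.2.le⟩

/-- Since `C ≤ H(P)`, the type class has at least `2^(n(C-δ))` words. Without such codes every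
fraction would be `0 / 0 = 0` and the lower bounds could fail. -/
lemma IsCapacityAchieving.eventually_nonempty_constCompCode (hP : A.IsCapacityAchieving P)
    (hτ : ∀ n ∈ N, τ n ∈ typesOfLength X n) (hlim : Tendsto τ (atTop ⊓ 𝓟 N) (𝓝 P))
    {δ R : ℝ} (hδ : 0 < δ) (hR : R = A.capacity - δ) :
    ∀ᶠ n : ℕ in atTop ⊓ 𝓟 N, Nonempty (ConstCompCode n (codeSize n R) (τ n)) := by
  filter_upwards [eventually_le_ncard_typeClass hτ hlim hδ] with n hn
  have h1 : (codeSize n R : ℝ) ≤ (typeClass n (τ n)).ncard := by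
    refine (codeSize_le n R).trans (le_trans ?_ hn)
    refine Real.rpow_le_rpow_of_exponent_le one_le_two ?_
    have := hP.capacity_le_entropy
    gcongr
    linarith
  have h2 : codeSize n R ≤ (typeClass n (τ n)).ncard := by exact_mod_cast h1
  obtain ⟨K, hK, hKc⟩ := Set.exists_subset_card_eq h2
  exact ⟨⟨K, hK, hKc⟩⟩

omit [Fintype Y] in
lemma uniformProb_constCompCode_le_uniformProb_tuple {n M L : ℕ} {σ : X → ℝ}
    (hσ : σ ∈ typesOfLength X n) :
    uniformProb {K : ConstCompCode n M σ | A.IsListDecodable L K.1}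
      ≤ uniformProb {c : CodewordTuple n M σ | A.IsListDecodable L (Set.range c.encoder)} := by
  classical
  obtain ⟨x₀, hx₀⟩ := hσ
  have : Nonempty (typeClass n σ) := ⟨⟨x₀, hx₀⟩⟩
  have : Fintype (typeClass n σ) := Fintype.ofFinite _
  refine (uniformProb_set_ncard_eq (typeClass n σ) M fun K => A.IsListDecodable L K).trans_le ?_
  refine (uniformProb_finset_card_le_uniformProb_tuple
    (p := fun K : Finset (typeClass n σ) =>
      A.IsListDecodable L (Subtype.val '' (K : Set (typeClass n σ))))
    (fun J K hJK h => h.anti (Set.image_mono (Finset.coe_subset.2 hJK))) M).trans ?_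
  refine uniformProb_mono fun c hc => ?_
  have h1 : Set.range (CodewordTuple.encoder c)
      = Subtype.val '' ((Finset.univ.image c : Finset (typeClass n σ)) : Set (typeClass n σ)) := by
    rw [Finset.coe_image, Finset.coe_univ, Set.image_univ, ← Set.range_comp]
    rfl
  change A.IsListDecodable L (Set.range (CodewordTuple.encoder c))
  rw [h1]
  exact hc

/-- An eventual bound for every positive `L < C / δ` holds for all `L < C / δ` simultaneously. -/
lemma eventually_forall_lt_capacity_div {δ : ℝ} (hδ : 0 < δ) {f : ℕ → ℕ → ℝ} {g : ℕ → ℝ}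
    (hf0 : ∀ n, f n 0 = 0) (hg : ∀ n, 0 ≤ g n)
    (h : ∀ L : ℕ, 1 ≤ L → L * δ < A.capacity → ∀ᶠ n in atTop ⊓ 𝓟 N, f n L ≤ g n) :
    ∀ᶠ n in atTop ⊓ 𝓟 N, ∀ L : ℕ, (L : ℝ) < A.capacity / δ → f n L ≤ g n := by
  have h1 : ∀ᶠ n in atTop ⊓ 𝓟 N, ∀ L ∈ Finset.range ⌈A.capacity / δ⌉₊, f n L ≤ g n := by
    refine (eventually_all_finset _).2 fun L hL => ?_
    rcases Nat.eq_zero_or_pos L with rfl | hL0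
    · exact Eventually.of_forall fun n => by rw [hf0]; exact hg n
    · refine h L hL0 ?_
      rw [← lt_div_iff₀ hδ]
      exact Nat.lt_ceil.1 (Finset.mem_range.1 hL)
  filter_upwards [h1] with n hn L hL
  exact hn L (Finset.mem_range.2 (Nat.lt_ceil.2 hL))

-- At `L = 0` the empty list is confusable by any output word, so the case excluded from the second
-- moment argument is trivial.
omit [Fintype Y] in
lemma uniformProb_zero_decodable_eq_zero [Nonempty Y] {n M : ℕ} (σ : X → ℝ) :
    uniformProb {c : CodewordTuple n M σ | A.IsMessageListDecodable 0 c.encoder} = 0 ∧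
      uniformProb {c : CodewordTuple n M σ | A.IsListDecodable 0 (Set.range c.encoder)} = 0 := by
  have hy : Nonempty (Fin n → Y) := inferInstance
  obtain ⟨y⟩ := hy
  constructor
  · have : {c : CodewordTuple n M σ | A.IsMessageListDecodable 0 c.encoder} = ∅ := by
      refine Set.eq_empty_of_forall_notMem fun c hc => hc ∅ rfl ⟨y, ?_⟩
      simp
    rw [this]; simp [uniformProb]
  · have : {c : CodewordTuple n M σ | A.IsListDecodable 0 (Set.range c.encoder)} = ∅ := by
      refine Set.eq_empty_of_forall_notMem fun c hc => hc ∅ ?_ rfl ⟨y, ?_⟩ <;> simp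
    rw [this]; simp [uniformProb]

lemma tendsto_one_of_eventually_le {f : ℕ → ℝ} {θ δ b : ℝ} (hθ : 0 < θ) (hδ : 0 < δ)
    (hle : ∀ n, f n ≤ 1) (h : ∀ᶠ n : ℕ in atTop ⊓ 𝓟 N,
      1 - (2 : ℝ) ^ (-((n : ℝ) * θ)) - (2 : ℝ) ^ (-((n : ℝ) * δ) + b) ≤ f n) :
    Tendsto f (atTop ⊓ 𝓟 N) (𝓝 1) := by
  have h1 : Tendsto (fun n : ℕ => 1 - (2 : ℝ) ^ (-((n : ℝ) * θ)) - (2 : ℝ) ^ (-((n : ℝ) * δ) + b))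
      (atTop ⊓ 𝓟 N) (𝓝 1) := by
    have h2 := tendsto_two_rpow_neg_mul hθ 0
    have h3 := tendsto_two_rpow_neg_mul hδ b
    simp only [add_zero] at h2
    have h4 := (tendsto_const_nhds (x := (1 : ℝ))).sub h2 |>.sub h3
    simp only [sub_zero] at h4
    exact h4.mono_left inf_le_left
  exact tendsto_of_tendsto_of_tendsto_of_le_of_le' h1 tendsto_const_nhds h
    (Eventually.of_forall hle)

end AdversarialChannel

end

/-! ### Assembly of the theorem -/

theorem mainTheorem4 {X S Y : Type*} [Fintype X] [Fintype S] [Fintype Y]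
    (A : AdversarialChannel X S Y)
    (Pstar : X → ℝ) (hP : A.IsCapacityAchieving Pstar)
    (N : Set ℕ) (hN : A.NoiseTypesDense N)
    (τ : ℕ → X → ℝ) (hτ : ∀ n ∈ N, τ n ∈ typesOfLength X n)
    (hlim : Tendsto τ (atTop ⊓ 𝓟 N) (𝓝 Pstar))
    (δ : ℝ) (hδ : 0 < δ) (R : ℝ) (hR : R = A.capacity - δ) :
    -- Random codes, lists of messages.
    ((∀ᶠ n : ℕ in atTop ⊓ 𝓟 N,
        (∀ L : ℕ, (L : ℝ) < A.capacity / δ →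
          uniformProb {c : CodewordTuple n (codeSize n R) (τ n) |
              A.IsMessageListDecodable L c.encoder}
            ≤ (2 : ℝ) ^ (-((n : ℝ) * δ) + 2 / δ * Real.logb 2 (1 / δ))) ∧
        1 - (2 : ℝ) ^ (-((n : ℝ) * (1 - R)))
            - (2 : ℝ) ^ (-((n : ℝ) * δ) + 2 / δ * Real.logb 2 (1 / δ))
          ≤ uniformProb {c : CodewordTuple n (codeSize n R) (τ n) |
              A.ListSizeRange δ (A.messageListSize c.encoder)}) ∧
      Tendsto (fun n : ℕ => uniformProb {c : CodewordTuple n (codeSize n R) (τ n) |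
          A.ListSizeRange δ (A.messageListSize c.encoder)})
        (atTop ⊓ 𝓟 N) (𝓝 1)) ∧
    -- Most constant composition codes are list decodable with a list size in the range.
    (∀ᶠ n : ℕ in atTop ⊓ 𝓟 N,
      1 - (2 : ℝ) ^ (-((n : ℝ) * (1 - R)))
          - (2 : ℝ) ^ (-((n : ℝ) * δ) + 2 / δ * Real.logb 2 (1 / δ))
        ≤ uniformProb {K : ConstCompCode n (codeSize n R) (τ n) |
            ∃ L : ℕ, A.ListSizeRange δ L ∧ A.IsListDecodable L K.1}) ∧
    -- Lists of distinct codewords, for a channel that is not noiseless under `Pstar`.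
    (A.capacity < shannonEntropy Pstar →
      (∀ᶠ n : ℕ in atTop ⊓ 𝓟 N,
        (∀ L : ℕ, (L : ℝ) < A.capacity / δ →
          uniformProb {c : CodewordTuple n (codeSize n R) (τ n) |
              A.IsListDecodable L (Set.range c.encoder)}
            ≤ (2 : ℝ) ^ (-((n : ℝ) * δ) + 2 / δ * Real.logb 2 (1 / δ))) ∧
        1 - (2 : ℝ) ^ (-((n : ℝ) * (1 - R)))
            - (2 : ℝ) ^ (-((n : ℝ) * δ) + 2 / δ * Real.logb 2 (1 / δ))
          ≤ uniformProb {K : ConstCompCode n (codeSize n R) (τ n) |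
              A.ListSizeRange δ (A.listSize K.1)}) ∧
      Tendsto (fun n : ℕ => uniformProb {K : ConstCompCode n (codeSize n R) (τ n) |
          A.ListSizeRange δ (A.listSize K.1)})
        (atTop ⊓ 𝓟 N) (𝓝 1)) := by
  -- Only the constancy of `b` in `n` matters from here on.
  set b : ℝ := 2 / δ * Real.logb 2 (1 / δ) with hb
  have hYne := hP.nonempty_output
  have hg : ∀ n : ℕ, 0 ≤ (2 : ℝ) ^ (-((n : ℝ) * δ) + b) := fun n => by positivity
  have hL1 : ∀ L : ℕ, 1 ≤ L → L * δ < A.capacity → _ := fun L hL hLC =>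
    AdversarialChannel.eventually_uniformProb_isMessageListDecodable_le hP hN hτ hlim hδ hR hL hLC b
  have hlow := AdversarialChannel.eventually_forall_lt_capacity_div (A := A) hδ
    (f := fun n L => uniformProb {c : CodewordTuple n (codeSize n R) (τ n) |
      A.IsMessageListDecodable L c.encoder})
    (fun n => (AdversarialChannel.uniformProb_zero_decodable_eq_zero (A := A) (τ n)).1) hg hL1
  -- The second rate `θ > 0` gives convergence to `1` even for `R ≥ 1`, where `2^(-n(1-R))` does not
  -- tend to zero.
  obtain ⟨L₀, hL₀, θ, hθ, hup⟩ := hP.exists_sufficient_listSize hτ hlim hδ hR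
  have hmem : ∀ᶠ n in atTop ⊓ 𝓟 N, n ∈ N :=
    eventually_inf_principal.2 (Eventually.of_forall fun n hn => hn)
  have hcodes := hP.eventually_nonempty_constCompCode hτ hlim hδ hR
  have hmsg : ∀ᶠ n : ℕ in atTop ⊓ 𝓟 N, ∃ u : ℝ, u ≤ (2 : ℝ) ^ (-((n : ℝ) * (1 - R))) ∧
      u ≤ (2 : ℝ) ^ (-((n : ℝ) * θ)) ∧ 1 - u - (2 : ℝ) ^ (-((n : ℝ) * δ) + b)
        ≤ uniformProb {c : CodewordTuple n (codeSize n R) (τ n) |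
          A.ListSizeRange δ (A.messageListSize c.encoder)} := by
    filter_upwards [hlow, hup, hmem] with n hlow hup hnN
    obtain ⟨u, hu1, hu2, hu3, -⟩ := hup
    obtain ⟨x₀, hx₀⟩ := hτ n hnN
    have : Nonempty (typeClass n (τ n)) := ⟨⟨x₀, hx₀⟩⟩
    exact ⟨u, hu1, hu2, AdversarialChannel.le_uniformProb_listSizeRange_sInf hL₀
      (fun L (c : CodewordTuple n (codeSize n R) (τ n)) => A.IsMessageListDecodable L c.encoder)
      (fun L c h => h.succ) hu3 (hg n) hlow⟩
  refine ⟨⟨?_, ?_⟩, ?_, fun hC => ?_⟩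
  · filter_upwards [hlow, hmsg] with n hlow hmsg
    obtain ⟨u, hu1, -, hu⟩ := hmsg
    exact ⟨hlow, by linarith⟩
  · refine AdversarialChannel.tendsto_one_of_eventually_le hθ hδ (b := b)
      (fun n => uniformProb_le_one _) ?_
    filter_upwards [hmsg] with n hmsg
    obtain ⟨u, -, hu2, hu⟩ := hmsg
    linarith
  · filter_upwards [hup, hcodes] with n hup hcodes
    obtain ⟨u, hu1, -, -, hu4⟩ := hup
    have h1 := uniformProb_add_compl
      {K : ConstCompCode n (codeSize n R) (τ n) | A.IsListDecodable L₀ K.1}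
    have h2 : uniformProb {K : ConstCompCode n (codeSize n R) (τ n) | A.IsListDecodable L₀ K.1}
        ≤ uniformProb {K : ConstCompCode n (codeSize n R) (τ n) |
            ∃ L : ℕ, A.ListSizeRange δ L ∧ A.IsListDecodable L K.1} :=
      uniformProb_mono fun K hK => ⟨L₀, hL₀, hK⟩
    have h3 : uniformProb
        {K : ConstCompCode n (codeSize n R) (τ n) | A.IsListDecodable L₀ K.1}ᶜ ≤ u := hu4
    linarith [hg n]
  · have hL2 : ∀ L : ℕ, 1 ≤ L → L * δ < A.capacity → _ := fun L hL hLC =>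
      AdversarialChannel.eventually_uniformProb_isListDecodable_range_le hP hN hτ hlim hC hδ hR hL
        hLC b
    have hlow' := AdversarialChannel.eventually_forall_lt_capacity_div (A := A) hδ
      (f := fun n L => uniformProb {c : CodewordTuple n (codeSize n R) (τ n) |
        A.IsListDecodable L (Set.range c.encoder)})
      (fun n => (AdversarialChannel.uniformProb_zero_decodable_eq_zero (A := A) (τ n)).2) hg hL2
    have hcode : ∀ᶠ n : ℕ in atTop ⊓ 𝓟 N, ∃ u : ℝ, u ≤ (2 : ℝ) ^ (-((n : ℝ) * (1 - R))) ∧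
        u ≤ (2 : ℝ) ^ (-((n : ℝ) * θ)) ∧ 1 - u - (2 : ℝ) ^ (-((n : ℝ) * δ) + b)
          ≤ uniformProb {K : ConstCompCode n (codeSize n R) (τ n) |
            A.ListSizeRange δ (A.listSize K.1)} := by
      filter_upwards [hlow', hup, hmem, hcodes] with n hlow' hup hnN hcodes
      obtain ⟨u, hu1, hu2, -, hu4⟩ := hup
      exact ⟨u, hu1, hu2, AdversarialChannel.le_uniformProb_listSizeRange_sInf hL₀
        (fun L (K : ConstCompCode n (codeSize n R) (τ n)) => A.IsListDecodable L K.1)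
        (fun L K h => h.succ) hu4 (hg n) fun L hL =>
          (AdversarialChannel.uniformProb_constCompCode_le_uniformProb_tuple (hτ n hnN)).trans
            (hlow' L hL)⟩
    refine ⟨?_, ?_⟩
    · filter_upwards [hlow', hcode] with n hlow' hcode
      obtain ⟨u, hu1, -, hu⟩ := hcode
      exact ⟨hlow', by linarith⟩
    · refine AdversarialChannel.tendsto_one_of_eventually_le hθ hδ (b := b)
        (fun n => uniformProb_le_one _) ?_
      filter_upwards [hcode] with n hcode
      obtain ⟨u, -, hu2, hu⟩ := hcode
      linarith
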